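/- **Setting.** Let $\xi=(\xi_n)_{n\ge1}$ be i.i.d. random variables on a probability space $(\Omega,\mathscr A,\mathbf P)$; each value of $\xi_n$ determines (measurably) a point process law $\mathcal L(\xi_n)$ on $\mathbb R$. Given $\xi$ and $a\in\mathbb R$, let $\mathbb P_{\xi,a}$ be the law of the branching random walk in which the root $\varnothing$ sits at $V(\varnothing)=a$ and, independently of one another, the particles of generation $n$ have children displaced from them according to a point process $L_{n+1}$ with law $\mathcal L(\xi_{n+1})$. Write $V(u)$ for the position of $u$, $|u|$ for its generation, $u_k$ for its ancestor in generation $k$, $\mathbb P_\xi=\mathbb P_{\xi,0}$, $\mathbb E[\cdot]=\int\mathbb E_\xi[\cdot]\,d\mathbf P$, and (for fixed $\xi$) $\mathscr F_n=\sigma((u,V(u)),|u|\le n)$. Assume that $\mathbf P$-a.s. $\mathbb P_\xi(\sum_{|u|=1}1\ge1)=1$, $\ \mathbb E_\xi[\sum_{|u|=1}\mathbf 1_{\{V(u)>0\}}e^{-V(u)}]>0$, $\ \mathbb E_\xi[\sum_{|u|=1}e^{-V(u)}]=1$ and $\mathbb E_\xi[\sum_{|u|=1}V(u)e^{-V(u)}]=0$;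 that $\mathbf P\big[\mathbb P_\xi(\sum_{|u|=1}1>1)>0\big]>0$; and that $\mathbb E[\sum_{|u|=1}|V(u)|^{2+\delta}e^{-V(u)}]<\infty$ for some $\delta>0$. Under $\mathbb P_{\xi,a}$ let also $S_n=a+X_1+\dots+X_n$, with independent steps $X_n$ of law $\mu_n(B)=\mathbb E_\xi[\sum_{x\in L_n}\mathbf 1_{\{x\in B\}}e^{-x}]$. With $\theta\xi=(\xi_2,\xi_3,\dots)$ and $\tau_y=\inf\{n\ge1:y+S_n<0\}$ put, for $y\ge0$, $$U(\xi,y)=\lim_{n\to\infty}\mathbb E_\xi\big[(y+S_n)\mathbf 1_{\{\tau_y>n\}}\big].$$ For $\beta\ge0$, $a\ge0$ and $|v|=n$ let $$D_n^{(\beta)}(v)=U(\theta^n\xi,V(v)+\beta)\,e^{-V(v)}\,\mathbf 1_{\{\min_{0\le k\le n}V(v_k)\ge-\beta\}},\qquad D_n^{(\beta)}=\sum_{|v|=n}D_n^{(\beta)}(v).$$ Let $\mathbb Q^{(\beta)}_{\xi,a}$ be the law of the following branching random walk with a spine $(w_n)_{n\ge0}$, where $w_0=\varnothing$ and $V(\varnothing)=a$.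 A spine particle $w_n$ at $x$ produces children according to the law of $L_{n+1}$ reweighted by the density $\sum_{i}U(\theta^{n+1}\xi,y_i+\beta)e^{-y_i}\mathbf 1_{\{y_i\ge-\beta\}}\big/\big(U(\theta^n\xi,x+\beta)e^{-x}\big)$, where $y_i$ are the positions of the children; given these, $w_{n+1}$ is chosen among them with probability proportional to $U(\theta^{n+1}\xi,y_i+\beta)e^{-y_i}\mathbf 1_{\{y_i\ge-\beta\}}$. All other particles reproduce independently as under $\mathbb P_{\xi,a}$. **Proposition (Law of the spine).** For $\mathbf P$-almost every $\xi$, the limits $U(\theta^n\xi,y)$ exist and are positive and finite for all $n\ge0$, $y\ge0$, and for all $\beta\ge0$, $a\ge0$ the following hold. (0) On the space of marked trees, $\dfrac{d\mathbb Q^{(\beta)}_{\xi,a}}{d\mathbb P_{\xi,a}}\Big|_{\mathscr F_n}=\dfrac{D_n^{(\beta)}}{U(\xi,a+\beta)e^{-a}}$ for every $n\ge0$. (1) For every $n$, $0<D_n^{(\beta)}<\infty$ $\mathbb Q^{(\beta)}_{\xi,a}$-a.s., and for every label $v$ with $|v|=n$, $\mathbb Q^{(\beta)}_{\xi,a}$-a.s.,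 $$\mathbb Q^{(\beta)}_{\xi,a}(w_n=v\mid\mathscr F_n)=\frac{D_n^{(\beta)}(v)}{D_n^{(\beta)}},$$ where $D_n^{(\beta)}(v)=0$ if $v$ is not in the tree. (2) Under $\mathbb Q^{(\beta)}_{\xi,a}$ the process $(V(w_n))_{n\ge0}$ is distributed as the random walk $(S_n)_{n\ge0}$ under $\mathbb P_{\xi,a}$ conditioned to stay in $[-\beta,\infty)$, that is, as the Markov chain started at $a$ whose transition kernel from time $k$ to time $k+1$ is $$\frac{U(\theta^{k+1}\xi,y+\beta)\mathbf 1_{\{y\ge-\beta\}}}{U(\theta^k\xi,x+\beta)}\,\mathbb P_{\theta^k\xi,x}(S_1\in dy).$$ Equivalently, for all $n$ and all measurable $f:\mathbb R^{n+1}\to[0,\infty]$, $$\mathbb E_{\mathbb Q^{(\beta)}_{\xi,a}}\big[f(V(w_0),\dots,V(w_n))\big]=\mathbb E_{\xi,a}\Big[f(S_0,\dots,S_n)\frac{U(\theta^n\xi,S_n+\beta)}{U(\xi,a+\beta)}\mathbf 1_{\{\min_{0\le k\le n}S_k\ge-\beta\}}\Big].$$ -/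

import Mathlib

open MeasureTheory ProbabilityTheory Filter Topology
open scoped ENNReal

namespace BRWRE

noncomputable section

/-! ### Point processes and marked trees -/

/-- The (labelled) children of a particle: `b i` is the displacement of the `i`-th child, and
`b i = ⊤` means that there is no `i`-th child. A point process law is a probability measure on
this space; infinitely many children are allowed. -/
abbrev Brood : Type := ℕ → WithTop ℝ

/-- A marked tree: every Ulam--Harris label carries a brood. A label is a word of natural numbers
written with the youngest letter first: `[]` is the root and `i :: u` is the `i`-th child of `u`.
The generation of `u` is `u.length`. -/
abbrev Tree : Type := List ℕ → Brood

/-- `g` evaluated at the position `z` of an existing particle, and `0` if the particle does not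
exist. -/
def atPos {M : Type*} [Zero M] (g : ℝ → M) (z : WithTop ℝ) : M :=
  WithTop.recTopCoe (C := fun _ => M) 0 g z

/-- `∑_{x ∈ b} g x`. -/
def childSum (g : ℝ → ℝ≥0∞) (b : Brood) : ℝ≥0∞ := ∑' i, atPos g (b i)

/-- The position `V(u)` of the particle `u` when the root sits at `a`; `V(u) = ⊤` exactly when
`u` does not belong to the genealogical tree. -/
def position (a : ℝ) (T : Tree) : List ℕ → WithTop ℝ
  | [] => (a : WithTop ℝ)
  | i :: u => position a T u + T u i

/-- The ancestor `u_k` of `u` in generation `k ≤ |u|`. -/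
def ancestor (u : List ℕ) (k : ℕ) : List ℕ := u.drop (u.length - k)

lemma measurable_position (a : ℝ) (u : List ℕ) : Measurable fun T : Tree => position a T u := by
  induction u with
  | nil => exact measurable_const
  | cons i u ih =>
    have h : Measurable fun T : Tree => T u i := by fun_prop
    have key : (fun T : Tree => position a T (i :: u)) = fun T =>
        if position a T u = ⊤ ∨ T u i = ⊤ then ⊤ else
          (((position a T u).untopD 0 + (T u i).untopD 0 : ℝ) : WithTop ℝ) := by
      funext T
      change position a T u + T u i = _
      cases position a T u <;> cases T u i <;> simp [← WithTop.coe_add]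
    rw [key]
    exact Measurable.ite ((ih (measurableSet_singleton ⊤)).union (h (measurableSet_singleton ⊤)))
      measurable_const ((ih.untopD 0).add (h.untopD 0)).withTop_coe

/-- The σ-field generated by `(u, V(u))`, `|u| ≤ n`. -/
@[reducible] def treeField (a : ℝ) (n : ℕ) : MeasurableSpace Tree :=
  ⨆ u ∈ {u : List ℕ | u.length ≤ n},
    MeasurableSpace.comap (fun T : Tree => position a T u) inferInstance

lemma treeField_le (a : ℝ) (n : ℕ) : treeField a n ≤ (inferInstance : MeasurableSpace Tree) :=
  iSup₂_le fun u _ => (measurable_position a u).comap_le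

/-! ### Environment, quenched branching random walk and associated random walk -/

/-- The shift `θ^n` of the environment. The entry `e k` is the environment of the reproduction
of the particles of generation `k`, that is `ξ_{k+1}`. -/
def shift {E : Type*} (n : ℕ) (e : ℕ → E) : ℕ → E := fun k => e (k + n)

section

variable {E : Type*} [MeasurableSpace E]

/-- The quenched law of the time-inhomogeneous branching random walk: independent broods, the
brood of `u` having the law attached to the environment `e |u|`. -/
def treeLaw (law : Kernel E Brood) (e : ℕ → E) : Measure Tree :=
  Measure.infinitePi fun u : List ℕ => law (e u.length)

/-- The measure `B ↦ E[∑_{x ∈ L} 1_{x ∈ B} e^{-x}]`, where `L` has law `ν`. -/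
def stepLaw (ν : Measure Brood) : Measure ℝ :=
  Measure.sum fun i : ℕ =>
    (ν.withDensity fun b => atPos (fun x => ENNReal.ofReal (Real.exp (-x))) (b i)).map
      fun b => (b i).untopD 0

instance (ν : Measure Brood) [SFinite ν] : SFinite (stepLaw ν) := by
  unfold stepLaw; infer_instance

/-- The quenched law of the random walk `(S_n)_{n ≥ 0}` with `S_0 = a` and independent steps,
the `(k+1)`-st step having law `stepLaw (law (e k))`. -/
def walkLaw (law : Kernel E Brood) (e : ℕ → E) (a : ℝ) : Measure (ℕ → ℝ) :=
  (Measure.infinitePi fun k : ℕ => stepLaw (law (e k))).map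
    fun X n => a + ∑ i ∈ Finset.range n, X i

open Classical in
/-- `U_n(ξ, y) = E_ξ[(y + S_n) 1_{τ_y > n}]`, where `τ_y = inf {k ≥ 1 : y + S_k < 0}`. -/
def Un (law : Kernel E Brood) (n : ℕ) (e : ℕ → E) (y : ℝ) : ℝ :=
  ∫ s, (if ∀ k, 1 ≤ k → k ≤ n → 0 ≤ y + s k then y + s n else 0) ∂(walkLaw law e 0)

/-- The quenched harmonic function `U(ξ, y) = lim_n U_n(ξ, y)`. -/
def U (law : Kernel E Brood) (e : ℕ → E) (y : ℝ) : ℝ :=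
  limUnder atTop fun n => Un law n e y

/-! ### The truncated derivative martingale -/

open Classical in
/-- `U(θ^n ξ, V(v) + β) e^{-V(v)} 1_{min_{k ≤ n} V(v_k) ≥ -β}` with `n = |v|`, and `0` if the
particle `v` does not exist. -/
def Dv (law : Kernel E Brood) (e : ℕ → E) (β a : ℝ) (T : Tree) (v : List ℕ) : ℝ≥0∞ :=
  atPos (fun x =>
    if ∀ k ≤ v.length, ((-β : ℝ) : WithTop ℝ) ≤ position a T (ancestor v k) then
      ENNReal.ofReal (U law (shift v.length e) (x + β) * Real.exp (-x)) else 0)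
    (position a T v)

/-- The truncated derivative martingale `D_n^{(β)}`. -/
def D (law : Kernel E Brood) (e : ℕ → E) (β a : ℝ) (n : ℕ) (T : Tree) : ℝ≥0∞ :=
  ∑' v : {v : List ℕ // v.length = n}, Dv law e β a T v

end

/-! ### Kernels given by densities, and Markov chains -/

section

variable {α γ : Type*} [MeasurableSpace α] [MeasurableSpace γ]

lemma measurableSet_mass_eq_one (κ : Kernel α γ) [IsSFiniteKernel κ] (f : α → γ → ℝ≥0∞) :
    MeasurableSet {x | κ.withDensity f x Set.univ = 1} :=
  (κ.withDensity f).measurable_coe MeasurableSet.univ (measurableSet_singleton 1)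

open Classical in
/-- The kernel with density `f` with respect to `κ`, at the points where this is a probability
measure; the kernel `η` elsewhere (this only serves to have a Markov kernel everywhere). -/
def densityKernel (κ : Kernel α γ) [IsSFiniteKernel κ] (f : α → γ → ℝ≥0∞) (η : Kernel α γ) :
    Kernel α γ :=
  Kernel.piecewise (measurableSet_mass_eq_one κ f) (κ.withDensity f) η

instance (κ : Kernel α γ) [IsSFiniteKernel κ] (f : α → γ → ℝ≥0∞) (η : Kernel α γ)
    [IsMarkovKernel η] : IsMarkovKernel (densityKernel κ f η) := by
  refine ⟨fun x => ⟨?_⟩⟩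
  unfold densityKernel
  rw [Kernel.piecewise_apply']
  split_ifs with h
  · exact h
  · exact measure_univ

/-- The law of the Markov chain started at `x₀` whose `n`-th transition kernel is `κ n`. -/
def chainLaw (κ : ℕ → Kernel α α) [∀ n, IsMarkovKernel (κ n)] (x₀ : α) : Measure (ℕ → α) :=
  Kernel.traj (X := fun _ => α)
    (fun n => (κ n).comap (fun h : (i : Finset.Iic n) → α => h ⟨n, by simp⟩)
      (measurable_pi_apply _)) 0 (fun _ => x₀)

instance (κ : ℕ → Kernel α α) [∀ n, IsMarkovKernel (κ n)] (x₀ : α) :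
    IsProbabilityMeasure (chainLaw κ x₀) := by
  unfold chainLaw; infer_instance

end

section

variable {E : Type*} [MeasurableSpace E]

/-! ### The random walk conditioned to stay above `-β` -/

open Classical in
/-- The `h`-transformed transition kernel from time `k` to time `k + 1`:
`U(θ^{k+1} ξ, y + β) 1_{y ≥ -β} / U(θ^k ξ, x + β) · P_{θ^k ξ, x}(S_1 ∈ dy)`. -/
def condKernel (law : Kernel E Brood) [IsMarkovKernel law] (e : ℕ → E) (β : ℝ) (k : ℕ) :
    Kernel ℝ ℝ :=
  densityKernel ((Kernel.id ×ₖ Kernel.const ℝ (stepLaw (law (e k)))).map fun p => p.1 + p.2)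
    (fun x y => if -β ≤ y then
      ENNReal.ofReal (U law (shift (k + 1) e) (y + β) / U law (shift k e) (x + β)) else 0)
    Kernel.id

instance (law : Kernel E Brood) [IsMarkovKernel law] (e : ℕ → E) (β : ℝ) (k : ℕ) :
    IsMarkovKernel (condKernel law e β k) := by
  unfold condKernel; infer_instance

/-- The law of the random walk in random environment, started at `a` and conditioned (in the
sense of Doob's `h`-transform by `U`) to stay in `[-β, ∞)`. -/
def condWalkLaw (law : Kernel E Brood) [IsMarkovKernel law] (e : ℕ → E) (β a : ℝ) :
    Measure (ℕ → ℝ) :=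
  chainLaw (condKernel law e β) a

/-! ### The branching random walk with a spine -/

open Classical in
/-- The weight `U(θ^{k+1} ξ, V + β) e^{-V} 1_{V ≥ -β}` of a child at displacement `z` from its
parent, the parent being in generation `k` and at position `x`, so that `V = x + z`. -/
def childWeight (law : Kernel E Brood) (e : ℕ → E) (β : ℝ) (k : ℕ) (x : ℝ) (z : WithTop ℝ) :
    ℝ≥0∞ :=
  atPos (fun y => if -β ≤ y then
    ENNReal.ofReal (U law (shift (k + 1) e) (y + β) * Real.exp (-y)) else 0) ((x : WithTop ℝ) + z)

/-- The law of the brood of the spine particle of generation `k` at position `x`: the first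
brood under `Q_{θ^k ξ, x}`, with density `D_1 / (U(θ^k ξ, x + β) e^{-x})` with respect to the law
of a normal brood. -/
def spineBrood (law : Kernel E Brood) [IsMarkovKernel law] (e : ℕ → E) (β : ℝ) (k : ℕ) :
    Kernel ℝ Brood :=
  densityKernel (Kernel.const ℝ (law (e k)))
    (fun x b => (∑' i, childWeight law e β k x (b i)) /
      ENNReal.ofReal (U law (shift k e) (x + β) * Real.exp (-x)))
    (Kernel.const ℝ (law (e k)))

/-- The choice of the next spine particle among the children of the present one, with
probability proportional to the weights of the children. -/
def spineChoice (law : Kernel E Brood) (e : ℕ → E) (β : ℝ) (k : ℕ) : Kernel (ℝ × Brood) ℕ :=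
  densityKernel (Kernel.const (ℝ × Brood) Measure.count)
    (fun p i => childWeight law e β k p.1 (p.2 i) / ∑' j, childWeight law e β k p.1 (p.2 j))
    (Kernel.const (ℝ × Brood) (Measure.dirac 0))

instance (law : Kernel E Brood) [IsMarkovKernel law] (e : ℕ → E) (β : ℝ) (k : ℕ) :
    IsMarkovKernel (spineBrood law e β k) := by
  unfold spineBrood; infer_instance

instance (law : Kernel E Brood) (e : ℕ → E) (β : ℝ) (k : ℕ) :
    IsMarkovKernel (spineChoice law e β k) := by
  unfold spineChoice; infer_instance

/-- The state of the spine in generation `n`: the position of `w_n` and, for `n ≥ 1`, the brood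
of `w_{n-1}` and the label of `w_n` among the children of `w_{n-1}`. -/
abbrev SpineState : Type := ℝ × Brood × ℕ

lemma measurable_spineMove :
    Measurable fun p : ℝ × Brood × ℕ => (p.1 + (p.2.1 p.2.2).untopD 0, p.2) := by
  have h : Measurable fun q : Brood × ℕ => q.1 q.2 :=
    measurable_from_prod_countable_left fun i => measurable_pi_apply i
  exact (measurable_fst.add ((h.comp measurable_snd).untopD 0)).prodMk measurable_snd

/-- One generation of the spine: produce a brood, choose one of the children, move to it. -/
def spineKernel (law : Kernel E Brood) [IsMarkovKernel law] (e : ℕ → E) (β : ℝ) (k : ℕ) :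
    Kernel SpineState SpineState :=
  ((Kernel.id ×ₖ (spineBrood law e β k ⊗ₖ spineChoice law e β k)).map
    fun p : ℝ × Brood × ℕ => (p.1 + (p.2.1 p.2.2).untopD 0, p.2)).comap Prod.fst measurable_fst

instance (law : Kernel E Brood) [IsMarkovKernel law] (e : ℕ → E) (β : ℝ) (k : ℕ) :
    IsMarkovKernel (spineKernel law e β k) := by
  unfold spineKernel
  have := Kernel.IsMarkovKernel.map
    (Kernel.id ×ₖ (spineBrood law e β k ⊗ₖ spineChoice law e β k)) measurable_spineMove
  infer_instance

/-- The law of the sequence of states of the spine, started at `a` (the brood and the label in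
the initial state are dummies). -/
def spineLaw (law : Kernel E Brood) [IsMarkovKernel law] (e : ℕ → E) (β a : ℝ) :
    Measure (ℕ → SpineState) :=
  chainLaw (spineKernel law e β) (a, fun _ => ⊤, 0)

/-- The spine particle `w_n`, read off from the sequence of labels of the spine. -/
def spine (c : ℕ → ℕ) : ℕ → List ℕ
  | 0 => []
  | n + 1 => c n :: spine c n

/-- The tree in which the spine particles have the broods recorded in `s` and all the other
particles have the broods given by `T`, together with the labels of the spine. -/
def graft (p : (ℕ → SpineState) × Tree) : Tree × (ℕ → ℕ) :=
  (fun u => if u = spine (fun k => (p.1 (k + 1)).2.2) u.length then (p.1 (u.length + 1)).2.1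
    else p.2 u, fun k => (p.1 (k + 1)).2.2)

lemma measurable_graft : Measurable graft := by
  have hc : ∀ k, Measurable fun p : (ℕ → SpineState) × Tree => (p.1 (k + 1)).2.2 := by
    intro k; fun_prop
  have hs : ∀ n u, MeasurableSet {p : (ℕ → SpineState) × Tree |
      u = spine (fun k => (p.1 (k + 1)).2.2) n} := by
    intro n
    induction n with
    | zero => intro u; exact MeasurableSet.const (u = [])
    | succ n ih =>
      intro u
      cases u with
      | nil => simp [spine]
      | cons i u =>
        have h := ((hc n) (measurableSet_singleton i)).inter (ih u)
        convert h using 1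
        ext p
        simp [spine, eq_comm]
  refine Measurable.prodMk (measurable_pi_lambda _ fun u => ?_) (measurable_pi_lambda _ hc)
  exact Measurable.ite (hs _ _) (by fun_prop) (by fun_prop)

/-- The quenched law of the branching random walk with a spine: the spine particles reproduce
according to `spineBrood` and choose their successor according to `spineChoice`, all the other
particles reproduce independently as in the original branching random walk. -/
def spinalLaw (law : Kernel E Brood) [IsMarkovKernel law] (e : ℕ → E) (β a : ℝ) :
    Measure (Tree × (ℕ → ℕ)) :=
  ((spineLaw law e β a).prod (treeLaw law e)).map graft

instance (law : Kernel E Brood) [IsMarkovKernel law] (e : ℕ → E) (β a : ℝ) :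
    IsProbabilityMeasure (spinalLaw law e β a) := by
  unfold spinalLaw spineLaw treeLaw
  exact Measure.isProbabilityMeasure_map measurable_graft.aemeasurable

end

end

end BRWRE

namespace BRWRE

noncomputable section

set_option linter.unusedSectionVars false

/-! ### Resampling a coordinate of a product measure -/

/-! The proof separates a probabilistic statement about the environment from an exact computation in
each good environment.

Environment. Let `ν k` be the step laws of the associated walk. For centered steps, killing below
the origin only removes negative values, so the killed means of `y + S_n` increase with `n`. Their
supremum `harmonic` therefore always exists in `[0, ∞]`; it is harmonic by monotone convergence
(`harmonic_eq_killedStep`) and positive because every step charges `(0, ∞)`. What remains is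
finiteness. Averaging over the i.i.d. environment turns the walk into one with a single centered
step law having a moment of order `2 + δ`. For that law `t + t ^ (1 - ε)`, with `t = x + R`, is
superharmonic for the killed walk: the concavity of the power gains order `t ^ (-1 - ε)`, while
large jumps cost at most order `t ^ (-1 - δ)`, and `ε < δ` (`CenteredStep.exists_superharmonic`).
Resampling the environment of one step at a time, this function bounds the mean of `harmonic` over
the environment, so `harmonic` is almost surely finite (`ae_harmonic_ne_top`). Stationarity gives
the same for all shifts, whence `ae_goodEnv`.

Fixed good environment. Harmonicity and the many-to-one formula say exactly that the reweighted
kernels have mass one. The total weight of the spine's brood is the numerator of the brood density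
and the denominator of the choice of child; it cancels (`GoodEnv.lintegral_spineKernel`), and only
the weight of the chosen child survives. These factors telescope along a line of descent, so
choosing the line `v` with prescribed broods has the weight `Dv` divided by its initial value
(`lintegral_spineLaw`). The broods off the spine are independent and unchanged, which gives `Q(w_n =
v, A) = E[D_n(v); A] / (U e^{-a})` for `A` in `ℱ_n` (`spinalLaw_inter`). Summation over `v` yields
the density on `ℱ_n`, and comparison of the two formulas yields the conditional law of `w_n`.

For the positions, the spine and the conditioned walk are both Markov chains whose observed
transitions are those of the walk weighted by `h (k + 1) / h k`. Both have the finite-dimensional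
laws given by `lintegral_chainLaw_eq_walk`, and these determine the law of the path. -/

lemma map_update_infinitePi {ι : Type*} [DecidableEq ι] {X : ι → Type*}
    [∀ i, MeasurableSpace (X i)] (μ : ∀ i, Measure (X i)) [∀ i, IsProbabilityMeasure (μ i)]
    (i : ι) :
    ((Measure.infinitePi μ).prod (μ i)).map (fun p => Function.update p.1 i p.2) =
      Measure.infinitePi μ := by
  refine Measure.eq_infinitePi μ fun s t ht => ?_
  have hm : Measurable fun p : (∀ j, X j) × X i => Function.update p.1 i p.2 :=
    measurable_update'
  rw [Measure.map_apply hm (MeasurableSet.pi s.countable_toSet fun j _ => ht j)]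
  have key : (fun p : (∀ j, X j) × X i => Function.update p.1 i p.2) ⁻¹' (Set.pi s t) =
      (Set.pi (s.erase i : Finset ι) t) ×ˢ (if i ∈ s then t i else Set.univ) := by
    ext p
    simp only [Set.mem_preimage, Set.mem_pi, Finset.mem_coe, Set.mem_prod, Finset.mem_erase]
    constructor
    · intro h
      refine ⟨fun j hj => by simpa [hj.1] using h j hj.2, ?_⟩
      split_ifs with hi
      · simpa using h i hi
      · trivial
    · rintro ⟨h1, h2⟩ j hj
      by_cases hji : j = i
      · subst hji; simpa [hj] using h2
      · simpa [hji] using h1 j ⟨hji, hj⟩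
  rw [key, Measure.prod_prod, Measure.infinitePi_pi _ fun j _ => ht j]
  split_ifs with hi
  · rw [Finset.prod_erase_mul _ _ hi]
  · rw [Finset.erase_eq_of_notMem hi]; simp

/-- This replaces conditioning on all other coordinates. It is applied to the last step of a walk,
to one entry of the environment and to the brood of one particle. -/
lemma lintegral_infinitePi_update {ι : Type*} [DecidableEq ι] {X : ι → Type*}
    [∀ i, MeasurableSpace (X i)] (μ : ∀ i, Measure (X i)) [∀ i, IsProbabilityMeasure (μ i)]
    (i : ι) {G : (∀ j, X j) → ℝ≥0∞} (hG : Measurable G) :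
    ∫⁻ x, G x ∂(Measure.infinitePi μ) =
      ∫⁻ x, ∫⁻ y, G (Function.update x i y) ∂(μ i) ∂(Measure.infinitePi μ) := by
  have hm : Measurable fun p : (∀ j, X j) × X i => Function.update p.1 i p.2 :=
    measurable_update'
  conv_lhs => rw [← map_update_infinitePi μ i]
  rw [lintegral_map hG hm]
  exact lintegral_prod _ (hG.comp hm).aemeasurable

/-! ### Partial sums and Markov chains -/

/-- The path of the partial sums of `X`, started at `a`. -/
def path (a : ℝ) (X : ℕ → ℝ) : ℕ → ℝ := fun n => a + ∑ i ∈ Finset.range n, X i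

@[fun_prop]
lemma measurable_path (a : ℝ) : Measurable (path a) := by
  refine measurable_pi_lambda _ fun n => ?_
  unfold path
  fun_prop

@[simp] lemma path_zero (a : ℝ) (X : ℕ → ℝ) : path a X 0 = a := by simp [path]

lemma path_update_of_le (a : ℝ) (X : ℕ → ℝ) {n k : ℕ} (h : k ≤ n) (z : ℝ) :
    path a (Function.update X n z) k = path a X k := by
  unfold path
  congr 1
  refine Finset.sum_congr rfl fun i hi => ?_
  rw [Function.update_of_ne]
  have := Finset.mem_range.1 hi
  omega

lemma path_update_succ (a : ℝ) (X : ℕ → ℝ) (n : ℕ) (z : ℝ) :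
    path a (Function.update X n z) (n + 1) = path a X n + z := by
  have h := path_update_of_le a X le_rfl z (n := n)
  unfold path at *
  rw [Finset.sum_range_succ, ← add_assoc, h, Function.update_self]

/-- The path frozen after time `n`. -/
def freeze {α : Type*} (n : ℕ) (s : ℕ → α) : ℕ → α := fun k => s (min k n)

lemma freeze_of_le {α : Type*} {n k : ℕ} (h : k ≤ n) (s : ℕ → α) : freeze n s k = s k := by
  simp [freeze, h]

@[fun_prop]
lemma measurable_freeze {α : Type*} [MeasurableSpace α] (n : ℕ) :
    Measurable (freeze n : (ℕ → α) → ℕ → α) :=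
  measurable_pi_lambda _ fun _ => measurable_pi_apply _

section

variable {α : Type*} [MeasurableSpace α] (κ : ℕ → Kernel α α) [∀ n, IsMarkovKernel (κ n)] (x₀ : α)

/-- The Markov property at time `n`. Freezing makes the past a path again, still a function of the
coordinates up to `n`, so the composition-product description of the trajectory measure applies. -/
lemma lintegral_chainLaw_succ (n : ℕ) {F : (ℕ → α) × α → ℝ≥0∞} (hF : Measurable F) :
    ∫⁻ s, F (freeze n s, s (n + 1)) ∂(chainLaw κ x₀) =
      ∫⁻ s, ∫⁻ y, F (freeze n s, y) ∂(κ n (s n)) ∂(chainLaw κ x₀) := by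
  let κ' : (n : ℕ) → Kernel ((i : Finset.Iic n) → α) α := fun n =>
    (κ n).comap (fun h : (i : Finset.Iic n) → α => h ⟨n, by simp⟩) (measurable_pi_apply _)
  let G : ((i : Finset.Iic n) → α) → ℕ → α := fun h k => h ⟨min k n, by simp⟩
  have hG : Measurable G := measurable_pi_lambda _ fun _ => measurable_pi_apply _
  have hFG : Measurable fun p : ((i : Finset.Iic n) → α) × α => F (G p.1, p.2) :=
    hF.comp ((hG.comp measurable_fst).prodMk measurable_snd)
  have key := Kernel.partialTraj_compProd_eq_map_traj (X := fun _ => α) (κ := κ') (a := 0)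
    (b := n) (Nat.zero_le n) (x₀ := fun _ => x₀)
  have e1 : ∫⁻ s, F (freeze n s, s (n + 1)) ∂(chainLaw κ x₀) =
      ∫⁻ p, F (G p.1, p.2) ∂((chainLaw κ x₀).map
        (fun x ↦ (Preorder.frestrictLe (π := fun _ => α) n x, x (n + 1)))) := by
    rw [lintegral_map hFG (by fun_prop)]
    rfl
  rw [e1]
  change ∫⁻ p, F (G p.1, p.2) ∂((Kernel.traj κ' 0 fun _ => x₀).map
        (fun x ↦ (Preorder.frestrictLe (π := fun _ => α) n x, x (n + 1)))) = _
  rw [← key, Measure.lintegral_compProd hFG, ← Kernel.traj_map_frestrictLe,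
    Kernel.map_apply _ (by fun_prop), lintegral_map _ (by fun_prop)]
  · rfl
  · exact Measurable.lintegral_kernel_prod_right' hFG

lemma chainLaw_zero [MeasurableSingletonClass α] : ∀ᵐ s ∂(chainLaw κ x₀), s 0 = x₀ := by
  have h : (chainLaw κ x₀).map (Preorder.frestrictLe (π := fun _ => α) 0) =
      Measure.dirac (fun _ => x₀) := by
    unfold chainLaw
    rw [Kernel.traj_map_frestrictLe_apply, Kernel.partialTraj_self, Kernel.id_apply]
  have h2 : ∀ᵐ t ∂((chainLaw κ x₀).map (Preorder.frestrictLe (π := fun _ => α) 0)),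
      t ⟨0, by simp⟩ = x₀ := by
    rw [h, ae_dirac_iff]
    exact measurable_pi_apply (X := fun _ : Finset.Iic 0 => α) _ (measurableSet_singleton x₀)
  exact ae_of_ae_map (by fun_prop) h2

/-- If a Markov chain is observed through `π` and, above the level `-β`, its transitions are those
of the random walk with steps `step k` weighted by `h (k + 1) / h k`, then its finite-dimensional
laws are those of the random walk weighted by `h`. -/
theorem lintegral_chainLaw_eq_walk [MeasurableSingletonClass α] (π : α → ℝ) (hπ : Measurable π)
    (step : ℕ → Measure ℝ) [∀ n, IsProbabilityMeasure (step n)] (h : ℕ → ℝ → ℝ≥0∞)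
    (hh : ∀ n, Measurable (h n)) (β : ℝ) (h0 : ∀ n x, -β ≤ x → h n x ≠ 0)
    (htop : ∀ n x, -β ≤ x → h n x ≠ ⊤)
    (hκ : ∀ n x, -β ≤ π x → ∀ g : ℝ → ℝ≥0∞, Measurable g →
      ∫⁻ y, g (π y) ∂(κ n x) =
        ∫⁻ z, g (π x + z) * ((Set.Ici (-β)).indicator (h (n + 1)) (π x + z) / h n (π x)) ∂(step n))
    (ha : -β ≤ π x₀) (n : ℕ) {f : (ℕ → ℝ) → ℝ≥0∞} (hf : Measurable f) :
    ∫⁻ s, f (freeze n fun k => π (s k)) ∂(chainLaw κ x₀) =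
      ∫⁻ X, f (freeze n (path (π x₀) X)) *
        {s : ℕ → ℝ | ∀ k ≤ n, -β ≤ s k}.indicator (fun s => h n (s n) / h 0 (π x₀))
          (path (π x₀) X) ∂(Measure.infinitePi step) := by
  induction n generalizing f with
  | zero =>
    have e1 : ∀ᵐ s ∂(chainLaw κ x₀), f (freeze 0 fun k => π (s k)) = f fun _ => π x₀ := by
      filter_upwards [chainLaw_zero κ x₀] with s hs
      refine congrArg f (funext fun k => ?_)
      simp [freeze, hs]
    have e2 : ∀ X : ℕ → ℝ, f (freeze 0 (path (π x₀) X)) *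
        {s : ℕ → ℝ | ∀ k ≤ 0, -β ≤ s k}.indicator (fun s => h 0 (s 0) / h 0 (π x₀))
          (path (π x₀) X) = f fun _ => π x₀ := by
      intro X
      rw [Set.indicator_of_mem (by simpa using ha), path_zero,
        ENNReal.div_self (h0 0 _ ha) (htop 0 _ ha), mul_one]
      refine congrArg f (funext fun k => ?_)
      simp [freeze]
    rw [lintegral_congr_ae e1, lintegral_congr e2]
    simp
  | succ n ih =>
    -- `J` separates the past from the last value: a path frozen at `n + 1` takes the value of time
    -- `n + 1` at every later time.
    let J : (ℕ → ℝ) × ℝ → ℝ≥0∞ := fun p => f fun k => if k ≤ n then p.1 k else p.2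
    have hJ : Measurable J := by
      refine hf.comp (measurable_pi_lambda _ fun k => ?_)
      split_ifs <;> fun_prop
    have hJf : ∀ t : ℕ → ℝ, f (freeze (n + 1) t) = J (freeze n t, t (n + 1)) := by
      intro t
      refine congrArg f (funext fun k => ?_)
      by_cases hk : k ≤ n
      · simp [freeze, hk, show k ≤ n + 1 by omega]
      · simp [freeze, hk, show n + 1 ≤ k by omega]
    have hind : ∀ m, MeasurableSet {s : ℕ → ℝ | ∀ k ≤ m, -β ≤ s k} := by
      intro m
      have : {s : ℕ → ℝ | ∀ k ≤ m, -β ≤ s k} = ⋂ k, ⋂ (_ : k ≤ m), {s | -β ≤ s k} := by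
        ext; simp
      rw [this]
      exact MeasurableSet.iInter fun k => MeasurableSet.iInter fun _ =>
        measurableSet_le measurable_const (measurable_pi_apply k)
    -- The transitions are only known above `-β`. That the chain stays there follows from the
    -- induction hypothesis for the indicator of the complement, where the weight vanishes.
    have hbd : ∀ᵐ s ∂(chainLaw κ x₀), -β ≤ π (s n) := by
      have hB : MeasurableSet {t : ℕ → ℝ | t n < -β} :=
        measurableSet_lt (measurable_pi_apply n) measurable_const
      have := ih (f := {t : ℕ → ℝ | t n < -β}.indicator 1) (measurable_one.indicator hB)
      have h2 : ∀ X : ℕ → ℝ, {t : ℕ → ℝ | t n < -β}.indicator 1 (freeze n (path (π x₀) X)) *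
          {s : ℕ → ℝ | ∀ k ≤ n, -β ≤ s k}.indicator (fun s => h n (s n) / h 0 (π x₀))
            (path (π x₀) X) = 0 := by
        intro X
        by_cases hX : path (π x₀) X n < -β
        · rw [Set.indicator_of_notMem (s := {s : ℕ → ℝ | ∀ k ≤ n, -β ≤ s k}), mul_zero]
          exact fun hc => absurd (hc n le_rfl) (not_le.2 hX)
        · rw [Set.indicator_of_notMem, zero_mul]
          simpa [freeze] using hX
      have h3 : Measurable fun s : ℕ → α => ({t : ℕ → ℝ | t n < -β}.indicator 1
          (freeze n fun k => π (s k)) : ℝ≥0∞) := (measurable_one.indicator hB).comp (by fun_prop)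
      rw [lintegral_congr h2, lintegral_zero, lintegral_eq_zero_iff h3] at this
      filter_upwards [this] with s hs
      simpa [freeze, Set.indicator_apply] using hs
    let K : (ℕ → ℝ) × ℝ → ℝ≥0∞ := fun p =>
      J (p.1, p.1 n + p.2) * ((Set.Ici (-β)).indicator (h (n + 1)) (p.1 n + p.2) / h n (p.1 n))
    have hK : Measurable K := by
      have h1 : Measurable fun p : (ℕ → ℝ) × ℝ => p.1 n + p.2 := by fun_prop
      have h2 : Measurable fun p : (ℕ → ℝ) × ℝ => p.1 n := by fun_prop
      exact (hJ.comp (measurable_fst.prodMk h1)).mul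
        (((((hh (n + 1)).indicator measurableSet_Ici)).comp h1).div ((hh n).comp h2))
    have hL : ∫⁻ s, f (freeze (n + 1) fun k => π (s k)) ∂(chainLaw κ x₀) =
        ∫⁻ s, (fun t => ∫⁻ z, K (t, z) ∂(step n)) (freeze n fun k => π (s k))
          ∂(chainLaw κ x₀) := by
      have hF : Measurable fun p : (ℕ → α) × α => J (fun k => π (p.1 k), π p.2) :=
        hJ.comp (by fun_prop)
      calc _ = ∫⁻ s, (fun p : (ℕ → α) × α => J (fun k => π (p.1 k), π p.2))
            (freeze n s, s (n + 1)) ∂(chainLaw κ x₀) := lintegral_congr fun s => hJf _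
        _ = _ := by
          rw [lintegral_chainLaw_succ κ x₀ n hF]
          refine lintegral_congr_ae ?_
          filter_upwards [hbd] with s hs
          rw [hκ n (s n) hs (fun y => J (fun k => π (freeze n s k), y)) (hJ.comp (by fun_prop))]
          simp only [K, freeze_of_le le_rfl]
          rfl
    have hG : Measurable fun X : ℕ → ℝ => f (freeze (n + 1) (path (π x₀) X)) *
        {s : ℕ → ℝ | ∀ k ≤ n + 1, -β ≤ s k}.indicator
          (fun s => h (n + 1) (s (n + 1)) / h 0 (π x₀)) (path (π x₀) X) :=
      (hf.comp (by fun_prop)).mul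
        ((((hh (n + 1)).comp (measurable_pi_apply _)).div_const _ |>.indicator (hind _)).comp
          (measurable_path _))
    rw [hL, ih hK.lintegral_prod_right', lintegral_infinitePi_update step n hG]
    · refine lintegral_congr fun X => ?_
      by_cases hX : path (π x₀) X ∈ {s : ℕ → ℝ | ∀ k ≤ n, -β ≤ s k}
      · rw [Set.indicator_of_mem hX, ← lintegral_mul_const _ (by fun_prop)]
        refine lintegral_congr fun z => ?_
        have hX' : ∀ k ≤ n, -β ≤ path (π x₀) X k := hX
        have e1 : freeze n (path (π x₀) (Function.update X n z)) = freeze n (path (π x₀) X) :=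
          funext fun k => path_update_of_le _ _ (min_le_right _ _) _
        rw [hJf, e1, path_update_succ]
        simp only [K, freeze_of_le le_rfl]
        rw [mul_assoc]
        congr 1
        by_cases hz : -β ≤ path (π x₀) X n + z
        -- The telescoping: `h n` at the current position cancels, which needs it to be neither zero
        -- nor infinite.
        · rw [Set.indicator_of_mem (show _ ∈ Set.Ici (-β) from hz), Set.indicator_of_mem,
            path_update_succ, div_eq_mul_inv, div_eq_mul_inv, div_eq_mul_inv, mul_assoc,
              ← mul_assoc _ _ (h 0 (π x₀))⁻¹, ENNReal.inv_mul_cancel (h0 n _ (hX' n le_rfl))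
              (htop n _ (hX' n le_rfl)), one_mul]
          intro k hk
          rcases Nat.le_succ_iff.1 hk with hk | rfl
          · rw [path_update_of_le _ _ hk]; exact hX' k hk
          · rw [path_update_succ]; exact hz
        · rw [Set.indicator_of_notMem (show _ ∉ Set.Ici (-β) from hz), Set.indicator_of_notMem]
          · simp
          · intro hc
            have := hc (n + 1) le_rfl
            rw [path_update_succ] at this
            exact hz this
      · rw [Set.indicator_of_notMem hX, mul_zero]
        rw [← lintegral_zero (μ := step n)]
        refine lintegral_congr fun z => ?_
        rw [Set.indicator_of_notMem, mul_zero]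
        refine fun hc => hX fun k hk => ?_
        have := hc k (by omega)
        rwa [path_update_of_le _ _ hk] at this

end

/-! ### Functionals of a brood and the step law -/

lemma atPos_coe {M : Type*} [Zero M] (g : ℝ → M) (x : ℝ) : atPos g (x : WithTop ℝ) = g x := rfl

lemma atPos_top {M : Type*} [Zero M] (g : ℝ → M) : atPos g ⊤ = 0 := rfl

lemma measurable_atPos {M : Type*} [Zero M] [MeasurableSpace M] {g : ℝ → M} (hg : Measurable g) :
    Measurable (atPos g) := by
  have : atPos g = fun z : WithTop ℝ => if z = ⊤ then 0 else g (z.untopD 0) := by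
    funext z
    cases z <;> simp [atPos]
  rw [this]
  exact Measurable.ite (measurableSet_singleton ⊤) measurable_const
    (hg.comp (measurable_id.untopD 0))

lemma measurable_childSum {g : ℝ → ℝ≥0∞} (hg : Measurable g) : Measurable (childSum g) :=
  Measurable.tsum fun i => (measurable_atPos hg).comp (measurable_pi_apply i)

/-- The many-to-one formula for a single brood. Absent children carry density zero, so the default
value of `untopD` plays no role. -/
lemma lintegral_stepLaw (ν : Measure Brood) {g : ℝ → ℝ≥0∞} (hg : Measurable g) :
    ∫⁻ z, g z ∂(stepLaw ν) =
      ∫⁻ b, childSum (fun z => g z * ENNReal.ofReal (Real.exp (-z))) b ∂ν := by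
  have hm : ∀ i : ℕ, Measurable fun b : Brood => (b i).untopD 0 := fun i =>
    (measurable_pi_apply i : Measurable fun b : Brood => b i).untopD 0
  have hd : ∀ i : ℕ, Measurable fun b : Brood =>
      atPos (fun x => ENNReal.ofReal (Real.exp (-x))) (b i) := fun i =>
    (measurable_atPos (by fun_prop)).comp (measurable_pi_apply i)
  unfold stepLaw
  rw [lintegral_sum_measure]
  simp_rw [lintegral_map hg (hm _)]
  have hs : ∀ i : ℕ, Measurable fun b : Brood =>
      atPos (fun z => g z * ENNReal.ofReal (Real.exp (-z))) (b i) := fun i =>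
    (measurable_atPos (by fun_prop)).comp (measurable_pi_apply i)
  unfold childSum
  rw [lintegral_tsum fun i => (hs i).aemeasurable]
  refine tsum_congr fun i => ?_
  have hgm : Measurable fun b : Brood => g ((b i).untopD 0) := hg.comp (hm i)
  rw [lintegral_withDensity_eq_lintegral_mul _ (hd i) hgm]
  refine lintegral_congr fun b => ?_
  simp only [Pi.mul_apply]
  cases b i with
  | top => simp [atPos_top]
  | coe x => simp [atPos_coe, mul_comm]

/-! ### The random walk killed below the origin -/

/-- One step of the random walk with step law `ν`, killed below the origin. -/
def killedStep (ν : Measure ℝ) (g : ℝ → ℝ≥0∞) (x : ℝ) : ℝ≥0∞ :=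
  ∫⁻ z, (Set.Ici (0 : ℝ)).indicator g (x + z) ∂ν

/-- `n` steps of the random walk with step laws `ν 0, ν 1, …`, killed below the origin. -/
def killedIter : (ℕ → Measure ℝ) → ℕ → (ℝ → ℝ≥0∞) → ℝ → ℝ≥0∞
  | _, 0, g => g
  | ν, n + 1, g => killedStep (ν 0) (killedIter (fun k => ν (k + 1)) n g)

/-- The definition peels off the first step, which suits harmonicity. Monotonicity in `n` and
resampling of the environment need the last step peeled off instead. -/
lemma killedIter_succ' (ν : ℕ → Measure ℝ) (n : ℕ) (g : ℝ → ℝ≥0∞) :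
    killedIter ν (n + 1) g = killedIter ν n (killedStep (ν n) g) := by
  induction n generalizing ν with
  | zero => rfl
  | succ n ih => rw [killedIter, ih]; rfl

lemma measurable_killedStep (ν : Measure ℝ) [SFinite ν] {g : ℝ → ℝ≥0∞} (hg : Measurable g) :
    Measurable (killedStep ν g) := by
  have h : Measurable fun p : ℝ × ℝ => (Set.Ici (0 : ℝ)).indicator g (p.1 + p.2) :=
    (hg.indicator measurableSet_Ici).comp (by fun_prop)
  exact h.lintegral_prod_right'

lemma measurable_killedIter (ν : ℕ → Measure ℝ) [∀ n, SFinite (ν n)] (n : ℕ) {g : ℝ → ℝ≥0∞}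
    (hg : Measurable g) : Measurable (killedIter ν n g) := by
  induction n generalizing g with
  | zero => exact hg
  | succ n ih => rw [killedIter_succ']; exact ih (measurable_killedStep _ hg)

lemma killedStep_mono (ν : Measure ℝ) {g g' : ℝ → ℝ≥0∞} (h : ∀ x, 0 ≤ x → g x ≤ g' x) (x : ℝ) :
    killedStep ν g x ≤ killedStep ν g' x := by
  refine lintegral_mono fun z => ?_
  by_cases hz : 0 ≤ x + z
  · simp [hz, h _ hz]
  · simp [hz]

lemma killedIter_mono (ν : ℕ → Measure ℝ) (n : ℕ) {g g' : ℝ → ℝ≥0∞}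
    (h : ∀ x, 0 ≤ x → g x ≤ g' x) : ∀ x, 0 ≤ x → killedIter ν n g x ≤ killedIter ν n g' x := by
  induction n generalizing g g' with
  | zero => exact h
  | succ n ih =>
    rw [killedIter_succ', killedIter_succ']
    exact ih fun x _ => killedStep_mono _ h x

lemma measurableSet_nonneg (n : ℕ) :
    MeasurableSet {s : ℕ → ℝ | ∀ k, 1 ≤ k → k ≤ n → 0 ≤ s k} := by
  have : {s : ℕ → ℝ | ∀ k, 1 ≤ k → k ≤ n → 0 ≤ s k} =
      ⋂ k, ⋂ (_ : 1 ≤ k), ⋂ (_ : k ≤ n), {s | 0 ≤ s k} := by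
    ext; simp
  rw [this]
  exact MeasurableSet.iInter fun k => MeasurableSet.iInter fun _ => MeasurableSet.iInter fun _ =>
    measurableSet_le measurable_const (measurable_pi_apply k)

/-- Induction on `n`, resampling the last step. Time `0` is not tested, in accordance with `τ_y ≥
1`, so no sign of `y` is required. -/
lemma lintegral_path_killed (ν : ℕ → Measure ℝ) [∀ n, IsProbabilityMeasure (ν n)] (n : ℕ)
    {g : ℝ → ℝ≥0∞} (hg : Measurable g) (y : ℝ) :
    ∫⁻ X, {s : ℕ → ℝ | ∀ k, 1 ≤ k → k ≤ n → 0 ≤ s k}.indicator (fun s => g (s n)) (path y X)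
      ∂(Measure.infinitePi ν) = killedIter ν n g y := by
  have hm : ∀ m, ∀ g : ℝ → ℝ≥0∞, Measurable g → Measurable fun X : ℕ → ℝ =>
      {s : ℕ → ℝ | ∀ k, 1 ≤ k → k ≤ m → 0 ≤ s k}.indicator (fun s => g (s m)) (path y X) :=
    fun m g hg => ((hg.comp (measurable_pi_apply m)).indicator (measurableSet_nonneg m)).comp
      (measurable_path y)
  induction n generalizing g with
  | zero =>
    have : ∀ X : ℕ → ℝ, {s : ℕ → ℝ | ∀ k, 1 ≤ k → k ≤ 0 → 0 ≤ s k}.indicator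
        (fun s => g (s 0)) (path y X) = g y := by
      intro X
      rw [Set.indicator_of_mem (fun k h1 h2 => by omega), path_zero]
    simp only [this, lintegral_const, measure_univ, mul_one]
    rfl
  | succ n ih =>
    rw [killedIter_succ', ← ih (measurable_killedStep (ν n) hg),
      lintegral_infinitePi_update ν n (hm (n + 1) g hg)]
    refine lintegral_congr fun X => ?_
    by_cases hX : path y X ∈ {s : ℕ → ℝ | ∀ k, 1 ≤ k → k ≤ n → 0 ≤ s k}
    · rw [Set.indicator_of_mem hX]
      refine lintegral_congr fun z => ?_
      by_cases hz : 0 ≤ path y X n + z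
      · rw [Set.indicator_of_mem (show _ ∈ Set.Ici (0 : ℝ) from hz), Set.indicator_of_mem,
          path_update_succ]
        intro k h1 h2
        rcases Nat.le_succ_iff.1 h2 with h2 | rfl
        · rw [path_update_of_le _ _ h2]; exact hX k h1 h2
        · rw [path_update_succ]; exact hz
      · rw [Set.indicator_of_notMem (show _ ∉ Set.Ici (0 : ℝ) from hz), Set.indicator_of_notMem]
        intro hc
        have := hc (n + 1) (by omega) le_rfl
        rw [path_update_succ] at this
        exact hz this
    · rw [Set.indicator_of_notMem hX]
      refine (lintegral_congr fun z => ?_).trans lintegral_zero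
      rw [Set.indicator_of_notMem]
      refine fun hc => hX fun k h1 h2 => ?_
      have := hc k h1 (by omega)
      rwa [path_update_of_le _ _ h2] at this

/-- A centered probability measure which charges the positive half-line. -/
structure CenteredStep (ν : Measure ℝ) : Prop where
  prob : IsProbabilityMeasure ν
  mean : ∫⁻ z, ENNReal.ofReal z ∂ν = ∫⁻ z, ENNReal.ofReal (-z) ∂ν
  finite : ∫⁻ z, ENNReal.ofReal (-z) ∂ν ≠ ⊤
  pos : 0 < ν (Set.Ioi 0)

/-- Integrate the pointwise inequality `x + z⁺ ≤ (x + z)⁺ + z⁻`. The means of `z⁺` and `z⁻` agree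
and are finite, hence cancel. -/
lemma CenteredStep.le_killedStep {ν : Measure ℝ} (h : CenteredStep ν) {x : ℝ} (hx : 0 ≤ x) :
    ENNReal.ofReal x ≤ killedStep ν ENNReal.ofReal x := by
  have := h.prob
  have h1 : ∀ z : ℝ, ENNReal.ofReal x + ENNReal.ofReal z ≤
      (Set.Ici (0 : ℝ)).indicator ENNReal.ofReal (x + z) + ENNReal.ofReal (-z) := by
    intro z
    by_cases hz : 0 ≤ x + z
    · rw [Set.indicator_of_mem (show _ ∈ Set.Ici (0 : ℝ) from hz)]
      rcases le_total 0 z with h0 | h0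
      · rw [← ENNReal.ofReal_add hx h0]; exact le_self_add
      · rw [ENNReal.ofReal_of_nonpos h0, add_zero, ← ENNReal.ofReal_add hz (by linarith)]
        exact ENNReal.ofReal_le_ofReal (by linarith)
    · rw [ENNReal.ofReal_of_nonpos (p := z) (by linarith), add_zero]
      exact le_add_left (ENNReal.ofReal_le_ofReal (by linarith))
  have h2 := lintegral_mono (μ := ν) h1
  rw [lintegral_add_left measurable_const, lintegral_add_right _ (by fun_prop), lintegral_const,
    measure_univ, mul_one, h.mean] at h2
  exact (ENNReal.add_le_add_iff_right h.finite).1 h2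

lemma killedIter_monotone {ν : ℕ → Measure ℝ} (h : ∀ n, CenteredStep (ν n)) {x : ℝ} (hx : 0 ≤ x) :
    Monotone fun n => killedIter ν n ENNReal.ofReal x :=
  monotone_nat_of_le_succ fun n => by
    rw [killedIter_succ']
    exact killedIter_mono ν n (fun y hy => (h n).le_killedStep hy) x hx

/-- The harmonic function of the killed random walk. -/
def harmonic (ν : ℕ → Measure ℝ) (y : ℝ) : ℝ≥0∞ := ⨆ n, killedIter ν n ENNReal.ofReal y

/-- Monotone convergence in the first-step decomposition. It holds in `[0, ∞]`, before finiteness is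
known. -/
lemma harmonic_eq_killedStep {ν : ℕ → Measure ℝ} (h : ∀ n, CenteredStep (ν n)) {x : ℝ}
    (hx : 0 ≤ x) : harmonic ν x = killedStep (ν 0) (harmonic fun k => ν (k + 1)) x := by
  have := fun n => (h n).prob
  have e1 : harmonic ν x = ⨆ n, killedIter ν (n + 1) ENNReal.ofReal x :=
    ((killedIter_monotone h hx).iSup_nat_add 1).symm
  rw [e1]
  unfold killedIter killedStep
  rw [← lintegral_iSup]
  · refine lintegral_congr fun z => ?_
    by_cases hz : 0 ≤ x + z
    · simp [hz, harmonic]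
    · simp [hz]
  · intro n
    exact ((measurable_killedIter _ n ENNReal.measurable_ofReal).indicator
      measurableSet_Ici).comp (by fun_prop)
  · intro m n hmn z
    by_cases hz : 0 ≤ x + z
    · simpa [hz] using
        killedIter_monotone (fun k => h (k + 1)) hz hmn
    · simp [hz]

/-- One step suffices, since it moves upwards with positive probability; this covers `x = 0` as
well. -/
lemma harmonic_pos {ν : ℕ → Measure ℝ} (h : ∀ n, CenteredStep (ν n)) {x : ℝ} (hx : 0 ≤ x) :
    0 < harmonic ν x := by
  refine lt_of_lt_of_le ?_ (le_iSup (fun n => killedIter ν n ENNReal.ofReal x) 1)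
  change 0 < killedStep (ν 0) ENNReal.ofReal x
  have hm : Measurable fun z : ℝ => (Set.Ici (0 : ℝ)).indicator ENNReal.ofReal (x + z) :=
    (ENNReal.measurable_ofReal.indicator measurableSet_Ici).comp (by fun_prop)
  rw [killedStep, lintegral_pos_iff_support hm]
  refine (h 0).pos.trans_le (measure_mono fun z hz => ?_)
  have hz : 0 < z := hz
  have : 0 < x + z := by linarith
  simp [Set.indicator_apply, this.le, this]

/-! ### Identification of `U` -/

section

variable {E : Type*} [MeasurableSpace E]

/-- The step laws of the random walk in the environment `e`. -/
def steps (law : Kernel E Brood) (e : ℕ → E) (k : ℕ) : Measure ℝ := stepLaw (law (e k))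

lemma walkLaw_eq (law : Kernel E Brood) (e : ℕ → E) (a : ℝ) :
    walkLaw law e a = (Measure.infinitePi (steps law e)).map (path a) := rfl

variable {law : Kernel E Brood} {e : ℕ → E}

lemma Un_eq_integral [∀ n, IsProbabilityMeasure (steps law e n)] (n : ℕ) (y : ℝ) :
    Un law n e y = ∫ X, {s : ℕ → ℝ | ∀ k, 1 ≤ k → k ≤ n → 0 ≤ s k}.indicator (fun s => s n)
      (path y X) ∂(Measure.infinitePi (steps law e)) := by
  have hm : Measurable fun p : ℕ → ℝ =>
      {s : ℕ → ℝ | ∀ k, 1 ≤ k → k ≤ n → 0 ≤ s k}.indicator (fun s => s n) (fun k => y + p k) :=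
    ((measurable_pi_apply n).indicator (measurableSet_nonneg n)).comp (by fun_prop)
  have hp : ∀ X, path y X = fun k => y + path 0 X k := by intro X; funext k; simp [path]
  simp_rw [hp]
  have h1 := integral_map (μ := Measure.infinitePi (steps law e)) (measurable_path 0).aemeasurable
    hm.aestronglyMeasurable
  rw [← h1, ← walkLaw_eq]
  unfold Un
  refine integral_congr_ae (ae_of_all _ fun s => ?_)
  simp [Set.indicator_apply]

lemma Un_eq_toReal (h : ∀ n, CenteredStep (steps law e n)) (n : ℕ) {y : ℝ} (hy : 0 ≤ y) :
    Un law n e y = (killedIter (steps law e) n ENNReal.ofReal y).toReal := by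
  have := fun n => (h n).prob
  have hm : Measurable fun X : ℕ → ℝ =>
      {s : ℕ → ℝ | ∀ k, 1 ≤ k → k ≤ n → 0 ≤ s k}.indicator (fun s => s n) (path y X) :=
    ((measurable_pi_apply n).indicator (measurableSet_nonneg n)).comp (measurable_path y)
  rw [Un_eq_integral, integral_eq_lintegral_of_nonneg_ae _ hm.aestronglyMeasurable,
    ← lintegral_path_killed _ n ENNReal.measurable_ofReal]
  · congr 1
    refine lintegral_congr fun X => ?_
    by_cases hX : path y X ∈ {s : ℕ → ℝ | ∀ k, 1 ≤ k → k ≤ n → 0 ≤ s k}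
    · simp only [Set.indicator_of_mem hX]
    · simp only [Set.indicator_of_notMem hX, ENNReal.ofReal_zero]
  · refine ae_of_all _ fun X => Set.indicator_apply_nonneg fun hX => ?_
    -- At time `0` no positivity comes from the event, only from `0 ≤ y`.
    rcases Nat.eq_zero_or_pos n with rfl | hn
    · simpa using hy
    · exact hX n hn le_rfl

lemma tendsto_Un (h : ∀ n, CenteredStep (steps law e n)) {y : ℝ} (hy : 0 ≤ y)
    (hfin : harmonic (steps law e) y ≠ ⊤) :
    Tendsto (fun n => Un law n e y) atTop (𝓝 (harmonic (steps law e) y).toReal) := by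
  simp_rw [Un_eq_toReal h _ hy]
  exact (ENNReal.tendsto_toReal hfin).comp (tendsto_atTop_iSup (killedIter_monotone h hy))

lemma U_eq_toReal (h : ∀ n, CenteredStep (steps law e n)) {y : ℝ} (hy : 0 ≤ y)
    (hfin : harmonic (steps law e) y ≠ ⊤) : U law e y = (harmonic (steps law e) y).toReal :=
  (tendsto_Un h hy hfin).limUnder_eq

/-- `limUnder` of measurable functions is measurable whether or not the limit exists, so negative
arguments need no separate treatment. -/
lemma measurable_U [∀ n, IsProbabilityMeasure (steps law e n)] : Measurable (U law e) := by
  refine (StronglyMeasurable.limUnder (l := atTop) (f := fun n y => Un law n e y)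
    fun n => ?_).measurable
  have hm : Measurable fun p : ℝ × (ℕ → ℝ) =>
      {s : ℕ → ℝ | ∀ k, 1 ≤ k → k ≤ n → 0 ≤ s k}.indicator (fun s => s n) (path p.1 p.2) := by
    refine ((measurable_pi_apply n).indicator (measurableSet_nonneg n)).comp
      (measurable_pi_lambda _ fun k => ?_)
    unfold path
    fun_prop
  simp_rw [Un_eq_integral]
  exact hm.stronglyMeasurable.integral_prod_right'

end

/-! ### A superharmonic function for centered random walks with `2 + δ` moments -/

/-- The square of the right side exceeds `1 + u` by `u² (1 - u) / 12 + u⁴ / 144`. -/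
lemma sqrt_one_add_le {u : ℝ} (h1 : -1 ≤ u) (h2 : u ≤ 1) :
    √(1 + u) ≤ 1 + u / 2 - u ^ 2 / 12 := by
  rw [Real.sqrt_le_left (by nlinarith)]
  nlinarith [mul_nonneg (sq_nonneg u) (sub_nonneg.2 h2), sq_nonneg (u ^ 2)]

/-- Weighted AM-GM between the exponents `1` and `1/2`, with weights `1 - 2ε` and `2ε`. The
quadratic gain of the square root is inherited with the factor `2ε`, which gives `ε / 6`. -/
lemma rpow_one_add_le {ε u : ℝ} (hε : 0 ≤ ε) (hε' : ε ≤ 1 / 2) (h1 : -1 ≤ u) (h2 : u ≤ 1) :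
    (1 + u) ^ (1 - ε) ≤ 1 + (1 - ε) * u - ε / 6 * u ^ 2 := by
  have h0 : 0 ≤ 1 + u := by linarith
  have h := Real.geom_mean_le_arith_mean2_weighted (w₁ := 1 - 2 * ε) (w₂ := 2 * ε)
    (by linarith) (by linarith) h0 (Real.sqrt_nonneg (1 + u)) (by ring)
  have e : (1 + u) ^ (1 - 2 * ε) * √(1 + u) ^ (2 * ε) = (1 + u) ^ (1 - ε) := by
    rw [Real.sqrt_eq_rpow, ← Real.rpow_mul h0]
    -- Adding exponents requires a positive base, so `u = -1` is treated by hand, together with the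
    -- convention `0 ^ 0 = 1`.
    rcases h0.eq_or_lt with h0 | h0
    · rw [← h0]
      rcases hε.eq_or_lt with rfl | hε0
      · simp
      · have e1 : (1 : ℝ) / 2 * (2 * ε) ≠ 0 := by positivity
        have e2 : 1 - ε ≠ 0 := by linarith
        rw [Real.zero_rpow e1, Real.zero_rpow e2, mul_zero]
    · rw [← Real.rpow_add h0]
      congr 1
      ring
  rw [e] at h
  nlinarith [sqrt_one_add_le h1 h2]

lemma rpow_add_le {ε t z : ℝ} (hε : 0 ≤ ε) (hε' : ε ≤ 1 / 2) (ht : 0 < t) (hz : |z| ≤ t) :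
    (t + z) ^ (1 - ε) ≤ t ^ (1 - ε) + (1 - ε) * t ^ (-ε) * z - ε / 6 * t ^ (-1 - ε) * z ^ 2 := by
  obtain ⟨h1, h2⟩ := abs_le.1 hz
  have hu1 : -1 ≤ z / t := by rw [le_div_iff₀ ht]; linarith
  have hu2 : z / t ≤ 1 := by rw [div_le_iff₀ ht]; linarith
  have h := rpow_one_add_le hε hε' hu1 hu2
  have e1 : t + z = t * (1 + z / t) := by field_simp
  have e2 : t ^ (-ε) = t ^ (1 - ε) / t := by
    rw [show -ε = (1 - ε) - 1 by ring, Real.rpow_sub_one ht.ne']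
  have e3 : t ^ (-1 - ε) = t ^ (1 - ε) / t ^ 2 := by
    rw [show -1 - ε = (1 - ε) - 1 - 1 by ring, Real.rpow_sub_one ht.ne', Real.rpow_sub_one ht.ne']
    field_simp
  rw [e1, Real.mul_rpow ht.le (by linarith), e2, e3]
  calc _ ≤ t ^ (1 - ε) * (1 + (1 - ε) * (z / t) - ε / 6 * (z / t) ^ 2) :=
        mul_le_mul_of_nonneg_left h (Real.rpow_nonneg ht.le _)
    _ = _ := by field_simp

/-- Small jumps use the quadratic gain. A large jump that survives is upwards, and Bernoulli's
inequality suffices. After a large killing jump the left side is zero, and the last term compensates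
the linear one, whose slope is at most `2`. -/
lemma indicator_potential_le {ε t x z : ℝ} (hε : 0 ≤ ε) (hε' : ε ≤ 1 / 2) (ht : 1 ≤ t)
    (hx : x ≤ t) :
    (if 0 ≤ x + z then (t + z) + (t + z) ^ (1 - ε) else 0) ≤
      (t + t ^ (1 - ε)) + (1 + (1 - ε) * t ^ (-ε)) * z
        - ε / 6 * t ^ (-1 - ε) * {z : ℝ | |z| ≤ t}.indicator (fun z => z ^ 2) z
        + 2 * {z : ℝ | t < |z|}.indicator (fun z => |z|) z := by
  have ht0 : 0 < t := by linarith
  have hp1 : t ^ (-ε) ≤ 1 := Real.rpow_le_one_of_one_le_of_nonpos ht (by linarith)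
  have hp0 : 0 ≤ t ^ (-ε) := Real.rpow_nonneg ht0.le _
  have hp2 : 0 ≤ t ^ (1 - ε) := Real.rpow_nonneg ht0.le _
  by_cases hz : |z| ≤ t
  · rw [Set.indicator_of_mem (show z ∈ {z : ℝ | |z| ≤ t} from hz),
      Set.indicator_of_notMem (show z ∉ {z : ℝ | t < |z|} from not_lt.2 hz)]
    have h := rpow_add_le hε hε' ht0 hz
    have h0 : 0 ≤ t + z := by linarith [(abs_le.1 hz).1]
    have h2 := Real.rpow_nonneg h0 (1 - ε)
    split_ifs <;> linarith
  · have hz' : t < |z| := not_le.1 hz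
    rw [Set.indicator_of_notMem (show z ∉ {z : ℝ | |z| ≤ t} from hz),
      Set.indicator_of_mem (show z ∈ {z : ℝ | t < |z|} from hz')]
    split_ifs with hxz
    · have h0 : 0 ≤ t + z := by linarith
      -- A downward jump longer than `t ≥ x` would have been killed.
      have hzt : 0 ≤ z := by
        by_contra hn
        rw [abs_of_neg (not_le.1 hn)] at hz'
        linarith
      have h := rpow_one_add_le_one_add_mul_self (s := z / t) (p := 1 - ε)
        (by have := div_nonneg hzt ht0.le; linarith) (by linarith) (by linarith)
      have e1 : t + z = t * (1 + z / t) := by field_simp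
      have e2 : t ^ (-ε) = t ^ (1 - ε) / t := by
        rw [show -ε = (1 - ε) - 1 by ring, Real.rpow_sub_one ht0.ne']
      have h3 : (t + z) ^ (1 - ε) ≤ t ^ (1 - ε) + (1 - ε) * t ^ (-ε) * z := by
        rw [e1, Real.mul_rpow ht0.le (by positivity), e2]
        calc _ ≤ t ^ (1 - ε) * (1 + (1 - ε) * (z / t)) := mul_le_mul_of_nonneg_left h hp2
          _ = _ := by field_simp
      have := abs_nonneg z
      nlinarith
    · have h1 : |(1 + (1 - ε) * t ^ (-ε)) * z| ≤ 2 * |z| := by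
        rw [abs_mul]
        refine mul_le_mul_of_nonneg_right ?_ (abs_nonneg z)
        rw [abs_of_nonneg (by nlinarith)]
        nlinarith
      have := neg_abs_le ((1 + (1 - ε) * t ^ (-ε)) * z)
      nlinarith

lemma CenteredStep.integrable {ν : Measure ℝ} (h : CenteredStep ν) : Integrable id ν := by
  refine ⟨aestronglyMeasurable_id, ?_⟩
  rw [hasFiniteIntegral_iff_norm]
  have : ∀ z : ℝ, ENNReal.ofReal ‖z‖ = ENNReal.ofReal z + ENNReal.ofReal (-z) := by
    intro z
    rcases le_total 0 z with hz | hz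
    · rw [Real.norm_of_nonneg hz, ENNReal.ofReal_of_nonpos (p := -z) (by linarith), add_zero]
    · rw [Real.norm_of_nonpos hz, ENNReal.ofReal_of_nonpos hz, zero_add]
  simp only [id, this]
  rw [lintegral_add_left (by fun_prop), h.mean]
  exact (ENNReal.add_ne_top.2 ⟨h.finite, h.finite⟩).lt_top

lemma CenteredStep.integral_eq_zero {ν : Measure ℝ} (h : CenteredStep ν) : ∫ z, z ∂ν = 0 := by
  have := integral_eq_lintegral_pos_part_sub_lintegral_neg_part h.integrable
  simpa only [id, h.mean, sub_self] using this

/-- The identity alone is only subharmonic after killing; the concave term `t ^ (1 - ε)` repairs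
this. The linear terms have mean zero, and the translation by `R` keeps `t` in the range where the
gain from concavity exceeds the loss from large jumps. -/
theorem CenteredStep.exists_superharmonic {ν : Measure ℝ} (h : CenteredStep ν) {δ : ℝ}
    (hδ : 0 < δ) (hmom : ∫⁻ z, ENNReal.ofReal (|z| ^ (2 + δ)) ∂ν ≠ ⊤) :
    ∃ g : ℝ → ℝ≥0∞, Measurable g ∧ (∀ x, g x ≠ ⊤) ∧ (∀ x, 0 ≤ x → ENNReal.ofReal x ≤ g x) ∧
      ∀ x, 0 ≤ x → killedStep ν g x ≤ g x := by
  have := h.prob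
  -- This is below both `δ` and `1 / 2`.
  set ε := min δ 1 / 4 with hεd
  have hm0 : 0 < min δ 1 := lt_min hδ one_pos
  have hε : 0 < ε := by positivity
  have hε' : ε ≤ 1 / 2 := by have := min_le_right δ 1; linarith
  have hεδ : ε < δ := by have := min_le_left δ 1; linarith
  have hM : Integrable (fun z : ℝ => |z| ^ (2 + δ)) ν := by
    have hm : Measurable fun z : ℝ => |z| ^ (2 + δ) := (measurable_id.abs).pow_const _
    refine ⟨hm.aestronglyMeasurable, ?_⟩
    rw [hasFiniteIntegral_iff_norm]
    refine lt_of_eq_of_lt (lintegral_congr fun z => ?_) hmom.lt_top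
    rw [Real.norm_of_nonneg (Real.rpow_nonneg (abs_nonneg z) _)]
  set M := ∫ z, |z| ^ (2 + δ) ∂ν with hMd
  have hM0 : 0 ≤ M := integral_nonneg fun z => Real.rpow_nonneg (abs_nonneg z) _
  have hset : ∀ t : ℝ, MeasurableSet {z : ℝ | |z| ≤ t} := fun t =>
    measurableSet_le (by fun_prop) (by fun_prop)
  have hset' : ∀ t : ℝ, MeasurableSet {z : ℝ | t < |z|} := fun t =>
    measurableSet_lt (by fun_prop) (by fun_prop)
  have hsq : ∀ t : ℝ, Integrable ({z : ℝ | |z| ≤ t}.indicator fun z => z ^ 2) ν := by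
    intro t
    refine Integrable.of_bound (C := t ^ 2)
      (((measurable_id.pow_const 2).indicator (hset t)).aestronglyMeasurable) (ae_of_all _ fun z => ?_)
    by_cases hz : |z| ≤ t
    · rw [Set.indicator_of_mem (show z ∈ {z : ℝ | |z| ≤ t} from hz), Real.norm_eq_abs, abs_pow]
      exact pow_le_pow_left₀ (abs_nonneg z) hz 2
    · rw [Set.indicator_of_notMem (show z ∉ {z : ℝ | |z| ≤ t} from hz), norm_zero]
      positivity
  -- A truncated second moment that does not vanish, because the law charges `(0, ∞)`; it bounds the
  -- concave gain below for all `t ≥ N`.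
  obtain ⟨N, hN⟩ : ∃ N : ℕ, 0 < ∫ z, {z : ℝ | |z| ≤ N}.indicator (fun z => z ^ 2) z ∂ν := by
    have hU : Set.Ioi (0 : ℝ) = ⋃ n : ℕ, Set.Ioc (0 : ℝ) n := by
      ext x
      simp only [Set.mem_Ioi, Set.mem_iUnion, Set.mem_Ioc]
      exact ⟨fun hx => (exists_nat_ge x).imp fun n hn => ⟨hx, hn⟩, fun ⟨n, hx, _⟩ => hx⟩
    have hpos := h.pos
    rw [hU] at hpos
    obtain ⟨N, hN⟩ := exists_measure_pos_of_not_measure_iUnion_null hpos.ne'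
    refine ⟨N, ?_⟩
    rw [integral_pos_iff_support_of_nonneg
      (fun z => Set.indicator_nonneg (fun z _ => sq_nonneg z) z) (hsq N)]
    refine hN.trans_le (measure_mono fun z hz => ?_)
    have : |z| ≤ N := by rw [abs_of_pos hz.1]; exact hz.2
    simp [this, hz.1.ne']
  set m := ∫ z, {z : ℝ | |z| ≤ N}.indicator (fun z => z ^ 2) z ∂ν with hmd
  -- The threshold is the solution of `2 M t ^ (-1 - δ) ≤ (ε / 6) m t ^ (-1 - ε)` for `t ^ (δ - ε)`.
  obtain ⟨R, hR1, hRN, hR⟩ : ∃ R : ℝ, 1 ≤ R ∧ (N : ℝ) ≤ R ∧ ∀ t, R ≤ t →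
      12 * M / (ε * m) ≤ t ^ (δ - ε) := by
    have h1 := (tendsto_rpow_atTop (sub_pos.2 hεδ)).eventually_ge_atTop (12 * M / (ε * m))
    obtain ⟨R, hR⟩ := eventually_atTop.1 h1
    exact ⟨max 1 (max N R), le_max_left _ _, (le_max_left _ _).trans (le_max_right _ _),
      fun t ht => hR t (((le_max_right _ _).trans (le_max_right _ _)).trans ht)⟩
  refine ⟨fun x => ENNReal.ofReal ((x + R) + (x + R) ^ (1 - ε)), by fun_prop,
    fun x => ENNReal.ofReal_ne_top, fun x hx => ENNReal.ofReal_le_ofReal ?_, fun x hx => ?_⟩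
  · have := Real.rpow_nonneg (show 0 ≤ x + R by linarith) (1 - ε)
    linarith
  set t := x + R with htd
  have ht : R ≤ t := by linarith
  have ht1 : 1 ≤ t := by linarith
  have ht0 : 0 < t := by linarith
  let F : ℝ → ℝ := fun z => (t + t ^ (1 - ε)) + (1 + (1 - ε) * t ^ (-ε)) * z
        - ε / 6 * t ^ (-1 - ε) * {z : ℝ | |z| ≤ t}.indicator (fun z => z ^ 2) z
        + 2 * {z : ℝ | t < |z|}.indicator (fun z => |z|) z
  have hF : ∀ z, (if 0 ≤ x + z then (t + z) + (t + z) ^ (1 - ε) else 0) ≤ F z := fun z =>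
    indicator_potential_le hε.le hε' ht1 (by linarith)
  -- Needed to exchange the Lebesgue and Bochner integrals of `F`; it holds because `F` dominates a
  -- nonnegative function.
  have hF0 : ∀ z, 0 ≤ F z := by
    intro z
    refine le_trans ?_ (hF z)
    split_ifs with hz
    · have := Real.rpow_nonneg (show 0 ≤ t + z by linarith) (1 - ε)
      linarith
    · exact le_rfl
  have hid : Integrable (fun z : ℝ => z) ν := h.integrable
  have habs : Integrable ({z : ℝ | t < |z|}.indicator fun z => |z|) ν :=
    hid.abs.indicator (hset' t)
  have i1 : Integrable (fun z : ℝ => (t + t ^ (1 - ε)) + (1 + (1 - ε) * t ^ (-ε)) * z) ν :=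
    (integrable_const _).add (hid.const_mul _)
  have i2 := (hsq t).const_mul (ε / 6 * t ^ (-1 - ε))
  have i3 := habs.const_mul 2
  have hFi : Integrable F ν := (i1.sub i2).add i3
  have hFint : ∫ z, F z ∂ν = (t + t ^ (1 - ε))
      - ε / 6 * t ^ (-1 - ε) * ∫ z, {z : ℝ | |z| ≤ t}.indicator (fun z => z ^ 2) z ∂ν
      + 2 * ∫ z, {z : ℝ | t < |z|}.indicator (fun z => |z|) z ∂ν := by
    change ∫ z, ((t + t ^ (1 - ε)) + (1 + (1 - ε) * t ^ (-ε)) * z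
        - ε / 6 * t ^ (-1 - ε) * {z : ℝ | |z| ≤ t}.indicator (fun z => z ^ 2) z
        + 2 * {z : ℝ | t < |z|}.indicator (fun z => |z|) z) ∂ν = _
    have i12 : Integrable (fun z : ℝ => (t + t ^ (1 - ε)) + (1 + (1 - ε) * t ^ (-ε)) * z
        - ε / 6 * t ^ (-1 - ε) * {z : ℝ | |z| ≤ t}.indicator (fun z => z ^ 2) z) ν := i1.sub i2
    rw [integral_add i12 i3, integral_sub i1 i2,
      integral_add (integrable_const _) (hid.const_mul _), integral_const_mul, integral_const_mul,
      integral_const_mul, h.integral_eq_zero]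
    simp
  have hm : m ≤ ∫ z, {z : ℝ | |z| ≤ t}.indicator (fun z => z ^ 2) z ∂ν := by
    refine integral_mono (hsq N) (hsq t) fun z => ?_
    exact Set.indicator_le_indicator_of_subset (s := {z : ℝ | |z| ≤ N}) (t := {z : ℝ | |z| ≤ t})
      (f := fun z => z ^ 2) (fun w hw => le_trans hw (hRN.trans ht)) (fun w => sq_nonneg w) z
  -- On `t < |z|` one has `|z| ≤ t ^ (-1 - δ) * |z| ^ (2 + δ)`.
  have hloss : ∫ z, {z : ℝ | t < |z|}.indicator (fun z => |z|) z ∂ν ≤ t ^ (-1 - δ) * M := by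
    rw [hMd, ← integral_const_mul]
    refine integral_mono habs (hM.const_mul _) fun z => ?_
    by_cases hz : t < |z|
    swap
    · rw [Set.indicator_of_notMem (show z ∉ {z : ℝ | t < |z|} from hz)]
      positivity
    rw [Set.indicator_of_mem (show z ∈ {z : ℝ | t < |z|} from hz)]
    have hz0 : 0 < |z| := ht0.trans hz
    have e : |z| ^ (2 + δ) = |z| * |z| ^ (1 + δ) := by
      rw [show 2 + δ = 1 + (1 + δ) by ring, Real.rpow_add hz0, Real.rpow_one]
    have e2 : t ^ (-1 - δ) = (t ^ (1 + δ))⁻¹ := by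
      rw [← Real.rpow_neg ht0.le]; congr 1; ring
    have hle : t ^ (1 + δ) ≤ |z| ^ (1 + δ) := Real.rpow_le_rpow ht0.le hz.le (by linarith)
    have hp : 0 < t ^ (1 + δ) := Real.rpow_pos_of_pos ht0 _
    rw [e, e2, inv_mul_eq_div, le_div_iff₀ hp]
    exact mul_le_mul_of_nonneg_left hle hz0.le
  have hkey : 2 * (t ^ (-1 - δ) * M) ≤ ε / 6 * t ^ (-1 - ε) * m := by
    have h1 := hR t ht
    rw [div_le_iff₀ (by positivity)] at h1
    have e : t ^ (-1 - ε) = t ^ (δ - ε) * t ^ (-1 - δ) := by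
      rw [← Real.rpow_add ht0]; congr 1; ring
    have hp : 0 < t ^ (-1 - δ) := Real.rpow_pos_of_pos ht0 _
    rw [e]
    nlinarith [mul_le_mul_of_nonneg_right h1 hp.le]
  have hfinal : ∫ z, F z ∂ν ≤ t + t ^ (1 - ε) := by
    rw [hFint]
    have hp : 0 ≤ ε / 6 * t ^ (-1 - ε) := by positivity
    nlinarith [mul_le_mul_of_nonneg_left hm hp]
  calc killedStep ν (fun x => ENNReal.ofReal ((x + R) + (x + R) ^ (1 - ε))) x
      ≤ ∫⁻ z, ENNReal.ofReal (F z) ∂ν := by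
        refine lintegral_mono fun z => ?_
        have h1 := hF z
        by_cases hz : 0 ≤ x + z
        · rw [if_pos hz] at h1
          rw [Set.indicator_of_mem (show _ ∈ Set.Ici (0 : ℝ) from hz),
            show x + z + R = t + z by rw [htd]; ring]
          exact ENNReal.ofReal_le_ofReal h1
        · rw [Set.indicator_of_notMem (show _ ∉ Set.Ici (0 : ℝ) from hz)]
          exact zero_le
    _ = ENNReal.ofReal (∫ z, F z ∂ν) :=
        (ofReal_integral_eq_lintegral_ofReal hFi (ae_of_all _ hF0)).symm
    _ ≤ ENNReal.ofReal (t + t ^ (1 - ε)) := ENNReal.ofReal_le_ofReal hfinal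

/-! ### The annealed random walk and finiteness of the harmonic function -/

section

variable {E : Type*} [MeasurableSpace E] {law : Kernel E Brood} [IsMarkovKernel law]

instance (e : ℕ → E) (k : ℕ) : SFinite (steps law e k) := by
  unfold steps; infer_instance

/-- The many-to-one formula turns the integral into one against the kernel `law`, where
measurability in the parameter is available. -/
lemma measurable_lintegral_stepLaw {γ : Type*} [MeasurableSpace γ] {k : γ → E} (hk : Measurable k)
    {f : γ × ℝ → ℝ≥0∞} (hf : Measurable f) :
    Measurable fun c => ∫⁻ z, f (c, z) ∂(stepLaw (law (k c))) := by
  have hg : ∀ c, Measurable fun z => f (c, z) := fun c => hf.comp (by fun_prop)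
  simp_rw [fun c => lintegral_stepLaw (law (k c)) (hg c)]
  have hm : Measurable fun p : γ × Brood =>
      childSum (fun z => f (p.1, z) * ENNReal.ofReal (Real.exp (-z))) p.2 := by
    unfold childSum
    refine Measurable.tsum fun i => ?_
    have hi : Measurable fun p : γ × Brood => p.2 i := by fun_prop
    have : (fun p : γ × Brood =>
        atPos (fun z => f (p.1, z) * ENNReal.ofReal (Real.exp (-z))) (p.2 i)) = fun p =>
        if p.2 i = ⊤ then 0 else
          f (p.1, (p.2 i).untopD 0) * ENNReal.ofReal (Real.exp (-(p.2 i).untopD 0)) := by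
      funext p
      cases p.2 i <;> simp [atPos]
    rw [this]
    refine Measurable.ite (hi (measurableSet_singleton ⊤)) measurable_const ?_
    have hu := hi.untopD 0
    exact (hf.comp (measurable_fst.prodMk hu)).mul (by fun_prop)
  exact hm.lintegral_kernel_prod_right' (κ := law.comap k hk)

/-- The annealed step law is the mixture of the quenched ones, since `stepLaw` is linear in the law
of the brood. -/
lemma lintegral_stepLaw_bind (ν : Measure E) {g : ℝ → ℝ≥0∞} (hg : Measurable g) :
    ∫⁻ z, g z ∂(stepLaw (ν.bind law)) = ∫⁻ e, ∫⁻ z, g z ∂(stepLaw (law e)) ∂ν := by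
  have hm : Measurable (childSum fun z => g z * ENNReal.ofReal (Real.exp (-z))) :=
    measurable_childSum (by fun_prop)
  rw [lintegral_stepLaw _ hg, Measure.lintegral_bind law.measurable.aemeasurable hm.aemeasurable]
  simp_rw [lintegral_stepLaw _ hg]

lemma measurable_killedStep_prod {γ : Type*} [MeasurableSpace γ] {k : γ → E} (hk : Measurable k)
    {f : γ × ℝ → ℝ≥0∞} (hf : Measurable f) :
    Measurable fun p : γ × ℝ => killedStep (stepLaw (law (k p.1))) (fun x => f (p.1, x)) p.2 := by
  refine measurable_lintegral_stepLaw (γ := γ × ℝ) (k := fun p => k p.1) (by fun_prop)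
    (f := fun q => (Set.Ici (0 : ℝ)).indicator (fun x => f (q.1.1, x)) (q.1.2 + q.2)) ?_
  have : (fun q : (γ × ℝ) × ℝ =>
      (Set.Ici (0 : ℝ)).indicator (fun x => f (q.1.1, x)) (q.1.2 + q.2)) =
      {q : (γ × ℝ) × ℝ | 0 ≤ q.1.2 + q.2}.indicator fun q => f (q.1.1, q.1.2 + q.2) := by
    funext q
    simp [Set.indicator_apply]
  rw [this]
  exact (hf.comp (by fun_prop)).indicator (measurableSet_le (by fun_prop) (by fun_prop))

lemma measurable_killedIter_prod {γ : Type*} [MeasurableSpace γ] {k : γ → ℕ → E}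
    (hk : Measurable k) (n : ℕ) {f : γ × ℝ → ℝ≥0∞} (hf : Measurable f) :
    Measurable fun p : γ × ℝ => killedIter (steps law (k p.1)) n (fun x => f (p.1, x)) p.2 := by
  induction n generalizing f with
  | zero => exact hf
  | succ n ih =>
    simp_rw [killedIter_succ']
    exact ih (measurable_killedStep_prod (law := law) (k := fun c => k c n) (by fun_prop) hf)

lemma lintegral_killedStep {γ : Type*} [MeasurableSpace γ] (μ : Measure γ) [SFinite μ]
    (ν : Measure ℝ) [SFinite ν] {f : γ × ℝ → ℝ≥0∞} (hf : Measurable f) (x : ℝ) :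
    ∫⁻ c, killedStep ν (fun x => f (c, x)) x ∂μ =
      killedStep ν (fun x => ∫⁻ c, f (c, x) ∂μ) x := by
  unfold killedStep
  rw [lintegral_lintegral_swap]
  · refine lintegral_congr fun z => ?_
    by_cases hz : 0 ≤ x + z
    · simp [hz]
    · simp [hz]
  · have : (Function.uncurry fun (c : γ) z => (Set.Ici (0 : ℝ)).indicator
        (fun x => f (c, x)) (x + z)) =
        {q : γ × ℝ | 0 ≤ x + q.2}.indicator fun q => f (q.1, x + q.2) := by
      funext q
      simp [Set.indicator_apply, Function.uncurry]
    rw [this]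
    exact ((hf.comp (by fun_prop)).indicator
      (measurableSet_le (by fun_prop) (by fun_prop))).aemeasurable

/-- Iterated Tonelli: averaging over a parameter of the terminal function commutes with the killed
steps. -/
lemma lintegral_killedIter {γ : Type*} [MeasurableSpace γ] (μ : Measure γ) [SFinite μ]
    (ν : ℕ → Measure ℝ) [∀ n, SFinite (ν n)] (n : ℕ) {f : γ × ℝ → ℝ≥0∞} (hf : Measurable f)
    (x : ℝ) :
    ∫⁻ c, killedIter ν n (fun x => f (c, x)) x ∂μ =
      killedIter ν n (fun x => ∫⁻ c, f (c, x) ∂μ) x := by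
  induction n generalizing f with
  | zero => rfl
  | succ n ih =>
    simp_rw [killedIter_succ']
    have hm : Measurable fun p : γ × ℝ => killedStep (ν n) (fun x => f (p.1, x)) p.2 := by
      have : Measurable fun q : (γ × ℝ) × ℝ =>
          {q : (γ × ℝ) × ℝ | 0 ≤ q.1.2 + q.2}.indicator (fun q => f (q.1.1, q.1.2 + q.2)) q :=
        (hf.comp (by fun_prop)).indicator (measurableSet_le (by fun_prop) (by fun_prop))
      convert this.lintegral_prod_right' (ν := ν n) using 2 with p
      unfold killedStep
      refine lintegral_congr fun z => ?_
      simp [Set.indicator_apply]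
    rw [ih hm]
    congr 1
    funext y
    exact lintegral_killedStep μ (ν n) hf y

/-- Entry `n` of the environment enters only the last of the `n + 1` steps. -/
lemma killedIter_update (e : ℕ → E) (n : ℕ) (e' : E) (g : ℝ → ℝ≥0∞) :
    killedIter (steps law (Function.update e n e')) (n + 1) g =
      killedIter (steps law e) n (killedStep (stepLaw (law e')) g) := by
  have h : ∀ (m : ℕ), m ≤ n → ∀ g, killedIter (steps law (Function.update e n e')) m g =
      killedIter (steps law e) m g := by
    intro m
    induction m with
    | zero => intro _ _; rw [killedIter, killedIter]
    | succ m ih =>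
      intro hm g
      have hne : m ≠ n := by omega
      have e1 : steps law (Function.update e n e') m = steps law e m :=
        congrArg (fun x => stepLaw (law x)) (Function.update_of_ne hne e' e)
      rw [killedIter_succ', killedIter_succ', ih (by omega), e1]
  have e2 : steps law (Function.update e n e') n = stepLaw (law e') :=
    congrArg (fun x => stepLaw (law x)) (Function.update_self n e' e)
  rw [killedIter_succ', h n le_rfl, e2]

lemma measurable_killedIter_env {g : ℝ → ℝ≥0∞} (hg : Measurable g) (n : ℕ) (x : ℝ) :
    Measurable fun e : ℕ → E => killedIter (steps law e) n g x := by
  have h := measurable_killedIter_prod (law := law) (γ := ℕ → E) (k := fun e => e) measurable_id n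
    (f := fun p => g p.2) (hg.comp measurable_snd)
  have h2 : Measurable fun e : ℕ → E => (e, x) := by fun_prop
  have h3 := h.comp h2
  simpa only [Function.comp_def] using h3

/-- A superharmonic function of the annealed random walk dominates the quenched killed random
walks in the mean. -/
lemma lintegral_killedIter_le (ν : Measure E) [IsProbabilityMeasure ν] {h : ℝ → ℝ≥0∞}
    (hm : Measurable h) (hsup : ∀ x, 0 ≤ x → killedStep (stepLaw (ν.bind law)) h x ≤ h x)
    (n : ℕ) {x : ℝ} (hx : 0 ≤ x) :
    ∫⁻ e, killedIter (steps law e) n h x ∂(Measure.infinitePi fun _ : ℕ => ν) ≤ h x := by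
  induction n with
  | zero => simp [killedIter]
  | succ n ih =>
    -- Averaging over entry `n` alone makes the last step annealed, while the first `n` steps stay
    -- quenched. Superharmonicity then removes the last step.
    rw [lintegral_infinitePi_update _ n (measurable_killedIter_env (law := law) hm (n + 1) x)]
    refine le_trans (lintegral_mono fun e => ?_) ih
    simp_rw [killedIter_update]
    have hf : Measurable fun p : E × ℝ => killedStep (stepLaw (law p.1)) h p.2 :=
      measurable_killedStep_prod (law := law) (k := id) measurable_id (f := fun p => h p.2)
        (by fun_prop)
    have := lintegral_killedIter ν (steps law e) n hf x
    dsimp only at this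
    rw [this]
    refine killedIter_mono _ n (fun y hy => ?_) x hx
    refine le_trans (le_of_eq ?_) (hsup y hy)
    have hy' : Measurable fun z => (Set.Ici (0 : ℝ)).indicator h (y + z) :=
      (hm.indicator measurableSet_Ici).comp (by fun_prop)
    exact (lintegral_stepLaw_bind ν hy').symm

lemma monotoneOn_killedIter (ν : ℕ → Measure ℝ) (n : ℕ) {g : ℝ → ℝ≥0∞}
    (hg : MonotoneOn g (Set.Ici 0)) : MonotoneOn (killedIter ν n g) (Set.Ici 0) := by
  induction n generalizing g with
  | zero => exact hg
  | succ n ih =>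
    rw [killedIter_succ']
    refine ih fun x hx y hy hxy => lintegral_mono fun z => ?_
    by_cases hz : 0 ≤ x + z
    · have hz' : 0 ≤ y + z := by linarith
      simpa [hz, hz'] using hg hz hz' (by linarith)
    · simp [hz]

lemma harmonic_monotoneOn (ν : ℕ → Measure ℝ) : MonotoneOn (harmonic ν) (Set.Ici 0) :=
  fun _ hx _ hy hxy => iSup_mono fun n => monotoneOn_killedIter ν n
    (fun _ _ _ _ h => ENNReal.ofReal_le_ofReal h) hx hy hxy

/-- By monotone convergence the mean of `harmonic` over the environment is bounded by the
superharmonic function of the annealed walk, which is finite. -/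
theorem ae_harmonic_ne_top (ν : Measure E) [IsProbabilityMeasure ν]
    (hc : ∀ᵐ e ∂ν, CenteredStep (stepLaw (law e))) (hann : CenteredStep (stepLaw (ν.bind law)))
    {δ : ℝ} (hδ : 0 < δ)
    (hmom : ∫⁻ z, ENNReal.ofReal (|z| ^ (2 + δ)) ∂(stepLaw (ν.bind law)) ≠ ⊤) :
    ∀ᵐ e ∂(Measure.infinitePi fun _ : ℕ => ν), ∀ y, 0 ≤ y → harmonic (steps law e) y ≠ ⊤ := by
  obtain ⟨h, hm, htop, hle, hsup⟩ := hann.exists_superharmonic hδ hmom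
  have hM : ∀ (n : ℕ) (x : ℝ),
      Measurable fun e : ℕ → E => killedIter (steps law e) n ENNReal.ofReal x :=
    measurable_killedIter_env ENNReal.measurable_ofReal
  have hcs : ∀ᵐ e ∂(Measure.infinitePi fun _ : ℕ => ν), ∀ n, CenteredStep (steps law e n) := by
    rw [ae_all_iff]
    intro n
    have := measurePreserving_eval_infinitePi (fun _ : ℕ => ν) n
    rw [← this.map_eq] at hc
    exact ae_of_ae_map this.measurable.aemeasurable hc
  -- Integer starting points keep the exceptional set null; monotonicity in the starting point then
  -- covers all real `y ≥ 0`.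
  have hN : ∀ᵐ e ∂(Measure.infinitePi fun _ : ℕ => ν), ∀ N : ℕ,
      harmonic (steps law e) N ≠ ⊤ := by
    rw [ae_all_iff]
    intro N
    have hlt : ∫⁻ e, harmonic (steps law e) N ∂(Measure.infinitePi fun _ : ℕ => ν) ≤ h N := by
      unfold harmonic
      rw [lintegral_iSup' (fun n => (hM n N).aemeasurable)
        (hcs.mono fun e he => killedIter_monotone he N.cast_nonneg)]
      refine iSup_le fun n => le_trans (lintegral_mono fun e => ?_)
        (lintegral_killedIter_le ν hm hsup n N.cast_nonneg)
      exact killedIter_mono _ n hle _ N.cast_nonneg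
    refine (ae_lt_top (Measurable.iSup fun n => hM n N)
      (ne_top_of_le_ne_top (htop N) hlt)).mono fun e he => he.ne
  filter_upwards [hN] with e he y hy
  obtain ⟨N, hyN⟩ := exists_nat_ge y
  exact ne_top_of_le_ne_top (he N) (harmonic_monotoneOn _ hy (hy.trans hyN) hyN)

/-! ### From the hypotheses on the broods to those on the step laws -/

lemma abs_le_one_add_rpow {δ : ℝ} (hδ : 0 < δ) (z : ℝ) : |z| ≤ 1 + |z| ^ (2 + δ) := by
  have h0 := Real.rpow_nonneg (abs_nonneg z) (2 + δ)
  rcases le_total |z| 1 with h | h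
  · linarith
  · have := Real.rpow_le_rpow_of_exponent_le h (show (1 : ℝ) ≤ 2 + δ by linarith)
    rw [Real.rpow_one] at this
    linarith

/-- Everything is the many-to-one formula except the centering, which is assumed for a signed sum.
The moment bound allows it to be split into finite positive and negative parts. -/
lemma centeredStep_stepLaw (ν : Measure Brood) [IsProbabilityMeasure ν]
    (hadd : ∫⁻ b, childSum (fun x => ENNReal.ofReal (Real.exp (-x))) b ∂ν = 1)
    (hder : ∫ b, ∑' i, atPos (fun x : ℝ => x * Real.exp (-x)) (b i) ∂ν = 0)
    (hpos : 0 < ∫⁻ b, childSum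
      ((Set.Ioi (0 : ℝ)).indicator fun x => ENNReal.ofReal (Real.exp (-x))) b ∂ν)
    {δ : ℝ} (hδ : 0 < δ)
    (hmom : ∫⁻ b, childSum (fun x => ENNReal.ofReal (|x| ^ (2 + δ) * Real.exp (-x))) b ∂ν ≠ ⊤) :
    CenteredStep (stepLaw ν) := by
  have hprob : IsProbabilityMeasure (stepLaw ν) := by
    refine ⟨?_⟩
    rw [← lintegral_one, lintegral_stepLaw ν measurable_const]
    simpa using hadd
  have hmom' : ∫⁻ z, ENNReal.ofReal (|z| ^ (2 + δ)) ∂(stepLaw ν) ≠ ⊤ := by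
    have hm : Measurable fun z : ℝ => ENNReal.ofReal (|z| ^ (2 + δ)) :=
      (measurable_id.abs.pow_const _).ennreal_ofReal
    rw [lintegral_stepLaw ν hm]
    convert hmom using 5 with b x
    rw [ENNReal.ofReal_mul (Real.rpow_nonneg (abs_nonneg _) _)]
  have hfin : ∀ g : ℝ → ℝ, (∀ z, g z ≤ |z|) → ∫⁻ z, ENNReal.ofReal (g z) ∂(stepLaw ν) ≠ ⊤ := by
    intro g hg
    have hle : ∫⁻ z, ENNReal.ofReal (g z) ∂(stepLaw ν) ≤
        ∫⁻ z, (1 + ENNReal.ofReal (|z| ^ (2 + δ))) ∂(stepLaw ν) := by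
      refine lintegral_mono fun z => ?_
      rw [← ENNReal.ofReal_one, ← ENNReal.ofReal_add zero_le_one
        (Real.rpow_nonneg (abs_nonneg _) _)]
      exact ENNReal.ofReal_le_ofReal ((hg z).trans (abs_le_one_add_rpow hδ z))
    refine ne_top_of_le_ne_top ?_ hle
    rw [lintegral_add_left measurable_const, lintegral_const, measure_univ, mul_one]
    exact ENNReal.add_ne_top.2 ⟨ENNReal.one_ne_top, hmom'⟩
  have hneg := hfin (fun z => -z) fun z => neg_le_abs z
  have hposi := hfin (fun z => z) fun z => le_abs_self z
  refine ⟨hprob, ?_, hneg, ?_⟩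
  · let p : Brood → ℝ≥0∞ := childSum fun z => ENNReal.ofReal z * ENNReal.ofReal (Real.exp (-z))
    let q : Brood → ℝ≥0∞ := childSum fun z => ENNReal.ofReal (-z) * ENNReal.ofReal (Real.exp (-z))
    have hp : Measurable p := measurable_childSum (by fun_prop)
    have hq : Measurable q := measurable_childSum (by fun_prop)
    have hpi : ∫⁻ b, p b ∂ν = ∫⁻ z, ENNReal.ofReal z ∂(stepLaw ν) :=
      (lintegral_stepLaw ν (by fun_prop)).symm
    have hqi : ∫⁻ b, q b ∂ν = ∫⁻ z, ENNReal.ofReal (-z) ∂(stepLaw ν) :=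
      (lintegral_stepLaw ν (by fun_prop)).symm
    have hpt : ∀ᵐ b ∂ν, p b < ⊤ := ae_lt_top hp (by rw [hpi]; exact hposi)
    have hqt : ∀ᵐ b ∂ν, q b < ⊤ := ae_lt_top hq (by rw [hqi]; exact hneg)
    -- A divergent real `tsum` and a non-integrable Bochner integral would both default to `0`.
    -- Almost sure summability of both parts ensures that neither default occurs.
    have hsum : ∀ᵐ b ∂ν, ∑' i, atPos (fun x : ℝ => x * Real.exp (-x)) (b i) =
        (p b).toReal - (q b).toReal := by
      filter_upwards [hpt, hqt] with b h1 h2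
      have h1' : ∑' i, atPos (fun z => ENNReal.ofReal z * ENNReal.ofReal (Real.exp (-z))) (b i)
        ≠ ⊤ := h1.ne
      have h2' : ∑' i, atPos (fun z => ENNReal.ofReal (-z) * ENNReal.ofReal (Real.exp (-z))) (b i)
        ≠ ⊤ := h2.ne
      unfold p q childSum
      rw [ENNReal.tsum_toReal_eq fun i => ENNReal.ne_top_of_tsum_ne_top h1' i,
        ENNReal.tsum_toReal_eq fun i => ENNReal.ne_top_of_tsum_ne_top h2' i,
        ← (ENNReal.summable_toReal h1').tsum_sub (ENNReal.summable_toReal h2')]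
      refine tsum_congr fun i => ?_
      cases b i with
      | top => simp [atPos_top]
      | coe x =>
        simp only [atPos_coe]
        rw [← ENNReal.ofReal_mul' (Real.exp_nonneg _), ← ENNReal.ofReal_mul' (Real.exp_nonneg _)]
        rcases le_total 0 x with hx | hx
        · rw [ENNReal.toReal_ofReal (mul_nonneg hx (Real.exp_nonneg _)),
            ENNReal.ofReal_of_nonpos (mul_nonpos_of_nonpos_of_nonneg (neg_nonpos.2 hx)
              (Real.exp_nonneg _))]
          simp
        · rw [ENNReal.ofReal_of_nonpos (mul_nonpos_of_nonpos_of_nonneg hx (Real.exp_nonneg _)),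
            ENNReal.toReal_ofReal (mul_nonneg (neg_nonneg.2 hx) (Real.exp_nonneg _))]
          simp
    rw [integral_congr_ae hsum, integral_sub
      (integrable_toReal_of_lintegral_ne_top hp.aemeasurable (by rw [hpi]; exact hposi))
      (integrable_toReal_of_lintegral_ne_top hq.aemeasurable (by rw [hqi]; exact hneg)),
      integral_toReal hp.aemeasurable hpt, integral_toReal hq.aemeasurable hqt, hpi, hqi,
      sub_eq_zero] at hder
    exact (ENNReal.toReal_eq_toReal_iff' hposi hneg).1 hder
  · have : stepLaw ν (Set.Ioi 0) = ∫⁻ z, (Set.Ioi (0 : ℝ)).indicator 1 z ∂(stepLaw ν) :=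
      (lintegral_indicator_one measurableSet_Ioi).symm
    rw [this, lintegral_stepLaw ν (measurable_one.indicator measurableSet_Ioi)]
    convert hpos using 5 with b x
    by_cases hx : 0 < x <;> simp [hx]

/-- Centering and mass pass through the mixture, but finiteness of the mean does not follow from its
quenched counterpart and is taken from the annealed moment. -/
lemma centeredStep_bind (ν : Measure E) [IsProbabilityMeasure ν]
    (hc : ∀ᵐ e ∂ν, CenteredStep (stepLaw (law e))) {δ : ℝ} (hδ : 0 < δ)
    (hmom : ∫⁻ z, ENNReal.ofReal (|z| ^ (2 + δ)) ∂(stepLaw (ν.bind law)) ≠ ⊤) :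
    CenteredStep (stepLaw (ν.bind law)) := by
  have hprob : IsProbabilityMeasure (stepLaw (ν.bind law)) := by
    refine ⟨?_⟩
    rw [← lintegral_one, lintegral_stepLaw_bind ν measurable_const,
      lintegral_congr_ae (g := fun _ => 1) (hc.mono fun e he => ?_)]
    · simp
    · have := he.prob
      simp
  refine ⟨hprob, ?_, ?_, ?_⟩
  · rw [lintegral_stepLaw_bind ν (by fun_prop), lintegral_stepLaw_bind ν (by fun_prop)]
    exact lintegral_congr_ae (hc.mono fun e he => he.mean)
  · have hle : ∫⁻ z, ENNReal.ofReal (-z) ∂(stepLaw (ν.bind law)) ≤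
        ∫⁻ z, (1 + ENNReal.ofReal (|z| ^ (2 + δ))) ∂(stepLaw (ν.bind law)) := by
      refine lintegral_mono fun z => ?_
      rw [← ENNReal.ofReal_one, ← ENNReal.ofReal_add zero_le_one
        (Real.rpow_nonneg (abs_nonneg _) _)]
      refine ENNReal.ofReal_le_ofReal ((neg_le_abs z).trans (abs_le_one_add_rpow hδ z))
    refine ne_top_of_le_ne_top ?_ hle
    rw [lintegral_add_left measurable_const, lintegral_const, measure_univ, mul_one]
    exact ENNReal.add_ne_top.2 ⟨ENNReal.one_ne_top, hmom⟩
  · have hm : Measurable ((Set.Ioi (0 : ℝ)).indicator (1 : ℝ → ℝ≥0∞)) :=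
      measurable_one.indicator measurableSet_Ioi
    have hm' : Measurable fun e => ∫⁻ z, (Set.Ioi (0 : ℝ)).indicator 1 z ∂(stepLaw (law e)) :=
      measurable_lintegral_stepLaw measurable_id (hm.comp measurable_snd)
    rw [← lintegral_indicator_one measurableSet_Ioi, lintegral_stepLaw_bind ν hm,
      pos_iff_ne_zero]
    intro h0
    have h1 := (lintegral_eq_zero_iff hm').1 h0
    obtain ⟨e, he, he'⟩ := (hc.and h1).exists
    have he' : ∫⁻ z, (Set.Ioi (0 : ℝ)).indicator 1 z ∂(stepLaw (law e)) = 0 := he'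
    rw [lintegral_indicator_one measurableSet_Ioi] at he'
    exact he.pos.ne' he'

end

/-! ### Good environments -/

section

variable {E : Type*} [MeasurableSpace E] {law : Kernel E Brood} [IsMarkovKernel law]

/-- An environment in which all steps are centered and the harmonic functions are finite. -/
structure GoodEnv (law : Kernel E Brood) (e : ℕ → E) : Prop where
  centered : ∀ k, CenteredStep (steps law e k)
  finite : ∀ k y, 0 ≤ y → harmonic (steps law (shift k e)) y ≠ ⊤

/-- Allows the almost sure statement under `P` to be transferred to the law of `ξ 0`. -/
lemma measurableSet_centeredStep :
    MeasurableSet {e : E | CenteredStep (stepLaw (law e))} := by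
  have hm : ∀ g : ℝ → ℝ≥0∞, Measurable g →
      Measurable fun e : E => ∫⁻ z, g z ∂(stepLaw (law e)) := fun g hg =>
    measurable_lintegral_stepLaw measurable_id (hg.comp measurable_snd)
  have hI : Measurable ((Set.Ioi (0 : ℝ)).indicator (1 : ℝ → ℝ≥0∞)) :=
    measurable_one.indicator measurableSet_Ioi
  have : {e : E | CenteredStep (stepLaw (law e))} =
      {e | ∫⁻ _, 1 ∂(stepLaw (law e)) = 1} ∩
      ({e | ∫⁻ z, ENNReal.ofReal z ∂(stepLaw (law e)) =
          ∫⁻ z, ENNReal.ofReal (-z) ∂(stepLaw (law e))} ∩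
      ({e | ∫⁻ z, ENNReal.ofReal (-z) ∂(stepLaw (law e)) = ⊤}ᶜ ∩
      {e | 0 < ∫⁻ z, (Set.Ioi (0 : ℝ)).indicator 1 z ∂(stepLaw (law e))})) := by
    ext e
    simp only [Set.mem_ofPred_eq, Set.mem_inter_iff, Set.mem_compl_iff, lintegral_one,
      lintegral_indicator_one measurableSet_Ioi]
    exact ⟨fun h => ⟨h.prob.measure_univ, h.mean, h.finite, h.pos⟩,
      fun ⟨h1, h2, h3, h4⟩ => ⟨⟨h1⟩, h2, h3, h4⟩⟩
  rw [this]
  exact (hm _ measurable_const (measurableSet_singleton 1)).inter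
    ((measurableSet_eq_fun (hm _ (by fun_prop)) (hm _ (by fun_prop))).inter
      ((hm _ (by fun_prop) (measurableSet_singleton ⊤)).compl.inter
        (measurableSet_lt measurable_const (hm _ hI))))

theorem ae_goodEnv {Ω : Type*} [MeasurableSpace Ω] (P : Measure Ω) [IsProbabilityMeasure P]
    (ξ : ℕ → Ω → E) (hξ : ∀ n, Measurable (ξ n))
    (hindep : iIndepFun ξ P) (hident : ∀ n, IdentDistrib (ξ n) (ξ 0) P P)
    (hpos : ∀ᵐ ω ∂P, 0 < ∫⁻ b, childSum
      ((Set.Ioi (0 : ℝ)).indicator fun x => ENNReal.ofReal (Real.exp (-x))) b ∂(law (ξ 0 ω)))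
    (hadd : ∀ᵐ ω ∂P,
      ∫⁻ b, childSum (fun x => ENNReal.ofReal (Real.exp (-x))) b ∂(law (ξ 0 ω)) = 1)
    (hder : ∀ᵐ ω ∂P,
      ∫ b, ∑' i, atPos (fun x : ℝ => x * Real.exp (-x)) (b i) ∂(law (ξ 0 ω)) = 0)
    {δ : ℝ} (hδ : 0 < δ)
    (hmom : ∫⁻ ω, ∫⁻ b, childSum
      (fun x => ENNReal.ofReal (|x| ^ (2 + δ) * Real.exp (-x))) b ∂(law (ξ 0 ω)) ∂P < ⊤) :
    ∀ᵐ ω ∂P, GoodEnv law fun n => ξ n ω := by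
  set ν := P.map (ξ 0) with hν
  have hνp : IsProbabilityMeasure ν := Measure.isProbabilityMeasure_map (hξ 0).aemeasurable
  have hνn : ∀ n, P.map (ξ n) = ν := fun n => (hident n).map_eq
  have hmp : Measurable fun x : ℝ => |x| ^ (2 + δ) := measurable_id.abs.pow_const _
  have hmB : Measurable fun e : E => ∫⁻ b, childSum
      (fun x => ENNReal.ofReal (|x| ^ (2 + δ) * Real.exp (-x))) b ∂(law e) :=
    (measurable_childSum (by fun_prop)).lintegral_kernel
  have hfin : ∀ᵐ ω ∂P, ∫⁻ b, childSum
      (fun x => ENNReal.ofReal (|x| ^ (2 + δ) * Real.exp (-x))) b ∂(law (ξ 0 ω)) < ⊤ :=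
    ae_lt_top (hmB.comp (hξ 0)) hmom.ne
  have hc0 : ∀ᵐ ω ∂P, CenteredStep (stepLaw (law (ξ 0 ω))) := by
    filter_upwards [hpos, hadd, hder, hfin] with ω h1 h2 h3 h4
    exact centeredStep_stepLaw _ h2 h3 h1 hδ h4.ne
  have hc : ∀ᵐ e ∂ν, CenteredStep (stepLaw (law e)) :=
    (ae_map_iff (hξ 0).aemeasurable measurableSet_centeredStep).2 hc0
  have hmom' : ∫⁻ z, ENNReal.ofReal (|z| ^ (2 + δ)) ∂(stepLaw (ν.bind law)) ≠ ⊤ := by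
    rw [lintegral_stepLaw_bind ν (by fun_prop)]
    refine ne_top_of_le_ne_top hmom.ne (le_of_eq ?_)
    simp_rw [fun e => lintegral_stepLaw (law e) hmp.ennreal_ofReal]
    simp_rw [← ENNReal.ofReal_mul (Real.rpow_nonneg (abs_nonneg _) _)]
    rw [hν, lintegral_map hmB (hξ 0)]
  have hann := centeredStep_bind ν hc hδ hmom'
  have hH := ae_harmonic_ne_top ν hc hann hδ hmom'
  -- Every shifted environment has the same product law, so one almost sure statement serves all of
  -- the countably many shifts.
  have hshift : ∀ k, P.map (fun ω n => ξ (n + k) ω) = Measure.infinitePi fun _ : ℕ => ν := by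
    intro k
    have h1 : iIndepFun (fun n => ξ (n + k)) P :=
      hindep.precomp (g := fun n => n + k) (add_left_injective k)
    have h2 := (iIndepFun_iff_map_fun_eq_infinitePi_map fun n => hξ (n + k)).1 h1
    simpa only [hνn] using h2
  have hall : ∀ᵐ ω ∂P, ∀ k, CenteredStep (stepLaw (law (ξ k ω))) := by
    rw [ae_all_iff]
    intro k
    rw [← hνn k] at hc
    exact ae_of_ae_map (hξ k).aemeasurable hc
  have hall2 : ∀ᵐ ω ∂P, ∀ k, ∀ y, 0 ≤ y →
      harmonic (steps law (shift k fun n => ξ n ω)) y ≠ ⊤ := by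
    rw [ae_all_iff]
    intro k
    rw [← hshift k] at hH
    exact ae_of_ae_map (measurable_pi_lambda _ fun n => hξ (n + k)).aemeasurable hH
  filter_upwards [hall, hall2] with ω h1 h2
  exact ⟨h1, h2⟩

namespace GoodEnv

variable {e : ℕ → E} (h : GoodEnv law e)

include h

lemma isProbabilityMeasure (k : ℕ) : IsProbabilityMeasure (steps law e k) := (h.centered k).prob

lemma centered_shift (n k : ℕ) : CenteredStep (steps law (shift n e) k) := h.centered (k + n)

lemma tendsto_Un (n : ℕ) {y : ℝ} (hy : 0 ≤ y) :
    Tendsto (fun m => Un law m (shift n e) y) atTop (𝓝 (U law (shift n e) y)) := by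
  rw [U_eq_toReal (h.centered_shift n) hy (h.finite n y hy)]
  exact BRWRE.tendsto_Un (h.centered_shift n) hy (h.finite n y hy)

lemma ofReal_U (n : ℕ) {y : ℝ} (hy : 0 ≤ y) :
    ENNReal.ofReal (U law (shift n e) y) = harmonic (steps law (shift n e)) y := by
  rw [U_eq_toReal (h.centered_shift n) hy (h.finite n y hy),
    ENNReal.ofReal_toReal (h.finite n y hy)]

lemma U_pos (n : ℕ) {y : ℝ} (hy : 0 ≤ y) : 0 < U law (shift n e) y := by
  have := harmonic_pos (h.centered_shift n) hy
  rw [← h.ofReal_U n hy] at this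
  exact ENNReal.ofReal_pos.1 this

lemma measurable_U (n : ℕ) : Measurable (U law (shift n e)) := by
  have := fun k => (h.centered_shift n k).prob
  exact BRWRE.measurable_U

/-- Translation by `β` turns killing below `0` into killing below `-β`. Finiteness makes
`ENNReal.ofReal` of the real-valued `U` equal to `harmonic`. -/
lemma U_harmonic (β : ℝ) (k : ℕ) {x : ℝ} (hx : -β ≤ x) :
    ENNReal.ofReal (U law (shift k e) (x + β)) =
      ∫⁻ z, (Set.Ici (-β)).indicator
        (fun y => ENNReal.ofReal (U law (shift (k + 1) e) (y + β))) (x + z) ∂(steps law e k) := by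
  have hx' : 0 ≤ x + β := by linarith
  have e1 : (fun j => steps law (shift k e) (j + 1)) = steps law (shift (k + 1) e) := by
    funext j
    simp only [steps, shift]
    congr 3
    omega
  have e2 : steps law (shift k e) 0 = steps law e k := by simp [steps, shift]
  rw [h.ofReal_U k hx', harmonic_eq_killedStep (h.centered_shift k) hx', e1, e2, killedStep]
  refine lintegral_congr fun z => ?_
  by_cases hz : -β ≤ x + z
  · have hz' : 0 ≤ x + z + β := by linarith
    rw [Set.indicator_of_mem (show _ ∈ Set.Ici (-β) from hz), h.ofReal_U _ hz',
      Set.indicator_of_mem (show _ ∈ Set.Ici (0 : ℝ) by simp only [Set.mem_Ici]; linarith)]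
    congr 1
    ring
  · rw [Set.indicator_of_notMem (show _ ∉ Set.Ici (-β) from hz), Set.indicator_of_notMem]
    simp only [Set.mem_Ici]
    exact fun hc => hz (by linarith)

end GoodEnv

end

/-! ### Integrals against the transition kernels -/

/-- Total mass one at `x` is what rules out the fallback kernel `η` there. -/
lemma lintegral_densityKernel {α γ : Type*} [MeasurableSpace α] [MeasurableSpace γ]
    (κ : Kernel α γ) [IsSFiniteKernel κ] {f : α → γ → ℝ≥0∞} (hf : Measurable (Function.uncurry f))
    (η : Kernel α γ) {x : α} (hx : ∫⁻ y, f x y ∂(κ x) = 1) {g : γ → ℝ≥0∞} (hg : Measurable g) :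
    ∫⁻ y, g y ∂(densityKernel κ f η x) = ∫⁻ y, f x y * g y ∂(κ x) := by
  classical
  have hmass : κ.withDensity f x Set.univ = 1 := by
    rw [Kernel.withDensity_apply' κ hf, setLIntegral_univ, hx]
  have e : densityKernel κ f η x = κ.withDensity f x := by
    unfold densityKernel
    rw [Kernel.piecewise_apply, if_pos]
    exact hmass
  rw [e, Kernel.lintegral_withDensity κ hf x hg]

section

variable {E : Type*} [MeasurableSpace E] {law : Kernel E Brood} [IsMarkovKernel law]

/-- The harmonic function `x ↦ U(θ^k ξ, x + β)` with values in `[0, ∞]`. -/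
def level (law : Kernel E Brood) (e : ℕ → E) (β : ℝ) (k : ℕ) (x : ℝ) : ℝ≥0∞ :=
  ENNReal.ofReal (U law (shift k e) (x + β))

lemma childWeight_eq (e : ℕ → E) (β : ℝ) (k : ℕ) (x : ℝ) (z : WithTop ℝ) :
    childWeight law e β k x z = atPos (fun z => (Set.Ici (-β)).indicator
      (fun y => ENNReal.ofReal (U law (shift (k + 1) e) (y + β) * Real.exp (-y))) (x + z)) z := by
  unfold childWeight
  cases z with
  | top => rw [add_top, atPos_top, atPos_top]
  | coe z => rw [← WithTop.coe_add, atPos_coe, atPos_coe]; simp [Set.indicator_apply]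

/-- The exponential is split on purpose: `e^{-z}` is absorbed into the step law, and `e^{-x}`
cancels against the normalisation at the parent. -/
lemma childWeight_coe (e : ℕ → E) (β : ℝ) (k : ℕ) (x z : ℝ) :
    childWeight law e β k x (z : WithTop ℝ) =
      (Set.Ici (-β)).indicator (level law e β (k + 1)) (x + z) *
        ENNReal.ofReal (Real.exp (-x)) * ENNReal.ofReal (Real.exp (-z)) := by
  rw [childWeight_eq, atPos_coe]
  by_cases hz : -β ≤ x + z
  · rw [Set.indicator_of_mem (show _ ∈ Set.Ici (-β) from hz),
      Set.indicator_of_mem (show _ ∈ Set.Ici (-β) from hz), level,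
      ENNReal.ofReal_mul' (Real.exp_nonneg _), mul_assoc,
      ← ENNReal.ofReal_mul (Real.exp_nonneg _), ← Real.exp_add]
    ring_nf
  · rw [Set.indicator_of_notMem (show _ ∉ Set.Ici (-β) from hz),
      Set.indicator_of_notMem (show _ ∉ Set.Ici (-β) from hz)]
    simp

namespace GoodEnv

variable {e : ℕ → E} (h : GoodEnv law e)

include h

lemma measurable_level (β : ℝ) (k : ℕ) : Measurable (level law e β k) :=
  ((h.measurable_U k).comp (by fun_prop)).ennreal_ofReal

lemma level_ne_zero {β : ℝ} (k : ℕ) {x : ℝ} (hx : -β ≤ x) : level law e β k x ≠ 0 :=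
  (ENNReal.ofReal_pos.2 (h.U_pos k (by linarith))).ne'

lemma mul_exp_ne_zero {β : ℝ} (k : ℕ) {x : ℝ} (hx : -β ≤ x) :
    ENNReal.ofReal (U law (shift k e) (x + β) * Real.exp (-x)) ≠ 0 :=
  (ENNReal.ofReal_pos.2 (mul_pos (h.U_pos k (by linarith)) (Real.exp_pos _))).ne'

lemma level_eq_lintegral (β : ℝ) (k : ℕ) {x : ℝ} (hx : -β ≤ x) :
    ∫⁻ z, (Set.Ici (-β)).indicator (level law e β (k + 1)) (x + z) ∂(steps law e k) =
      level law e β k x :=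
  (h.U_harmonic β k hx).symm

/-- Harmonicity is the statement that the density has mass one, so above `-β` the kernel is the
genuine `h`-transform. -/
lemma lintegral_condKernel (β : ℝ) (k : ℕ) {x : ℝ} (hx : -β ≤ x) {g : ℝ → ℝ≥0∞}
    (hg : Measurable g) :
    ∫⁻ y, g y ∂(condKernel law e β k x) =
      ∫⁻ z, g (x + z) * ((Set.Ici (-β)).indicator (level law e β (k + 1)) (x + z) /
        level law e β k x) ∂(steps law e k) := by
  classical
  have hU := h.measurable_U k
  have hU' := h.measurable_U (k + 1)
  set κ : Kernel ℝ ℝ :=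
    (Kernel.id ×ₖ Kernel.const ℝ (stepLaw (law (e k)))).map fun p => p.1 + p.2 with hκ
  have hint : ∀ g : ℝ → ℝ≥0∞, Measurable g →
      ∫⁻ y, g y ∂(κ x) = ∫⁻ z, g (x + z) ∂(steps law e k) := by
    intro g hg
    rw [hκ, Kernel.map_apply _ (by fun_prop), lintegral_map hg (by fun_prop),
      Kernel.prod_apply, Kernel.id_apply, Kernel.const_apply,
      lintegral_prod _ (by fun_prop), lintegral_dirac' _ (by fun_prop)]
    rfl
  have hden : ∀ y, (if -β ≤ y then
      ENNReal.ofReal (U law (shift (k + 1) e) (y + β) / U law (shift k e) (x + β)) else 0) =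
      (Set.Ici (-β)).indicator (level law e β (k + 1)) y / level law e β k x := by
    intro y
    split_ifs with hy
    · rw [Set.indicator_of_mem (show _ ∈ Set.Ici (-β) from hy),
        ENNReal.ofReal_div_of_pos (h.U_pos k (by linarith))]
      rfl
    · rw [Set.indicator_of_notMem (show _ ∉ Set.Ici (-β) from hy), ENNReal.zero_div]
  have hl := (h.measurable_level β (k + 1)).indicator (measurableSet_Ici (a := -β))
  have hfm : Measurable (Function.uncurry fun x y : ℝ => if -β ≤ y then
      ENNReal.ofReal (U law (shift (k + 1) e) (y + β) / U law (shift k e) (x + β)) else 0) := by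
    refine Measurable.ite (measurableSet_le measurable_const measurable_snd) ?_ measurable_const
    exact ((hU'.comp (by fun_prop)).div (hU.comp (by fun_prop))).ennreal_ofReal
  unfold condKernel
  rw [lintegral_densityKernel κ hfm _ _ hg]
  · simp_rw [hden]
    rw [hint (fun y => (Set.Ici (-β)).indicator (level law e β (k + 1)) y / level law e β k x * g y)
      ((hl.div_const _).mul hg)]
    simp_rw [mul_comm]
  · simp_rw [hden]
    rw [hint _ (hl.div_const _)]
    simp_rw [div_eq_mul_inv]
    have hlx : Measurable fun z => (Set.Ici (-β)).indicator (level law e β (k + 1)) (x + z) :=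
      hl.comp (by fun_prop)
    rw [lintegral_mul_const _ hlx, h.level_eq_lintegral β k hx,
      ENNReal.mul_inv_cancel (h.level_ne_zero k hx) ENNReal.ofReal_ne_top]

lemma measurable_childWeight (β : ℝ) (k : ℕ) :
    Measurable fun p : ℝ × WithTop ℝ => childWeight law e β k p.1 p.2 := by
  have : (fun p : ℝ × WithTop ℝ => childWeight law e β k p.1 p.2) = fun p =>
      if p.2 = ⊤ then 0 else
        (Set.Ici (-β)).indicator (level law e β (k + 1)) (p.1 + p.2.untopD 0) *
        ENNReal.ofReal (Real.exp (-p.1)) * ENNReal.ofReal (Real.exp (-p.2.untopD 0)) := by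
    funext ⟨x, z⟩
    cases z with
    | top => simp [childWeight_eq, atPos_top]
    | coe z => simp [childWeight_coe]
  have hu : Measurable fun p : ℝ × WithTop ℝ => p.2.untopD 0 := measurable_snd.untopD 0
  rw [this]
  refine Measurable.ite (measurable_snd (measurableSet_singleton ⊤)) measurable_const ?_
  exact ((((h.measurable_level β (k + 1)).indicator measurableSet_Ici).comp (by fun_prop)).mul
    (by fun_prop)).mul (by fun_prop)

lemma measurable_childWeight_apply (β : ℝ) (k i : ℕ) :
    Measurable fun p : ℝ × Brood => childWeight law e β k p.1 (p.2 i) :=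
  (h.measurable_childWeight β k).comp (g := fun p : ℝ × WithTop ℝ => childWeight law e β k p.1 p.2)
    (f := fun p : ℝ × Brood => (p.1, p.2 i)) (by fun_prop)

lemma measurable_tsum_childWeight (β : ℝ) (k : ℕ) :
    Measurable fun p : ℝ × Brood => ∑' i, childWeight law e β k p.1 (p.2 i) :=
  Measurable.tsum fun i => h.measurable_childWeight_apply β k i

/-- The many-to-one formula for one generation. -/
lemma lintegral_tsum_childWeight (β : ℝ) (k : ℕ) (x : ℝ) {g : ℝ → ℝ≥0∞} (hg : Measurable g) :
    ∫⁻ b, ∑' i, childWeight law e β k x (b i) * g (x + (b i).untopD 0) ∂(law (e k)) =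
      ENNReal.ofReal (Real.exp (-x)) * ∫⁻ z, g (x + z) *
        (Set.Ici (-β)).indicator (level law e β (k + 1)) (x + z) ∂(steps law e k) := by
  have hl := (h.measurable_level β (k + 1)).indicator (measurableSet_Ici (a := -β))
  have hm : Measurable fun z => g (x + z) *
      (Set.Ici (-β)).indicator (level law e β (k + 1)) (x + z) :=
    (hg.comp (by fun_prop)).mul (hl.comp (by fun_prop))
  rw [← lintegral_const_mul _ hm]
  unfold steps
  rw [lintegral_stepLaw _ (hm.const_mul _)]
  unfold childSum
  refine lintegral_congr fun b => tsum_congr fun i => ?_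
  cases b i with
  | top => simp [childWeight_eq, atPos_top]
  | coe z =>
    rw [childWeight_coe, atPos_coe, WithTop.untopD_coe]
    ring

/-- Harmonicity once more, now for broods: the density of the spine brood has mean one. -/
lemma lintegral_tsum_childWeight_eq (β : ℝ) (k : ℕ) {x : ℝ} (hx : -β ≤ x) :
    ∫⁻ b, ∑' i, childWeight law e β k x (b i) ∂(law (e k)) =
      ENNReal.ofReal (U law (shift k e) (x + β) * Real.exp (-x)) := by
  have := h.lintegral_tsum_childWeight β k x (g := fun _ => 1) measurable_const
  simp only [mul_one, one_mul] at this
  rw [this, h.level_eq_lintegral β k hx, ENNReal.ofReal_mul' (Real.exp_nonneg _), mul_comm]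
  rfl

lemma lintegral_spineBrood (β : ℝ) (k : ℕ) {x : ℝ} (hx : -β ≤ x) {g : Brood → ℝ≥0∞}
    (hg : Measurable g) :
    ∫⁻ b, g b ∂(spineBrood law e β k x) =
      ∫⁻ b, (∑' i, childWeight law e β k x (b i)) /
        ENNReal.ofReal (U law (shift k e) (x + β) * Real.exp (-x)) * g b ∂(law (e k)) := by
  have hU := h.measurable_U k
  have hm := h.measurable_tsum_childWeight β k
  have hmx : Measurable fun b : Brood => ∑' i, childWeight law e β k x (b i) :=
    hm.comp (g := fun p : ℝ × Brood => ∑' i, childWeight law e β k p.1 (p.2 i))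
      (f := fun b => (x, b)) (by fun_prop)
  unfold spineBrood
  rw [lintegral_densityKernel _ _ _ _ hg]
  · rfl
  · exact hm.div (((hU.comp (by fun_prop)).mul (by fun_prop)).ennreal_ofReal)
  · rw [Kernel.const_apply]
    simp_rw [div_eq_mul_inv]
    rw [lintegral_mul_const _ hmx, h.lintegral_tsum_childWeight_eq β k hx,
      ENNReal.mul_inv_cancel (h.mul_exp_ne_zero k hx) ENNReal.ofReal_ne_top]

lemma lintegral_spineChoice (β : ℝ) (k : ℕ) (x : ℝ) (b : Brood)
    (h0 : ∑' i, childWeight law e β k x (b i) ≠ 0)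
    (htop : ∑' i, childWeight law e β k x (b i) ≠ ⊤) (g : ℕ → ℝ≥0∞) :
    ∫⁻ i, g i ∂(spineChoice law e β k (x, b)) =
      ∑' i, childWeight law e β k x (b i) / (∑' j, childWeight law e β k x (b j)) * g i := by
  unfold spineChoice
  rw [lintegral_densityKernel _ _ _ _ (measurable_of_countable g)]
  · rw [Kernel.const_apply, lintegral_count]
  · have : Measurable fun p : (ℝ × Brood) × ℕ => childWeight law e β k p.1.1 (p.1.2 p.2) /
        ∑' j, childWeight law e β k p.1.1 (p.1.2 j) :=
      measurable_from_prod_countable_left fun i =>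
        (h.measurable_childWeight_apply β k i).div (h.measurable_tsum_childWeight β k)
    exact this
  · rw [Kernel.const_apply, lintegral_count]
    simp_rw [div_eq_mul_inv]
    rw [ENNReal.tsum_mul_right, ENNReal.mul_inv_cancel h0 htop]

/-- The total weight of the brood biases the brood and normalises the choice; it cancels, leaving a
sum over children with their individual weights. -/
lemma lintegral_spineKernel (β : ℝ) (k : ℕ) {s : SpineState} (hs : -β ≤ s.1)
    {G : SpineState → ℝ≥0∞} (hG : Measurable G) :
    ∫⁻ y, G y ∂(spineKernel law e β k s) =
      (∫⁻ b, ∑' i, childWeight law e β k s.1 (b i) * G (s.1 + (b i).untopD 0, b, i)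
        ∂(law (e k))) / ENNReal.ofReal (U law (shift k e) (s.1 + β) * Real.exp (-s.1)) := by
  obtain ⟨x, s'⟩ := s
  dsimp only at hs ⊢
  set c := ENNReal.ofReal (U law (shift k e) (x + β) * Real.exp (-x)) with hc
  have hGm : Measurable fun p : ℝ × Brood × ℕ => G (p.1 + (p.2.1 p.2.2).untopD 0, p.2) :=
    hG.comp measurable_spineMove
  have hGx : Measurable fun q : Brood × ℕ => G (x + (q.1 q.2).untopD 0, q) :=
    hGm.comp (g := fun p : ℝ × Brood × ℕ => G (p.1 + (p.2.1 p.2.2).untopD 0, p.2))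
      (f := fun q : Brood × ℕ => (x, q)) (by fun_prop)
  have e1 : ∫⁻ y, G y ∂(spineKernel law e β k (x, s')) =
      ∫⁻ b, ∫⁻ i, G (x + (b i).untopD 0, b, i) ∂(spineChoice law e β k (x, b))
        ∂(spineBrood law e β k x) := by
    unfold spineKernel
    rw [Kernel.comap_apply, Kernel.map_apply _ measurable_spineMove,
      lintegral_map hG measurable_spineMove, Kernel.prod_apply, Kernel.id_apply,
      lintegral_prod _ hGm.aemeasurable, lintegral_dirac' _ hGm.lintegral_prod_right',
      Kernel.lintegral_compProd _ _ _ hGx]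
  have hmx : Measurable fun b : Brood => ∑' i, childWeight law e β k x (b i) :=
    (h.measurable_tsum_childWeight β k).comp
      (g := fun p : ℝ × Brood => ∑' i, childWeight law e β k p.1 (p.2 i))
      (f := fun b => (x, b)) (by fun_prop)
  have hch : Measurable fun b : Brood =>
      ∫⁻ i, G (x + (b i).untopD 0, b, i) ∂(spineChoice law e β k (x, b)) := by
    have : Measurable fun b : Brood => (x, b) := by fun_prop
    exact hGx.lintegral_kernel_prod_right' (κ := (spineChoice law e β k).comap _ this)
  have hmt : Measurable fun b : Brood =>
      ∑' i, childWeight law e β k x (b i) * G (x + (b i).untopD 0, b, i) :=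
    Measurable.tsum fun i => ((h.measurable_childWeight_apply β k i).comp
      (g := fun p : ℝ × Brood => childWeight law e β k p.1 (p.2 i))
      (f := fun b => (x, b)) (by fun_prop)).mul
        (hGx.comp (g := fun q : Brood × ℕ => G (x + (q.1 q.2).untopD 0, q))
          (f := fun b => (b, i)) (by fun_prop))
  -- A brood of infinite total weight would trigger the fallback choice; a finite mean excludes it
  -- almost surely.
  have hfin : ∀ᵐ b ∂(law (e k)), ∑' i, childWeight law e β k x (b i) < ⊤ := by
    refine ae_lt_top hmx ?_
    rw [h.lintegral_tsum_childWeight_eq β k hs]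
    exact ENNReal.ofReal_ne_top
  rw [e1, h.lintegral_spineBrood β k hs hch, div_eq_mul_inv, ← lintegral_mul_const _ hmt]
  refine lintegral_congr_ae ?_
  filter_upwards [hfin] with b hb
  -- For a brood of weight zero the fallback choice is harmless, because the density of the brood
  -- vanishes.
  by_cases h0 : ∑' i, childWeight law e β k x (b i) = 0
  · have h0' : ∀ i, childWeight law e β k x (b i) = 0 := ENNReal.tsum_eq_zero.1 h0
    simp [h0']
  · rw [h.lintegral_spineChoice β k x b h0 hb.ne, div_eq_mul_inv, mul_right_comm,
      ← ENNReal.tsum_mul_left]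
    congr 1
    refine tsum_congr fun i => ?_
    rw [← mul_assoc, ENNReal.mul_div_cancel h0 hb.ne]

end GoodEnv

end

/-! ### Labels, ancestors and positions -/

lemma ancestor_length {u : List ℕ} {k : ℕ} (h : k ≤ u.length) : (ancestor u k).length = k := by
  simp [ancestor]; omega

lemma ancestor_of_le {u : List ℕ} {k : ℕ} (h : u.length ≤ k) : ancestor u k = u := by
  simp [ancestor, Nat.sub_eq_zero_of_le h]

lemma ancestor_cons {u : List ℕ} {k : ℕ} (h : k ≤ u.length) (i : ℕ) :
    ancestor (i :: u) k = ancestor u k := by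
  unfold ancestor
  rw [List.length_cons, show u.length + 1 - k = (u.length - k) + 1 by omega, List.drop_succ_cons]

lemma ancestor_ancestor {u : List ℕ} {j k : ℕ} (h : j ≤ k) (hk : k ≤ u.length) :
    ancestor (ancestor u k) j = ancestor u j := by
  unfold ancestor
  rw [List.drop_drop, List.length_drop]
  congr 1
  omega

/-- The position of `u` is determined by the broods of its strict ancestors; the brood of `u` itself
does not enter. -/
lemma position_congr (a : ℝ) {T T' : Tree} {u : List ℕ}
    (h : ∀ k < u.length, T (ancestor u k) = T' (ancestor u k)) :
    position a T u = position a T' u := by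
  induction u with
  | nil => rfl
  | cons i u ih =>
    have h1 := h u.length (by simp)
    rw [ancestor_cons le_rfl, ancestor_of_le le_rfl] at h1
    rw [position, position, h1, ih fun k hk => ?_]
    have := h k (by simp; omega)
    rwa [ancestor_cons hk.le] at this

lemma position_ancestor_congr (a : ℝ) {T T' : Tree} {u : List ℕ}
    (h : ∀ k < u.length, T (ancestor u k) = T' (ancestor u k)) (k : ℕ) :
    position a T (ancestor u k) = position a T' (ancestor u k) := by
  rcases le_total u.length k with hk | hk
  · rw [ancestor_of_le hk]; exact position_congr a h
  · refine position_congr a fun j hj => ?_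
    rw [ancestor_length hk] at hj
    rw [ancestor_ancestor hj.le hk]
    exact h j (by omega)

lemma length_spine (c : ℕ → ℕ) (n : ℕ) : (spine c n).length = n := by
  induction n with
  | zero => rfl
  | succ n ih => simp [spine, ih]

lemma spine_congr {c c' : ℕ → ℕ} {n : ℕ} (h : ∀ k < n, c k = c' k) : spine c n = spine c' n := by
  induction n with
  | zero => rfl
  | succ n ih => rw [spine, spine, h n (by omega), ih fun k hk => h k (by omega)]

lemma ancestor_spine (c : ℕ → ℕ) {n k : ℕ} (h : k ≤ n) : ancestor (spine c n) k = spine c k := by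
  induction n with
  | zero => obtain rfl : k = 0 := by omega
            rfl
  | succ n ih =>
    rcases Nat.le_succ_iff.1 h with hk | rfl
    · rw [spine, ancestor_cons (by rw [length_spine]; exact hk), ih hk]
    · rw [ancestor_of_le (by rw [length_spine])]

section

variable {E : Type*} [MeasurableSpace E] {law : Kernel E Brood} [IsMarkovKernel law]

lemma Dv_congr (e : ℕ → E) (β a : ℝ) {T T' : Tree} {v : List ℕ}
    (h : ∀ k < v.length, T (ancestor v k) = T' (ancestor v k)) :
    Dv law e β a T v = Dv law e β a T' v := by
  unfold Dv
  rw [position_congr a h]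
  simp_rw [position_ancestor_congr a h]

/-- No ancestor of `v` lies below `-β`. -/
def Above (β a : ℝ) (T : Tree) (v : List ℕ) : Prop :=
  ∀ k ≤ v.length, ((-β : ℝ) : WithTop ℝ) ≤ position a T (ancestor v k)

lemma Dv_of_top {e : ℕ → E} {β a : ℝ} {T : Tree} {v : List ℕ} (hv : position a T v = ⊤) :
    Dv law e β a T v = 0 := by
  unfold Dv
  rw [hv, atPos_top]

lemma Dv_of_not_above {e : ℕ → E} {β a : ℝ} {T : Tree} {v : List ℕ} (hv : ¬ Above β a T v) :
    Dv law e β a T v = 0 := by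
  unfold Dv
  cases position a T v with
  | top => rw [atPos_top]
  | coe x => exact if_neg hv

lemma Dv_of_above {e : ℕ → E} {β a : ℝ} {T : Tree} {v : List ℕ} (hv : Above β a T v) {x : ℝ}
    (hx : position a T v = x) :
    Dv law e β a T v =
      ENNReal.ofReal (U law (shift v.length e) (x + β) * Real.exp (-x)) := by
  unfold Dv
  rw [hx]
  exact if_pos hv

lemma above_cons {β a : ℝ} {T : Tree} {i : ℕ} {v : List ℕ} :
    Above β a T (i :: v) ↔
      Above β a T v ∧ ((-β : ℝ) : WithTop ℝ) ≤ position a T (i :: v) := by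
  unfold Above
  constructor
  · intro h
    refine ⟨fun k hk => ?_, ?_⟩
    · have := h k (by simp; omega)
      rwa [ancestor_cons hk] at this
    · have := h (v.length + 1) (by simp)
      rwa [ancestor_of_le (by simp)] at this
  · rintro ⟨h1, h2⟩ k hk
    rw [List.length_cons] at hk
    rcases Nat.le_succ_iff.1 hk with hk | rfl
    · rw [ancestor_cons hk]; exact h1 k hk
    · rw [ancestor_of_le (by simp)]; exact h2

/-- Once all ancestors are above `-β`, the only new constraint is that on the child. -/
lemma Dv_cons {e : ℕ → E} {β a : ℝ} {T : Tree} {i : ℕ} {v : List ℕ} (hv : Above β a T v) {x : ℝ}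
    (hx : position a T v = x) :
    Dv law e β a T (i :: v) = childWeight law e β v.length x (T v i) := by
  have hp : position a T (i :: v) = x + T v i := by rw [position, hx]
  unfold Dv childWeight
  rw [hp]
  cases hz : (x : WithTop ℝ) + T v i with
  | top => rw [atPos_top, atPos_top]
  | coe y =>
    rw [atPos_coe, atPos_coe]
    have : (∀ k ≤ (i :: v).length, ((-β : ℝ) : WithTop ℝ) ≤ position a T (ancestor (i :: v) k)) ↔
        -β ≤ y := by
      have h1 := above_cons (β := β) (a := a) (T := T) (i := i) (v := v)
      rw [hp, hz, WithTop.coe_le_coe] at h1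
      exact h1.trans (and_iff_right hv)
    simp only [this]
    rfl

lemma position_ne_top_of_cons {a : ℝ} {T : Tree} {i : ℕ} {v : List ℕ}
    (hv : position a T v = ⊤) : position a T (i :: v) = ⊤ := by
  rw [position, hv, top_add]

/-- The value of `Dv` as a function of the positions of the ancestors. -/
lemma exists_measurable_Dv {e : ℕ → E} (h : GoodEnv law e) (β a : ℝ) (v : List ℕ) :
    ∃ Φ : (ℕ → WithTop ℝ) → ℝ≥0∞, Measurable Φ ∧
      ∀ T, Dv law e β a T v = Φ fun k => position a T (ancestor v k) := by
  classical
  let A : Set (ℕ → WithTop ℝ) := {q | ∀ k ≤ v.length, ((-β : ℝ) : WithTop ℝ) ≤ q k}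
  have hA : MeasurableSet A := by
    have : A = ⋂ k, ⋂ (_ : k ≤ v.length), {q | ((-β : ℝ) : WithTop ℝ) ≤ q k} := by
      ext; simp [A]
    rw [this]
    exact MeasurableSet.iInter fun k => MeasurableSet.iInter fun _ =>
      measurableSet_le measurable_const (measurable_pi_apply k)
  let ψ : WithTop ℝ → ℝ≥0∞ := atPos fun x =>
    ENNReal.ofReal (U law (shift v.length e) (x + β) * Real.exp (-x))
  have hψ : Measurable ψ := measurable_atPos
    (((h.measurable_U v.length).comp (by fun_prop)).mul (by fun_prop)).ennreal_ofReal
  refine ⟨A.indicator fun q => ψ (q v.length),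
    (hψ.comp (measurable_pi_apply _)).indicator hA, fun T => ?_⟩
  by_cases hT : Above β a T v
  · rw [Set.indicator_of_mem (show _ ∈ A from hT)]
    change _ = ψ (position a T (ancestor v v.length))
    rw [ancestor_of_le le_rfl]
    cases hx : position a T v with
    | top => rw [Dv_of_top hx]; rfl
    | coe x => rw [Dv_of_above hT hx]; rfl
  · rw [Set.indicator_of_notMem (show _ ∉ A from hT), Dv_of_not_above hT]

lemma measurable_Dv {e : ℕ → E} (h : GoodEnv law e) (β a : ℝ) (v : List ℕ) :
    Measurable fun T => Dv law e β a T v := by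
  obtain ⟨Φ, hΦ, hD⟩ := exists_measurable_Dv h β a v
  simp_rw [hD]
  exact hΦ.comp (measurable_pi_lambda _ fun k => measurable_position a _)

lemma measurable_Dv_treeField {e : ℕ → E} (h : GoodEnv law e) (β a : ℝ) {v : List ℕ} {n : ℕ}
    (hv : v.length ≤ n) : Measurable[treeField a n] fun T => Dv law e β a T v := by
  obtain ⟨Φ, hΦ, hD⟩ := exists_measurable_Dv h β a v
  simp_rw [hD]
  refine hΦ.comp (@measurable_pi_lambda _ _ _ (treeField a n) _ _ fun k => ?_)
  have hk : (ancestor v k).length ≤ n := by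
    unfold ancestor; rw [List.length_drop]; omega
  exact Measurable.mono (comap_measurable _)
    (le_iSup₂_of_le (ancestor v k) hk le_rfl) le_rfl

lemma measurable_D_treeField {e : ℕ → E} (h : GoodEnv law e) (β a : ℝ) (n : ℕ) :
    Measurable[treeField a n] fun T => D law e β a n T := by
  -- Stated for an arbitrary σ-field so that `treeField` is used in place of the product σ-field.
  have key : ∀ (m : MeasurableSpace Tree) (f : {v : List ℕ // v.length = n} → Tree → ℝ≥0∞),
      (∀ v, Measurable[m] (f v)) → Measurable[m] fun T => ∑' v, f v T :=
    fun m f hf => Measurable.tsum hf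
  exact key _ _ fun v => measurable_Dv_treeField h β a v.2.le

/-! ### The spine, generation by generation -/

/-- The labels of the spine read off from the sequence of its states. -/
def labels (s : ℕ → SpineState) (k : ℕ) : ℕ := (s (k + 1)).2.2

@[fun_prop]
lemma measurable_labels : Measurable labels := by
  refine measurable_pi_lambda _ fun k => ?_
  unfold labels
  fun_prop

lemma measurableSet_spine_eq (n : ℕ) (v : List ℕ) :
    MeasurableSet {c : ℕ → ℕ | spine c n = v} := by
  induction n generalizing v with
  | zero => exact MeasurableSet.const ([] = v)
  | succ n ih =>
    cases v with
    | nil => simp [spine]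
    | cons i v =>
      have : {c : ℕ → ℕ | spine c (n + 1) = i :: v} = {c | c n = i} ∩ {c | spine c n = v} := by
        ext c; simp [spine]
      rw [this]
      exact (measurable_pi_apply n (measurableSet_singleton i)).inter (ih v)

instance (e : ℕ → E) (β a : ℝ) : IsProbabilityMeasure (spineLaw law e β a) := by
  unfold spineLaw; infer_instance

instance (e : ℕ → E) : IsProbabilityMeasure (treeLaw law e) := by
  unfold treeLaw; infer_instance

lemma lintegral_treeLaw_update (e : ℕ → E) (u : List ℕ) {G : Tree → ℝ≥0∞} (hG : Measurable G) :
    ∫⁻ T, G T ∂(treeLaw law e) =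
      ∫⁻ T, ∫⁻ b, G (Function.update T u b) ∂(law (e u.length)) ∂(treeLaw law e) :=
  lintegral_infinitePi_update (fun u : List ℕ => law (e u.length)) u hG

/-- The joint law of the labels, the broods and the final position of the spine. -/
theorem lintegral_spineLaw {e : ℕ → E} (h : GoodEnv law e) {β a : ℝ} (ha : -β ≤ a) (v : List ℕ)
    {C : ℕ → Set Brood} (hC : ∀ k, MeasurableSet (C k)) {g : ℝ → ℝ≥0∞} (hg : Measurable g) :
    ∫⁻ s, {s : ℕ → SpineState | spine (labels s) v.length = v ∧
        ∀ k < v.length, (s (k + 1)).2.1 ∈ C k}.indicator (fun s => g (s v.length).1) s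
        ∂(spineLaw law e β a) =
      (∫⁻ T, {T : Tree | ∀ k < v.length, T (ancestor v k) ∈ C k}.indicator
        (fun T => Dv law e β a T v * g ((position a T v).untopD 0)) T ∂(treeLaw law e)) /
        ENNReal.ofReal (U law e (a + β) * Real.exp (-a)) := by
  classical
  induction v generalizing g with
  | nil =>
    have e1 : ∀ᵐ s ∂(spineLaw law e β a), {s : ℕ → SpineState |
        spine (labels s) ([] : List ℕ).length = [] ∧
        ∀ k < ([] : List ℕ).length, (s (k + 1)).2.1 ∈ C k}.indicator
          (fun s => g (s ([] : List ℕ).length).1) s = g a := by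
      filter_upwards [chainLaw_zero (spineKernel law e β) (a, fun _ => ⊤, 0)] with s hs
      rw [Set.indicator_of_mem (by simp [spine])]
      simp [hs]
    have e2 : ∀ T : Tree, {T : Tree | ∀ k < ([] : List ℕ).length,
        T (ancestor [] k) ∈ C k}.indicator
          (fun T => Dv law e β a T [] * g ((position a T []).untopD 0)) T =
          ENNReal.ofReal (U law e (a + β) * Real.exp (-a)) * g a := by
      intro T
      have hA : Above β a T [] := by
        intro k hk
        simpa [ancestor, position] using WithTop.coe_le_coe.2 ha
      rw [Set.indicator_of_mem (by simp), Dv_of_above hA (x := a) rfl]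
      rfl
    rw [lintegral_congr_ae e1, lintegral_congr e2]
    simp only [lintegral_const, measure_univ, mul_one]
    have h0 : ENNReal.ofReal (U law e (a + β) * Real.exp (-a)) ≠ 0 := h.mul_exp_ne_zero 0 ha
    rw [mul_comm, ENNReal.mul_div_cancel_right h0 ENNReal.ofReal_ne_top]
  | cons i v ih =>
    set n := v.length with hn
    have hlen : (i :: v).length = n + 1 := rfl
    let A : Set (ℕ → SpineState) :=
      {s | spine (labels s) n = v ∧ ∀ k < n, (s (k + 1)).2.1 ∈ C k}
    have hA : MeasurableSet A := by
      have : A = labels ⁻¹' {c | spine c n = v} ∩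
          ⋂ k, ⋂ (_ : k < n), (fun s : ℕ → SpineState => (s (k + 1)).2.1) ⁻¹' (C k) := by
        ext; simp [A]
      rw [this]
      exact (measurable_labels (measurableSet_spine_eq n v)).inter
        (MeasurableSet.iInter fun k => MeasurableSet.iInter fun _ =>
          (by fun_prop : Measurable fun s : ℕ → SpineState => (s (k + 1)).2.1) (hC k))
    let G : SpineState → ℝ≥0∞ := {y : SpineState | y.2.2 = i ∧ y.2.1 ∈ C n}.indicator fun y => g y.1
    have hG : Measurable G := by
      refine (hg.comp measurable_fst).indicator (MeasurableSet.inter ?_ ?_)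
      · exact (by fun_prop : Measurable fun y : SpineState => y.2.2) (measurableSet_singleton i)
      · exact (by fun_prop : Measurable fun y : SpineState => y.2.1) (hC n)
    have hF : Measurable fun p : (ℕ → SpineState) × SpineState => A.indicator 1 p.1 * G p.2 :=
      ((measurable_one.indicator hA).comp measurable_fst).mul (hG.comp measurable_snd)
    have hAf : ∀ s : ℕ → SpineState, freeze n s ∈ A ↔ s ∈ A := by
      intro s
      have h1 : spine (labels (freeze n s)) n = spine (labels s) n :=
        spine_congr fun k hk => by unfold labels; rw [freeze_of_le (by omega)]
      have h2 : ∀ k < n, freeze n s (k + 1) = s (k + 1) := fun k hk => freeze_of_le (by omega) s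
      simp only [A, Set.mem_ofPred_eq, h1]
      refine and_congr_right fun _ => forall₂_congr fun k hk => ?_
      rw [h2 k hk]
    -- The kernel ignores the brood and the label of its starting state, so dummies may be inserted.
    -- This makes the integral a function of the position, to which the induction hypothesis
    -- applies.
    let H : ℝ → ℝ≥0∞ := fun x => ∫⁻ y, G y ∂(spineKernel law e β n (x, fun _ => ⊤, 0))
    have hH : Measurable H := by
      have h1 : Measurable fun s => ∫⁻ y, G y ∂(spineKernel law e β n s) := hG.lintegral_kernel
      have h2 : Measurable fun x : ℝ => ((x, fun _ => ⊤, 0) : SpineState) := by fun_prop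
      exact h1.comp h2
    have hL : ∫⁻ s, {s : ℕ → SpineState | spine (labels s) (i :: v).length = i :: v ∧
        ∀ k < (i :: v).length, (s (k + 1)).2.1 ∈ C k}.indicator
          (fun s => g (s (i :: v).length).1) s ∂(spineLaw law e β a) =
        ∫⁻ s, A.indicator (fun s => H (s n).1) s ∂(spineLaw law e β a) := by
      have e1 : ∀ s : ℕ → SpineState, {s : ℕ → SpineState |
          spine (labels s) (i :: v).length = i :: v ∧
          ∀ k < (i :: v).length, (s (k + 1)).2.1 ∈ C k}.indicator
          (fun s => g (s (i :: v).length).1) s = A.indicator 1 (freeze n s) * G (s (n + 1)) := by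
        intro s
        have hmem : s ∈ {s : ℕ → SpineState | spine (labels s) (i :: v).length = i :: v ∧
            ∀ k < (i :: v).length, (s (k + 1)).2.1 ∈ C k} ↔
            s ∈ A ∧ s (n + 1) ∈ {y : SpineState | y.2.2 = i ∧ y.2.1 ∈ C n} := by
          simp only [A, Set.mem_ofPred_eq, hlen, spine, List.cons.injEq]
          have : labels s n = (s (n + 1)).2.2 := rfl
          rw [this]
          constructor
          · rintro ⟨⟨h1, h2⟩, h3⟩
            exact ⟨⟨h2, fun k hk => h3 k (by omega)⟩, h1, h3 n (by omega)⟩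
          · rintro ⟨⟨h2, h3⟩, h1, h4⟩
            refine ⟨⟨h1, h2⟩, fun k hk => ?_⟩
            rcases Nat.lt_succ_iff_lt_or_eq.1 hk with hk | rfl
            · exact h3 k hk
            · exact h4
        by_cases h1 : s ∈ A
        · rw [Set.indicator_of_mem ((hAf s).2 h1), Pi.one_apply, one_mul]
          by_cases h2 : s (n + 1) ∈ {y : SpineState | y.2.2 = i ∧ y.2.1 ∈ C n}
          · rw [Set.indicator_of_mem (hmem.2 ⟨h1, h2⟩)]
            exact (Set.indicator_of_mem h2 fun y : SpineState => g y.1).symm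
          · rw [Set.indicator_of_notMem fun hc => h2 (hmem.1 hc).2]
            exact (Set.indicator_of_notMem h2 fun y : SpineState => g y.1).symm
        · rw [Set.indicator_of_notMem fun hc => h1 ((hAf s).1 hc),
            Set.indicator_of_notMem fun hc => h1 (hmem.1 hc).1, zero_mul]
      rw [lintegral_congr e1]
      unfold spineLaw
      rw [lintegral_chainLaw_succ _ _ n hF]
      refine lintegral_congr fun s => ?_
      dsimp only
      rw [lintegral_const_mul _ hG]
      by_cases h1 : s ∈ A
      · rw [Set.indicator_of_mem ((hAf s).2 h1), Set.indicator_of_mem h1, Pi.one_apply, one_mul]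
        rfl
      · rw [Set.indicator_of_notMem fun hc => h1 ((hAf s).1 hc), Set.indicator_of_notMem h1,
          zero_mul]
    have hR : Measurable fun T : Tree => {T : Tree | ∀ k < (i :: v).length,
        T (ancestor (i :: v) k) ∈ C k}.indicator (fun T => Dv law e β a T (i :: v) *
          g ((position a T (i :: v)).untopD 0)) T := by
      refine ((measurable_Dv h β a _).mul
        (hg.comp ((measurable_position a _).untopD 0))).indicator ?_
      have : {T : Tree | ∀ k < (i :: v).length, T (ancestor (i :: v) k) ∈ C k} =
          ⋂ k, ⋂ (_ : k < (i :: v).length), (fun T : Tree => T (ancestor (i :: v) k)) ⁻¹' (C k) := by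
        ext; simp
      rw [this]
      exact MeasurableSet.iInter fun k => MeasurableSet.iInter fun _ =>
          measurable_pi_apply (ancestor (i :: v) k) (hC k)
    -- Resampling the brood of `v` matches one step of the spine: neither the position nor the
    -- weight of `v` depends on that brood.
    rw [hL, ih hH, lintegral_treeLaw_update e v hR]
    congr 1
    refine lintegral_congr fun T => ?_
    have hup : ∀ b, ∀ k < v.length, Function.update T v b (ancestor v k) = T (ancestor v k) := by
      intro b k hk
      refine Function.update_of_ne (fun hc => ?_) _ _
      have := ancestor_length (u := v) hk.le
      rw [hc] at this
      omega
    have hmem : ∀ b, Function.update T v b ∈ {T : Tree | ∀ k < (i :: v).length,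
        T (ancestor (i :: v) k) ∈ C k} ↔ (∀ k < v.length, T (ancestor v k) ∈ C k) ∧ b ∈ C n := by
      intro b
      simp only [Set.mem_ofPred_eq, hlen]
      constructor
      · intro hk
        refine ⟨fun k hkn => ?_, ?_⟩
        · have := hk k (by omega)
          rwa [ancestor_cons hkn.le, hup b k hkn] at this
        · have := hk n (by omega)
          rwa [ancestor_cons le_rfl, ancestor_of_le le_rfl, Function.update_self] at this
      · rintro ⟨h1, h2⟩ k hk
        rcases Nat.lt_succ_iff_lt_or_eq.1 hk with hk | rfl
        · rw [ancestor_cons hk.le, hup b k hk]; exact h1 k hk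
        · rw [ancestor_cons le_rfl, ancestor_of_le le_rfl, Function.update_self]; exact h2
    have hab : ∀ b, Above β a (Function.update T v b) v ↔ Above β a T v := by
      intro b
      unfold Above
      simp_rw [position_ancestor_congr a (hup b)]
    have hpos : ∀ b, position a (Function.update T v b) v = position a T v := fun b =>
      position_congr a (hup b)
    by_cases hT : ∀ k < v.length, T (ancestor v k) ∈ C k
    swap
    · rw [Set.indicator_of_notMem (show T ∉ {T : Tree | ∀ k < v.length, T (ancestor v k) ∈ C k} from hT)]
      symm
      refine (lintegral_congr fun b => ?_).trans lintegral_zero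
      rw [Set.indicator_of_notMem fun hc => hT ((hmem b).1 hc).1]
    rw [Set.indicator_of_mem (show T ∈ {T : Tree | ∀ k < v.length, T (ancestor v k) ∈ C k} from hT)]
    by_cases hT2 : Above β a T v ∧ position a T v ≠ ⊤
    swap
    · have hz : Dv law e β a T v = 0 := by
        by_cases h1 : Above β a T v
        · exact Dv_of_top (by_contra fun h2 => hT2 ⟨h1, h2⟩)
        · exact Dv_of_not_above h1
      rw [hz, zero_mul]
      symm
      refine (lintegral_congr fun b => ?_).trans lintegral_zero
      have hz' : Dv law e β a (Function.update T v b) (i :: v) = 0 := by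
        by_cases h1 : Above β a T v
        · exact Dv_of_top (position_ne_top_of_cons
            ((hpos b).trans (by_contra fun h2 => hT2 ⟨h1, h2⟩)))
        · exact Dv_of_not_above fun hc => h1 ((hab b).1 (above_cons.1 hc).1)
      exact Set.indicator_apply_eq_zero.2 fun _ => by rw [hz', zero_mul]
    obtain ⟨hT1, hT2⟩ := hT2
    obtain ⟨x, hx⟩ := WithTop.ne_top_iff_exists.1 hT2
    have hxβ : -β ≤ x := by
      have := hT1 v.length le_rfl
      rw [ancestor_of_le le_rfl, ← hx] at this
      exact WithTop.coe_le_coe.1 this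
    rw [Dv_of_above hT1 hx.symm, ← hx, WithTop.untopD_coe]
    change _ * (∫⁻ y, G y ∂(spineKernel law e β n (x, fun _ => ⊤, 0))) = _
    rw [h.lintegral_spineKernel β n hxβ hG,
      ENNReal.mul_div_cancel (h.mul_exp_ne_zero n hxβ) ENNReal.ofReal_ne_top]
    refine lintegral_congr fun b => ?_
    have hp' : position a (Function.update T v b) v = x := (hpos b).trans hx.symm
    -- Prescribing the next label leaves a single child in the sum, whose weight is `Dv` one
    -- generation later.
    rw [tsum_eq_single i fun j hj => ?_]
    swap
    · rw [show G (x + (b j).untopD 0, b, j) = 0 from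
        Set.indicator_of_notMem (fun hc => hj hc.1) _, mul_zero]
    by_cases hb : b ∈ C n
    · rw [Set.indicator_of_mem ((hmem b).2 ⟨hT, hb⟩),
        show G (x + (b i).untopD 0, b, i) = g (x + (b i).untopD 0) from
          Set.indicator_of_mem (s := {y : SpineState | y.2.2 = i ∧ y.2.1 ∈ C n}) ⟨rfl, hb⟩ _,
        Dv_cons ((hab b).2 hT1) hp', Function.update_self, position, hp', Function.update_self]
      cases b i with
      | top => simp [childWeight_eq, atPos_top]
      | coe z => rw [← WithTop.coe_add, WithTop.untopD_coe, WithTop.untopD_coe]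
    · rw [Set.indicator_of_notMem fun hc => hb ((hmem b).1 hc).2,
        show G (x + (b i).untopD 0, b, i) = 0 from
          Set.indicator_of_notMem (fun hc => hb hc.2) _, mul_zero]

end

/-- Finite measures on a product which agree on boxes are equal. -/
lemma measure_eq_of_boxes {ι : Type*} {X : ι → Type*} [∀ i, MeasurableSpace (X i)]
    (μ ν : Measure (∀ i, X i)) [IsFiniteMeasure μ]
    (h : ∀ (S : Finset ι) (t : ∀ i, Set (X i)), (∀ i, MeasurableSet (t i)) →
      μ (Set.pi S t) = ν (Set.pi S t)) : μ = ν := by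
  refine ext_of_generate_finite _ generateFrom_squareCylinders.symm
    (isPiSystem_squareCylinders (fun i => MeasurableSpace.isPiSystem_measurableSet) fun _ => .univ)
    ?_ ?_
  · rintro _ ⟨S, t, ht, rfl⟩
    exact h S t fun i => ht i (Set.mem_univ i)
  · simpa using h ∅ (fun _ => Set.univ) fun _ => .univ

section

variable {E : Type*} [MeasurableSpace E] {law : Kernel E Brood} [IsMarkovKernel law]

/-! ### The law of the tree and of the `n`-th spine particle -/

/-- Independence expressed by resampling: a functional insensitive to the broods in `S` factors from
a box over `S`. -/
lemma lintegral_mul_box (e : ℕ → E) {G : Tree → ℝ≥0∞} (hG : Measurable G) (S : Finset (List ℕ))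
    {B : List ℕ → Set Brood} (hB : ∀ u, MeasurableSet (B u))
    (hinv : ∀ u ∈ S, ∀ T b, G (Function.update T u b) = G T) :
    ∫⁻ T, G T * (Set.pi S B).indicator 1 T ∂(treeLaw law e) =
      (∫⁻ T, G T ∂(treeLaw law e)) * ∏ u ∈ S, law (e u.length) (B u) := by
  classical
  have hbox : ∀ S : Finset (List ℕ), MeasurableSet (Set.pi (S : Set (List ℕ)) B) := fun S =>
    MeasurableSet.pi S.countable_toSet fun u _ => hB u
  induction S using Finset.induction_on with
  | empty => simp
  | insert u S hu ih =>
    have hm : Measurable fun T : Tree =>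
        G T * (Set.pi (insert u S : Finset (List ℕ)) B).indicator (1 : Tree → ℝ≥0∞) T :=
      hG.mul (measurable_one.indicator (hbox _))
    have hm2 : Measurable fun T : Tree =>
        G T * (Set.pi (S : Set (List ℕ)) B).indicator (1 : Tree → ℝ≥0∞) T :=
      hG.mul (measurable_one.indicator (hbox S))
    rw [lintegral_treeLaw_update e u hm, Finset.prod_insert hu, mul_left_comm,
      ← ih fun w hw => hinv w (Finset.mem_insert_of_mem hw),
      ← lintegral_const_mul _ hm2]
    refine lintegral_congr fun T => ?_
    have key : ∀ b, G (Function.update T u b) * (Set.pi (insert u S : Finset (List ℕ)) B).indicator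
        (1 : Tree → ℝ≥0∞) (Function.update T u b) =
        (G T * (Set.pi S B).indicator 1 T) * (B u).indicator 1 b := by
      intro b
      rw [hinv u (Finset.mem_insert_self u S), mul_assoc]
      congr 1
      have hiff : Function.update T u b ∈ Set.pi (insert u S : Finset (List ℕ)) B ↔
          T ∈ Set.pi (S : Set (List ℕ)) B ∧ b ∈ B u := by
        simp only [Set.mem_pi, Finset.mem_coe, Finset.mem_insert]
        constructor
        · refine fun hc => ⟨fun w hw => ?_, by simpa using hc u (Or.inl rfl)⟩
          have := hc w (Or.inr hw)
          rwa [Function.update_of_ne (ne_of_mem_of_not_mem hw hu)] at this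
        · rintro ⟨h1, h2⟩ w (rfl | hw)
          · simpa using h2
          · rw [Function.update_of_ne (ne_of_mem_of_not_mem hw hu)]
            exact h1 w hw
      by_cases h1 : T ∈ Set.pi (S : Set (List ℕ)) B
      · by_cases h2 : b ∈ B u
        · rw [Set.indicator_of_mem (hiff.2 ⟨h1, h2⟩), Set.indicator_of_mem h1,
            Set.indicator_of_mem h2]
          simp
        · rw [Set.indicator_of_notMem fun hc => h2 (hiff.1 hc).2, Set.indicator_of_notMem h2,
            mul_zero]
      · rw [Set.indicator_of_notMem fun hc => h1 (hiff.1 hc).1, Set.indicator_of_notMem h1,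
          zero_mul]
    simp_rw [key]
    rw [lintegral_const_mul _ (measurable_one.indicator (hB u)),
      lintegral_indicator_one (hB u), mul_comm]

lemma measurableSet_spine_snd (n : ℕ) (v : List ℕ) :
    MeasurableSet {p : Tree × (ℕ → ℕ) | spine p.2 n = v} :=
  measurable_snd (measurableSet_spine_eq n v)

/-- On `w_n = v` the box splits: constraints on ancestors of `v` are read from the spine states, the
others from the independent tree. The same splitting under `treeLaw` gives the same product. -/
lemma spinalLaw_box {e : ℕ → E} (h : GoodEnv law e) {β a : ℝ} (ha : -β ≤ a) (v : List ℕ)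
    (S : Finset (List ℕ)) (hS : ∀ u ∈ S, u.length < v.length) {B : List ℕ → Set Brood}
    (hB : ∀ u, MeasurableSet (B u)) :
    spinalLaw law e β a ({p | spine p.2 v.length = v} ∩ Prod.fst ⁻¹' Set.pi S B) =
      (∫⁻ T in Set.pi S B, Dv law e β a T v ∂(treeLaw law e)) /
        ENNReal.ofReal (U law e (a + β) * Real.exp (-a)) := by
  classical
  set n := v.length with hn
  -- Constraints along the line of `v`, trivial where the box imposes none; `S2` collects those off
  -- the line.
  let C : ℕ → Set Brood := fun k => if ancestor v k ∈ S then B (ancestor v k) else Set.univ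
  have hC : ∀ k, MeasurableSet (C k) := by
    intro k
    simp only [C]
    split_ifs
    exacts [hB _, .univ]
  let S2 := S.filter fun u => u ≠ ancestor v u.length
  have hbox : ∀ S : Finset (List ℕ), MeasurableSet (Set.pi (S : Set (List ℕ)) B) := fun S =>
    MeasurableSet.pi S.countable_toSet fun u _ => hB u
  let E1 : Set (ℕ → SpineState) := {s | spine (labels s) n = v ∧ ∀ k < n, (s (k + 1)).2.1 ∈ C k}
  have hE1 : MeasurableSet E1 := by
    have : E1 = labels ⁻¹' {c | spine c n = v} ∩
        ⋂ k, ⋂ (_ : k < n), (fun s : ℕ → SpineState => (s (k + 1)).2.1) ⁻¹' (C k) := by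
      ext; simp [E1]
    rw [this]
    exact (measurable_labels (measurableSet_spine_eq n v)).inter
      (MeasurableSet.iInter fun k => MeasurableSet.iInter fun _ =>
        (by fun_prop : Measurable fun s : ℕ → SpineState => (s (k + 1)).2.1) (hC k))
  let A : Set Tree := {T | ∀ k < n, T (ancestor v k) ∈ C k}
  have hA : MeasurableSet A := by
    have : A = ⋂ k, ⋂ (_ : k < n), (fun T : Tree => T (ancestor v k)) ⁻¹' (C k) := by
      ext; simp [A]
    rw [this]
    exact MeasurableSet.iInter fun k => MeasurableSet.iInter fun _ =>
      measurable_pi_apply (ancestor v k) (hC k)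
  let G : Tree → ℝ≥0∞ := A.indicator fun T => Dv law e β a T v
  have hG : Measurable G := (measurable_Dv h β a v).indicator hA
  have hpre : graft ⁻¹' ({p | spine p.2 n = v} ∩ Prod.fst ⁻¹' Set.pi S B) =
      E1 ×ˢ Set.pi (S2 : Set (List ℕ)) B := by
    ext ⟨s, T⟩
    have h2 : (graft (s, T)).2 = labels s := rfl
    simp only [Set.mem_preimage, Set.mem_inter_iff, Set.mem_ofPred_eq, Set.mem_prod, h2, E1]
    rw [and_assoc]
    refine and_congr_right fun hv => ?_
    have hsp : ∀ k ≤ n, spine (labels s) k = ancestor v k := fun k hk => by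
      rw [← ancestor_spine (labels s) hk, hv]
    have hgr : ∀ u, u.length < n → (graft (s, T)).1 u =
        if u = ancestor v u.length then (s (u.length + 1)).2.1 else T u := by
      intro u hu
      change (if u = spine (labels s) u.length then _ else _) = _
      rw [hsp _ hu.le]
    simp only [Set.mem_pi, Finset.mem_coe]
    constructor
    · refine fun hc => ⟨fun k hk => ?_, fun u hu => ?_⟩
      · simp only [C]
        split_ifs with hk2
        · have := hc _ hk2
          rwa [hgr _ (hS _ hk2), ancestor_length hk.le, if_pos rfl] at this
        · trivial
      · have hu' := Finset.mem_filter.1 hu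
        have := hc u hu'.1
        rwa [hgr _ (hS _ hu'.1), if_neg hu'.2] at this
    · rintro ⟨h3, h4⟩ u hu
      rw [hgr _ (hS _ hu)]
      split_ifs with hu2
      · have := h3 u.length (hS _ hu)
        simp only [C] at this
        rwa [← hu2, if_pos hu] at this
      · exact h4 u (Finset.mem_filter.2 ⟨hu, hu2⟩)
  have hspine : spineLaw law e β a E1 = (∫⁻ T, G T ∂(treeLaw law e)) /
      ENNReal.ofReal (U law e (a + β) * Real.exp (-a)) := by
    have := lintegral_spineLaw h ha v hC (g := fun _ => 1) measurable_const
    simp only [mul_one] at this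
    rw [← lintegral_indicator_one hE1]
    exact this
  have hinv : ∀ u ∈ S2, ∀ T b, G (Function.update T u b) = G T := by
    intro u hu T b
    have hu' := Finset.mem_filter.1 hu
    have hup : ∀ k < n, Function.update T u b (ancestor v k) = T (ancestor v k) := by
      intro k hk
      refine Function.update_of_ne (fun hc => hu'.2 ?_) _ _
      rw [← hc, ancestor_length hk.le]
    have hmem : Function.update T u b ∈ A ↔ T ∈ A :=
      forall₂_congr fun k hk => by rw [hup k hk]
    by_cases hT : T ∈ A
    · simp only [G, Set.indicator_of_mem hT, Set.indicator_of_mem (hmem.2 hT)]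
      exact Dv_congr e β a hup
    · simp only [G, Set.indicator_of_notMem hT, Set.indicator_of_notMem fun hc => hT (hmem.1 hc)]
  have hsplit : ∀ T, (Set.pi (S : Set (List ℕ)) B).indicator (fun T => Dv law e β a T v) T =
      G T * (Set.pi (S2 : Set (List ℕ)) B).indicator 1 T := by
    intro T
    have hiff : T ∈ Set.pi (S : Set (List ℕ)) B ↔ T ∈ A ∧ T ∈ Set.pi (S2 : Set (List ℕ)) B := by
      simp only [Set.mem_pi, Finset.mem_coe, A, Set.mem_ofPred_eq]
      constructor
      · refine fun hc => ⟨fun k hk => ?_, fun u hu => hc u (Finset.mem_filter.1 hu).1⟩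
        simp only [C]
        split_ifs with hk2
        exacts [hc _ hk2, trivial]
      · rintro ⟨h3, h4⟩ u hu
        by_cases hu2 : u = ancestor v u.length
        · have := h3 u.length (hS _ hu)
          simp only [C] at this
          rwa [← hu2, if_pos hu] at this
        · exact h4 u (Finset.mem_filter.2 ⟨hu, hu2⟩)
    by_cases h1 : T ∈ A
    · by_cases h2 : T ∈ Set.pi (S2 : Set (List ℕ)) B
      · rw [Set.indicator_of_mem (hiff.2 ⟨h1, h2⟩), Set.indicator_of_mem h2]
        simp [G, h1]
      · rw [Set.indicator_of_notMem fun hc => h2 (hiff.1 hc).2, Set.indicator_of_notMem h2,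
          mul_zero]
    · rw [Set.indicator_of_notMem fun hc => h1 (hiff.1 hc).1]
      simp [G, h1]
  have htree : treeLaw law e (Set.pi (S2 : Set (List ℕ)) B) =
      ∏ u ∈ S2, law (e u.length) (B u) := by
    unfold treeLaw
    exact Measure.infinitePi_pi _ fun u _ => hB u
  unfold spinalLaw
  rw [Measure.map_apply measurable_graft ((measurableSet_spine_snd n v).inter
    (measurable_fst (hbox S))), hpre, Measure.prod_prod, hspine, htree,
    ← lintegral_indicator (hbox S), lintegral_congr hsplit, lintegral_mul_box e hG S2 hB hinv,
    ENNReal.mul_div_right_comm]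

/-- The tree in which the particles of generation at least `n` have no children. -/
def trunc (n : ℕ) (T : Tree) : Tree := fun u => if u.length < n then T u else fun _ => ⊤

lemma measurable_trunc (n : ℕ) : Measurable (trunc n) := by
  refine measurable_pi_lambda _ fun u => ?_
  unfold trunc
  split_ifs
  · exact measurable_pi_apply u
  · exact measurable_const

/-- Positions up to generation `n` use only broods of generations below `n`. The sets invariant
under `trunc n` form a σ-field containing the generators of `treeField a n`. -/
lemma trunc_preimage {a : ℝ} {n : ℕ} {A : Set Tree} (hA : MeasurableSet[treeField a n] A) :
    trunc n ⁻¹' A = A := by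
  have hpos : ∀ u : List ℕ, u.length ≤ n → ∀ T, position a (trunc n T) u = position a T u := by
    intro u hu T
    refine position_congr a fun k hk => ?_
    unfold trunc
    rw [if_pos]
    rw [ancestor_length hk.le]
    omega
  let m : MeasurableSpace Tree :=
    { MeasurableSet' := fun A => trunc n ⁻¹' A = A
      measurableSet_empty := rfl
      measurableSet_compl := fun A hA => by rw [Set.preimage_compl, hA]
      measurableSet_iUnion := fun f hf => by simp_rw [Set.preimage_iUnion, hf] }
  have hle : treeField a n ≤ m := by
    refine iSup₂_le fun u hu => ?_
    rintro _ ⟨B, -, rfl⟩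
    change trunc n ⁻¹' _ = _
    ext T
    simp only [Set.mem_preimage]
    rw [hpos u hu]
  exact hle A hA

/-- The joint law, on `ℱ_n`, of the tree and of the `n`-th spine particle. -/
theorem spinalLaw_inter {e : ℕ → E} (h : GoodEnv law e) {β a : ℝ} (ha : -β ≤ a) (v : List ℕ)
    {A : Set Tree} (hA : MeasurableSet[treeField a v.length] A) :
    spinalLaw law e β a ({p | spine p.2 v.length = v} ∩ Prod.fst ⁻¹' A) =
      (∫⁻ T in A, Dv law e β a T v ∂(treeLaw law e)) /
        ENNReal.ofReal (U law e (a + β) * Real.exp (-a)) := by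
  classical
  set n := v.length with hn
  set c := ENNReal.ofReal (U law e (a + β) * Real.exp (-a)) with hc
  let μ₁ : Measure Tree := ((spinalLaw law e β a).restrict {p | spine p.2 n = v}).map Prod.fst
  let μ₂ : Measure Tree := (treeLaw law e).withDensity fun T => Dv law e β a T v / c
  have hμ₁ : ∀ A, MeasurableSet A →
      μ₁ A = spinalLaw law e β a ({p | spine p.2 n = v} ∩ Prod.fst ⁻¹' A) := by
    intro A hA
    rw [Measure.map_apply measurable_fst hA, Measure.restrict_apply (measurable_fst hA),
      Set.inter_comm]
  have hμ₂ : ∀ A, MeasurableSet A → μ₂ A = (∫⁻ T in A, Dv law e β a T v ∂(treeLaw law e)) / c := by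
    intro A hA
    rw [withDensity_apply _ hA]
    simp_rw [div_eq_mul_inv]
    rw [lintegral_mul_const _ (measurable_Dv h β a v)]
  have hfin : IsFiniteMeasure μ₁ := Measure.isFiniteMeasure_map _ _
  -- The two measures need not agree on the whole tree. After truncation it suffices to compare
  -- boxes in generations below `n`.
  have hmap : μ₁.map (trunc n) = μ₂.map (trunc n) := by
    refine measure_eq_of_boxes _ _ fun S t ht => ?_
    have hbox : MeasurableSet (Set.pi (S : Set (List ℕ)) t) :=
      MeasurableSet.pi S.countable_toSet fun u _ => ht u
    rw [Measure.map_apply (measurable_trunc n) hbox, Measure.map_apply (measurable_trunc n) hbox]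
    -- In generations at least `n` the truncated tree has empty broods, so these constraints are
    -- either always or never satisfied.
    by_cases hS : ∀ u ∈ S, ¬ u.length < n → (fun _ => ⊤) ∈ t u
    · have hpre : trunc n ⁻¹' Set.pi S t =
          Set.pi (S.filter fun u : List ℕ => u.length < n : Finset (List ℕ)) t := by
        ext T
        simp only [Set.mem_preimage, Set.mem_pi, Finset.mem_coe, Finset.mem_filter, trunc]
        constructor
        · intro hT u hu
          have := hT u hu.1
          rwa [if_pos hu.2] at this
        · intro hT u hu
          split_ifs with hun
          · exact hT u ⟨hu, hun⟩
          · exact hS u hu hun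
      have hbox' : MeasurableSet
          (Set.pi (S.filter fun u : List ℕ => u.length < n : Finset (List ℕ)) t) :=
        MeasurableSet.pi (Finset.countable_toSet _) fun u _ => ht u
      rw [hpre, hμ₁ _ hbox', hμ₂ _ hbox']
      exact spinalLaw_box h ha v _ (fun u hu => (Finset.mem_filter.1 hu).2) ht
    · have hpre : trunc n ⁻¹' Set.pi S t = ∅ := by
        push Not at hS
        obtain ⟨u, hu, hun, hut⟩ := hS
        refine Set.eq_empty_of_forall_notMem fun T hT => hut ?_
        have := hT u hu
        rwa [trunc, if_neg (not_lt.2 hun)] at this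
      rw [hpre, measure_empty, measure_empty]
  have hA' := treeField_le a n A hA
  have key : μ₁ A = μ₂ A := by
    have h1 := congrArg (fun μ => μ A) hmap
    rwa [Measure.map_apply (measurable_trunc n) hA', Measure.map_apply (measurable_trunc n) hA',
      trunc_preimage hA] at h1
  rwa [hμ₁ A hA', hμ₂ A hA'] at key

end

section

variable {E : Type*} [MeasurableSpace E] {law : Kernel E Brood} [IsMarkovKernel law]

/-! ### Change of measure and the conditional law of the spine -/

/-- Exactly one label of length `n` is the spine particle, so the joint laws sum over these
countably many labels. -/
theorem spinalLaw_preimage_fst {e : ℕ → E} (h : GoodEnv law e) {β a : ℝ} (ha : -β ≤ a) (n : ℕ)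
    {A : Set Tree} (hA : MeasurableSet[treeField a n] A) :
    spinalLaw law e β a (Prod.fst ⁻¹' A) =
      ∫⁻ T in A, D law e β a n T / ENNReal.ofReal (U law e (a + β) * Real.exp (-a))
        ∂(treeLaw law e) := by
  have hA' := treeField_le a n A hA
  have hun : Prod.fst ⁻¹' A = ⋃ v : {v : List ℕ // v.length = n},
      ({p : Tree × (ℕ → ℕ) | spine p.2 n = v} ∩ Prod.fst ⁻¹' A) := by
    ext p
    simp only [Set.mem_preimage, Set.mem_iUnion, Set.mem_inter_iff, Set.mem_ofPred_eq]
    exact ⟨fun hp => ⟨⟨spine p.2 n, length_spine _ _⟩, rfl, hp⟩, fun ⟨_, _, hp⟩ => hp⟩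
  have hterm : ∀ v : {v : List ℕ // v.length = n},
      spinalLaw law e β a ({p : Tree × (ℕ → ℕ) | spine p.2 n = v} ∩ Prod.fst ⁻¹' A) =
      (∫⁻ T in A, Dv law e β a T v ∂(treeLaw law e)) *
        (ENNReal.ofReal (U law e (a + β) * Real.exp (-a)))⁻¹ := by
    rintro ⟨v, rfl⟩
    exact spinalLaw_inter h ha v hA
  rw [hun, measure_iUnion _ fun v : {v : List ℕ // v.length = n} =>
    (measurableSet_spine_snd n v).inter (measurable_fst hA'), tsum_congr hterm,
    ENNReal.tsum_mul_right, ← lintegral_tsum fun v : {v : List ℕ // v.length = n} =>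
      (measurable_Dv h β a v).aemeasurable]
  · simp_rw [div_eq_mul_inv]
    rw [lintegral_mul_const]
    · rfl
    · exact (measurable_D_treeField h β a n).mono (treeField_le a n) le_rfl
  · intro v w hvw
    refine Set.disjoint_left.2 fun p hp hq => hvw (Subtype.ext ?_)
    exact hp.1.symm.trans hq.1

lemma lintegral_spinalLaw_fst {e : ℕ → E} (h : GoodEnv law e) {β a : ℝ} (ha : -β ≤ a) (n : ℕ)
    {f : Tree → ℝ≥0∞} (hf : Measurable[treeField a n] f) :
    ∫⁻ p, f p.1 ∂(spinalLaw law e β a) =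
      ∫⁻ T, D law e β a n T / ENNReal.ofReal (U law e (a + β) * Real.exp (-a)) * f T
        ∂(treeLaw law e) := by
  have hm := treeField_le a n
  have hf' : Measurable f := hf.mono hm le_rfl
  have hD : Measurable fun T => D law e β a n T /
      ENNReal.ofReal (U law e (a + β) * Real.exp (-a)) :=
    ((measurable_D_treeField h β a n).mono hm le_rfl).div_const _
  have htrim : ((spinalLaw law e β a).map Prod.fst).trim hm =
      ((treeLaw law e).withDensity fun T => D law e β a n T /
        ENNReal.ofReal (U law e (a + β) * Real.exp (-a))).trim hm := by
    refine @Measure.ext _ (treeField a n) _ _ fun A hA => ?_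
    rw [trim_measurableSet_eq hm hA, trim_measurableSet_eq hm hA,
      Measure.map_apply measurable_fst (hm A hA), withDensity_apply _ (hm A hA)]
    exact spinalLaw_preimage_fst h ha n hA
  rw [← lintegral_map hf' measurable_fst, ← lintegral_trim hm hf, htrim, lintegral_trim hm hf,
    lintegral_withDensity_eq_lintegral_mul _ hD hf']
  rfl

/-- The density charges no set where it vanishes, and having integral one it is almost surely finite
under `treeLaw`, hence under the spinal law on `ℱ_n`. -/
lemma ae_D_pos_lt_top {e : ℕ → E} (h : GoodEnv law e) {β a : ℝ} (ha : -β ≤ a) (n : ℕ) :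
    ∀ᵐ p ∂(spinalLaw law e β a), 0 < D law e β a n p.1 ∧ D law e β a n p.1 < ⊤ := by
  have hD := measurable_D_treeField h β a n
  have hD' : Measurable fun T => D law e β a n T := hD.mono (treeField_le a n) le_rfl
  have hP : ∀ᵐ T ∂(treeLaw law e),
      D law e β a n T / ENNReal.ofReal (U law e (a + β) * Real.exp (-a)) < ⊤ := by
    refine ae_lt_top (hD'.div_const _) ?_
    have := spinalLaw_preimage_fst h ha n (A := Set.univ) MeasurableSet.univ
    rw [Set.preimage_univ, measure_univ, setLIntegral_univ] at this
    rw [← this]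
    exact ENNReal.one_ne_top
  have hbad : MeasurableSet[treeField a n] {T | ¬ (0 < D law e β a n T ∧ D law e β a n T < ⊤)} :=
    hD ((measurableSet_Ioo (a := (0 : ℝ≥0∞)) (b := ⊤)).compl)
  have h0 : spinalLaw law e β a
      (Prod.fst ⁻¹' {T | ¬ (0 < D law e β a n T ∧ D law e β a n T < ⊤)}) = 0 := by
    rw [spinalLaw_preimage_fst h ha n hbad, ← lintegral_indicator (treeField_le a n _ hbad),
      lintegral_eq_zero_iff ((hD'.div_const _).indicator (treeField_le a n _ hbad))]
    filter_upwards [hP] with T hT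
    refine Set.indicator_apply_eq_zero.2 fun hmem => ?_
    have hmem' : ¬ (0 < D law e β a n T ∧ D law e β a n T < ⊤) := hmem
    have htop : D law e β a n T < ⊤ := by
      rw [lt_top_iff_ne_top]
      intro hc
      rw [hc, ENNReal.top_div_of_ne_top ENNReal.ofReal_ne_top] at hT
      exact lt_irrefl _ hT
    have hz : D law e β a n T = 0 := by
      by_contra hne
      exact hmem' ⟨pos_iff_ne_zero.2 hne, htop⟩
    rw [hz, ENNReal.zero_div]
  exact h0

/-- Testing on `A` in `ℱ_n`: the change of measure multiplies the ratio by `D`, leaving the integral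
of `Dv` over `A`, which is the joint law of `spinalLaw_inter`. -/
theorem condExp_spine {e : ℕ → E} (h : GoodEnv law e) {β a : ℝ} (ha : -β ≤ a) (v : List ℕ) :
    (spinalLaw law e β a)[
        {p : Tree × (ℕ → ℕ) | spine p.2 v.length = v}.indicator (fun _ => (1 : ℝ)) |
        (treeField a v.length).comap Prod.fst]
      =ᵐ[spinalLaw law e β a]
    fun p => (Dv law e β a p.1 v / D law e β a v.length p.1).toReal := by
  set n := v.length with hn
  set Q := spinalLaw law e β a with hQ
  set c := ENNReal.ofReal (U law e (a + β) * Real.exp (-a)) with hc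
  have hm : (treeField a n).comap (Prod.fst : Tree × (ℕ → ℕ) → Tree) ≤
      (inferInstance : MeasurableSpace (Tree × (ℕ → ℕ))) :=
    (MeasurableSpace.comap_mono (treeField_le a n)).trans measurable_fst.comap_le
  have hD := measurable_D_treeField h β a n
  have hDv := measurable_Dv_treeField h β a (v := v) (n := n) le_rfl
  have hr : Measurable[treeField a n] fun T => Dv law e β a T v / D law e β a n T := hDv.div hD
  have hr' : Measurable fun T => Dv law e β a T v / D law e β a n T :=
    hr.mono (treeField_le a n) le_rfl
  have hle : ∀ T, Dv law e β a T v ≤ D law e β a n T := fun T =>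
    ENNReal.le_tsum (f := fun w : {w : List ℕ // w.length = n} => Dv law e β a T w) ⟨v, rfl⟩
  -- This holds also when `D` is `0` or `⊤`, by the conventions of `ℝ≥0∞`, and makes the ratio
  -- integrable.
  have hr1 : ∀ T, Dv law e β a T v / D law e β a n T ≤ 1 := fun T =>
    ENNReal.div_le_of_le_mul (by rw [one_mul]; exact hle T)
  have hset := measurableSet_spine_snd n v
  have hgint : Integrable (fun p : Tree × (ℕ → ℕ) =>
      (Dv law e β a p.1 v / D law e β a n p.1).toReal) Q := by
    refine Integrable.of_bound (C := 1)
      (hr'.comp measurable_fst).ennreal_toReal.aestronglyMeasurable (ae_of_all _ fun p => ?_)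
    rw [Real.norm_of_nonneg ENNReal.toReal_nonneg]
    exact ENNReal.toReal_le_of_le_ofReal zero_le_one (by simpa using hr1 p.1)
  symm
  refine ae_eq_condExp_of_forall_setIntegral_eq hm
    ((integrable_const (1 : ℝ)).indicator hset) (fun s _ _ => hgint.integrableOn) ?_ ?_
  · rintro _ ⟨A, hA, rfl⟩ -
    have hA' := treeField_le a n A hA
    have hpre : MeasurableSet (Prod.fst ⁻¹' A : Set (Tree × (ℕ → ℕ))) := measurable_fst hA'
    have hP : ∀ᵐ T ∂(treeLaw law e), D law e β a n T / c < ⊤ := by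
      refine ae_lt_top ((hD.mono (treeField_le a n) le_rfl).div_const _) ?_
      have := spinalLaw_preimage_fst h ha n (A := Set.univ) MeasurableSet.univ
      rw [Set.preimage_univ, measure_univ, setLIntegral_univ] at this
      rw [← this]
      exact ENNReal.one_ne_top
    have e1 : ∫⁻ p in Prod.fst ⁻¹' A, Dv law e β a p.1 v / D law e β a n p.1 ∂Q =
        Q ({p | spine p.2 n = v} ∩ Prod.fst ⁻¹' A) := by
      rw [← lintegral_indicator hpre]
      have hi : Measurable[treeField a n]
          (A.indicator fun T => Dv law e β a T v / D law e β a n T) := hr.indicator hA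
      have h1 := lintegral_spinalLaw_fst h ha n hi
      rw [spinalLaw_inter h ha v hA, ← lintegral_indicator hA']
      refine Eq.trans (lintegral_congr fun p => rfl) (h1.trans ?_)
      rw [div_eq_mul_inv, ← lintegral_mul_const _ ((measurable_Dv h β a v).indicator hA')]
      refine lintegral_congr_ae ?_
      filter_upwards [hP] with T hT
      by_cases hTA : T ∈ A
      · rw [Set.indicator_of_mem hTA, Set.indicator_of_mem hTA]
        by_cases hz : D law e β a n T = 0
        · have hz' : Dv law e β a T v = 0 := le_antisymm ((hle T).trans hz.le) bot_le
          rw [hz, hz']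
          simp
        · have htop : D law e β a n T ≠ ⊤ := by
            intro htop
            rw [htop, ENNReal.top_div_of_ne_top ENNReal.ofReal_ne_top] at hT
            exact lt_irrefl _ hT
          rw [div_eq_mul_inv, mul_right_comm, ENNReal.mul_div_cancel hz htop]
      · rw [Set.indicator_of_notMem hTA, Set.indicator_of_notMem hTA, mul_zero, zero_mul]
    have hrf : Measurable fun p : Tree × (ℕ → ℕ) => Dv law e β a p.1 v / D law e β a n p.1 :=
      hr'.comp measurable_fst
    rw [integral_toReal hrf.aemeasurable
      (ae_of_all _ fun p => (hr1 p.1).trans_lt ENNReal.one_lt_top), e1,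
      integral_indicator_const _ hset, smul_eq_mul, mul_one, measureReal_def,
      Measure.restrict_apply hset]
  · refine Measurable.aestronglyMeasurable ?_
    exact (hr.comp (comap_measurable _)).ennreal_toReal

end

section

variable {E : Type*} [MeasurableSpace E] {law : Kernel E Brood} [IsMarkovKernel law]

/-! ### The positions along the spine -/

lemma measurable_position_spine (a : ℝ) (n : ℕ) :
    Measurable fun p : Tree × (ℕ → ℕ) => position a p.1 (spine p.2 n) := by
  intro B hB
  have : (fun p : Tree × (ℕ → ℕ) => position a p.1 (spine p.2 n)) ⁻¹' B =
      ⋃ v : List ℕ, {p | spine p.2 n = v} ∩ (fun p => position a p.1 v) ⁻¹' B := by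
    ext p
    simp
  rw [this]
  exact MeasurableSet.iUnion fun v => (measurableSet_spine_snd n v).inter
    (((measurable_position a v).comp measurable_fst) hB)

namespace GoodEnv

variable {e : ℕ → E} (h : GoodEnv law e) {β a : ℝ}

include h

/-- A child that is absent or below `-β` has weight zero and is never chosen. -/
lemma ae_spineKernel (k : ℕ) {s : SpineState} (hs : -β ≤ s.1) :
    ∀ᵐ y ∂(spineKernel law e β k s),
      -β ≤ y.1 ∧ y.2.1 y.2.2 ≠ ⊤ ∧ y.1 = s.1 + (y.2.1 y.2.2).untopD 0 := by
  have hz : Measurable fun y : SpineState => y.2.1 y.2.2 := by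
    have h1 : Measurable fun q : Brood × ℕ => q.1 q.2 :=
      measurable_from_prod_countable_left fun i => measurable_pi_apply i
    exact h1.comp measurable_snd
  let good : Set SpineState :=
    {y | -β ≤ y.1} ∩ ({y | y.2.1 y.2.2 = ⊤}ᶜ ∩ {y | y.1 = s.1 + (y.2.1 y.2.2).untopD 0})
  have hgood : MeasurableSet good :=
    (measurableSet_le measurable_const measurable_fst).inter
      ((hz (measurableSet_singleton ⊤)).compl.inter
        (measurableSet_eq_fun measurable_fst ((hz.untopD 0).const_add _)))
  have h0 : spineKernel law e β k s goodᶜ = 0 := by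
    rw [← lintegral_indicator_one hgood.compl,
      h.lintegral_spineKernel β k hs (measurable_one.indicator hgood.compl)]
    refine ENNReal.div_eq_zero_iff.2 (Or.inl ?_)
    refine (lintegral_congr fun b => ENNReal.tsum_eq_zero.2 fun i => ?_).trans lintegral_zero
    cases hb : b i with
    | top => simp [childWeight_eq, atPos_top]
    | coe z =>
      by_cases hc : -β ≤ s.1 + z
      · rw [Set.indicator_of_notMem, mul_zero]
        simp only [Set.mem_compl_iff, not_not]
        refine ⟨?_, ?_, ?_⟩
        · simpa using hc
        · simp [hb]
        · simp [hb]
      · rw [childWeight_coe, Set.indicator_of_notMem (show _ ∉ Set.Ici (-β) from hc)]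
        simp
  exact h0

lemma ae_spineLaw (ha : -β ≤ a) : ∀ᵐ s ∂(spineLaw law e β a), (s 0).1 = a ∧ ∀ n,
    (s (n + 1)).2.1 (s (n + 1)).2.2 ≠ ⊤ ∧
      (s (n + 1)).1 = (s n).1 + ((s (n + 1)).2.1 (s (n + 1)).2.2).untopD 0 := by
  have hz : Measurable fun y : SpineState => y.2.1 y.2.2 := by
    have h1 : Measurable fun q : Brood × ℕ => q.1 q.2 :=
      measurable_from_prod_countable_left fun i => measurable_pi_apply i
    exact h1.comp measurable_snd
  have h0 := chainLaw_zero (spineKernel law e β) (a, fun _ => ⊤, 0)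
  -- The kernel is controlled only above `-β`, so this bound is carried along inductively with the
  -- other two properties.
  have hstep : ∀ n, (∀ᵐ s ∂(spineLaw law e β a), -β ≤ (s n).1) →
      ∀ᵐ s ∂(spineLaw law e β a), -β ≤ (s (n + 1)).1 ∧
        (s (n + 1)).2.1 (s (n + 1)).2.2 ≠ ⊤ ∧
        (s (n + 1)).1 = (s n).1 + ((s (n + 1)).2.1 (s (n + 1)).2.2).untopD 0 := by
    intro n hn
    let good : Set ((ℕ → SpineState) × SpineState) :=
      {p | -β ≤ p.2.1} ∩ ({p | p.2.2.1 p.2.2.2 = ⊤}ᶜ ∩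
        {p | p.2.1 = (p.1 n).1 + (p.2.2.1 p.2.2.2).untopD 0})
    have hz2 : Measurable fun p : (ℕ → SpineState) × SpineState => p.2.2.1 p.2.2.2 :=
      hz.comp measurable_snd
    have hgood : MeasurableSet good :=
      (measurableSet_le measurable_const (by fun_prop)).inter
        ((hz2 (measurableSet_singleton ⊤)).compl.inter
          (measurableSet_eq_fun (by fun_prop)
            ((by fun_prop : Measurable fun p : (ℕ → SpineState) × SpineState => (p.1 n).1).add
              (hz2.untopD 0))))
    have hF : Measurable (goodᶜ.indicator (1 : (ℕ → SpineState) × SpineState → ℝ≥0∞)) :=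
      measurable_one.indicator hgood.compl
    have h1 := lintegral_chainLaw_succ (spineKernel law e β) (a, fun _ => ⊤, 0) n hF
    have h2 : ∫⁻ s, ∫⁻ y, goodᶜ.indicator (1 : (ℕ → SpineState) × SpineState → ℝ≥0∞)
        (freeze n s, y) ∂(spineKernel law e β n (s n))
        ∂(chainLaw (spineKernel law e β) (a, fun _ => ⊤, 0)) = 0 := by
      have hn' : ∀ᵐ s ∂(chainLaw (spineKernel law e β) (a, fun _ => ⊤, 0)), -β ≤ (s n).1 := hn
      rw [lintegral_congr_ae (g := fun _ => 0), lintegral_zero]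
      filter_upwards [hn'] with s hs
      rw [lintegral_congr_ae (g := fun _ => 0), lintegral_zero]
      filter_upwards [h.ae_spineKernel n hs] with y hy
      have hmem : (freeze n s, y) ∈ good := ⟨hy.1, hy.2.1, by simpa [freeze] using hy.2.2⟩
      exact Set.indicator_of_notMem (s := goodᶜ) (fun hc => hc hmem) _
    rw [h2] at h1
    have hmf : Measurable fun s : ℕ → SpineState => (freeze n s, s (n + 1)) := by fun_prop
    have h3 := (lintegral_eq_zero_iff (hF.comp hmf)).1 h1
    have h3' : ∀ᵐ s ∂(spineLaw law e β a),
        goodᶜ.indicator (1 : (ℕ → SpineState) × SpineState → ℝ≥0∞) (freeze n s, s (n + 1)) = 0 := h3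
    filter_upwards [h3'] with s hs
    have hs2 : (freeze n s, s (n + 1)) ∈ good := by
      by_contra hc
      rw [Set.indicator_of_mem hc] at hs
      exact one_ne_zero hs
    refine ⟨hs2.1, hs2.2.1, ?_⟩
    have := hs2.2.2
    simpa [freeze] using this
  have hbd : ∀ n, ∀ᵐ s ∂(spineLaw law e β a), -β ≤ (s n).1 := by
    intro n
    induction n with
    | zero =>
      have h0' : ∀ᵐ s ∂(spineLaw law e β a), s 0 = (a, fun _ => ⊤, 0) := h0
      filter_upwards [h0'] with s hs
      rw [hs]
      exact ha
    | succ n ih => exact (hstep n ih).mono fun s hs => hs.1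
  have h0' : ∀ᵐ s ∂(spineLaw law e β a), s 0 = (a, fun _ => ⊤, 0) := h0
  have hall : ∀ᵐ s ∂(spineLaw law e β a), ∀ n, -β ≤ (s (n + 1)).1 ∧
        (s (n + 1)).2.1 (s (n + 1)).2.2 ≠ ⊤ ∧
        (s (n + 1)).1 = (s n).1 + ((s (n + 1)).2.1 (s (n + 1)).2.2).untopD 0 :=
    ae_all_iff.2 fun n => hstep n (hbd n)
  filter_upwards [h0', hall] with s hs hs2
  exact ⟨by rw [hs], fun n => (hs2 n).2⟩

/-- The chain moves by `untopD 0`, the tree by addition in `WithTop ℝ`. They agree since the chosen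
children almost surely exist. -/
lemma position_graft (ha : -β ≤ a) :
    ∀ᵐ p ∂((spineLaw law e β a).prod (treeLaw law e)), ∀ n,
      position a (graft p).1 (spine (graft p).2 n) = (((p.1 n).1 : ℝ) : WithTop ℝ) := by
  have h1 : ∀ᵐ p ∂((spineLaw law e β a).prod (treeLaw law e)), (p.1 0).1 = a ∧ ∀ n,
      (p.1 (n + 1)).2.1 (p.1 (n + 1)).2.2 ≠ ⊤ ∧
      (p.1 (n + 1)).1 = (p.1 n).1 + ((p.1 (n + 1)).2.1 (p.1 (n + 1)).2.2).untopD 0 :=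
    Measure.quasiMeasurePreserving_fst.ae (h.ae_spineLaw ha)
  filter_upwards [h1] with p hp n
  induction n with
  | zero => rw [hp.1]; rfl
  | succ n ih =>
    have hg : (graft p).1 (spine (graft p).2 n) = (p.1 (n + 1)).2.1 := by
      change (if spine (graft p).2 n = spine _ (spine (graft p).2 n).length then
        (p.1 ((spine (graft p).2 n).length + 1)).2.1 else _) = _
      rw [length_spine]
      exact if_pos rfl
    have hl : (graft p).2 n = (p.1 (n + 1)).2.2 := rfl
    obtain ⟨z, hz⟩ := WithTop.ne_top_iff_exists.1 (hp.2 n).1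
    rw [spine, position, ih, hg, hl, (hp.2 n).2, ← hz, WithTop.untopD_coe, WithTop.coe_add]

/-- The spine chain observed through its position satisfies the hypothesis of
`lintegral_chainLaw_eq_walk`: by many-to-one, the factor `e^{-x}` cancels. -/
lemma lintegral_spineLaw_fst (ha : -β ≤ a) (n : ℕ) {f : (ℕ → ℝ) → ℝ≥0∞} (hf : Measurable f) :
    ∫⁻ s, f (freeze n fun k => (s k).1) ∂(spineLaw law e β a) =
      ∫⁻ X, f (freeze n (path a X)) *
        {s : ℕ → ℝ | ∀ k ≤ n, -β ≤ s k}.indicator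
          (fun s => level law e β n (s n) / level law e β 0 a) (path a X)
        ∂(Measure.infinitePi (steps law e)) := by
  have := h.isProbabilityMeasure
  refine lintegral_chainLaw_eq_walk (spineKernel law e β) (a, fun _ => ⊤, 0) Prod.fst
    measurable_fst (steps law e) (level law e β) (h.measurable_level β) β
    (fun n x hx => h.level_ne_zero n hx) (fun n x hx => ENNReal.ofReal_ne_top) ?_ ha n hf
  intro k s hs g hg
  have hgf : Measurable fun y : SpineState => g y.1 := hg.comp measurable_fst
  rw [h.lintegral_spineKernel β k hs hgf]
  change (∫⁻ b, ∑' i, childWeight law e β k s.1 (b i) * g (s.1 + (b i).untopD 0) ∂(law (e k))) / _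
    = _
  have hl := (h.measurable_level β (k + 1)).indicator (measurableSet_Ici (a := -β))
  have hm : Measurable fun z => g (s.1 + z) *
      (Set.Ici (-β)).indicator (level law e β (k + 1)) (s.1 + z) :=
    (hg.comp (by fun_prop)).mul (hl.comp (by fun_prop))
  rw [h.lintegral_tsum_childWeight β k s.1 hg, ENNReal.ofReal_mul' (Real.exp_nonneg _), mul_comm,
    ENNReal.mul_div_mul_right _ _ (ENNReal.ofReal_pos.2 (Real.exp_pos _)).ne'
      ENNReal.ofReal_ne_top]
  simp_rw [div_eq_mul_inv]
  rw [← lintegral_mul_const _ hm]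
  simp_rw [mul_assoc]
  rfl

lemma lintegral_condWalkLaw (ha : -β ≤ a) (n : ℕ) {f : (ℕ → ℝ) → ℝ≥0∞} (hf : Measurable f) :
    ∫⁻ s, f (freeze n s) ∂(condWalkLaw law e β a) =
      ∫⁻ X, f (freeze n (path a X)) *
        {s : ℕ → ℝ | ∀ k ≤ n, -β ≤ s k}.indicator
          (fun s => level law e β n (s n) / level law e β 0 a) (path a X)
        ∂(Measure.infinitePi (steps law e)) := by
  have := h.isProbabilityMeasure
  exact lintegral_chainLaw_eq_walk (condKernel law e β) a id
    measurable_id (steps law e) (level law e β) (h.measurable_level β) β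
    (fun n x hx => h.level_ne_zero n hx) (fun n x hx => ENNReal.ofReal_ne_top)
    (fun k x hx g hg => h.lintegral_condKernel β k hx hg) ha n hf

lemma map_fst_spineLaw (ha : -β ≤ a) :
    (spineLaw law e β a).map (fun s n => (s n).1) = condWalkLaw law e β a := by
  have hm : Measurable fun (s : ℕ → SpineState) (n : ℕ) => (s n).1 := by fun_prop
  have : IsFiniteMeasure ((spineLaw law e β a).map fun s n => (s n).1) :=
    Measure.isFiniteMeasure_map _ _
  refine measure_eq_of_boxes _ _ fun S t ht => ?_
  have hbox : MeasurableSet (Set.pi (S : Set ℕ) t) :=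
    MeasurableSet.pi S.countable_toSet fun u _ => ht u
  -- A finite box does not see times beyond `S.sup id`, so the formula for frozen paths decides its
  -- measure.
  have hfr : ∀ s : ℕ → ℝ, (Set.pi (S : Set ℕ) t).indicator (1 : (ℕ → ℝ) → ℝ≥0∞)
      (freeze (S.sup id) s) = (Set.pi (S : Set ℕ) t).indicator 1 s := by
    intro s
    have : freeze (S.sup id) s ∈ Set.pi (S : Set ℕ) t ↔ s ∈ Set.pi (S : Set ℕ) t :=
      forall₂_congr fun k hk => by rw [freeze_of_le
        (show k ≤ S.sup id from Finset.le_sup (f := id) hk)]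
    by_cases hs : s ∈ Set.pi (S : Set ℕ) t
    · rw [Set.indicator_of_mem hs, Set.indicator_of_mem (this.2 hs)]; rfl
    · rw [Set.indicator_of_notMem hs, Set.indicator_of_notMem fun hc => hs (this.1 hc)]
  have hI : Measurable ((Set.pi (S : Set ℕ) t).indicator (1 : (ℕ → ℝ) → ℝ≥0∞)) :=
    measurable_one.indicator hbox
  have h1 := h.lintegral_spineLaw_fst ha (S.sup id) hI
  rw [← h.lintegral_condWalkLaw ha (S.sup id) hI] at h1
  simp_rw [hfr] at h1
  rw [← lintegral_map hI hm, lintegral_indicator_one hbox, lintegral_indicator_one hbox] at h1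
  exact h1

theorem map_position_spine (ha : -β ≤ a) :
    (spinalLaw law e β a).map (fun p n => position a p.1 (spine p.2 n)) =
      (condWalkLaw law e β a).map (fun s n => ((s n : ℝ) : WithTop ℝ)) := by
  have hm : Measurable fun (p : Tree × (ℕ → ℕ)) (n : ℕ) => position a p.1 (spine p.2 n) :=
    measurable_pi_lambda _ fun n => measurable_position_spine a n
  have hfst : Measurable fun (s : ℕ → SpineState) (n : ℕ) => (s n).1 := by fun_prop
  have hcoe : Measurable fun (s : ℕ → ℝ) (n : ℕ) => ((s n : ℝ) : WithTop ℝ) :=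
    measurable_pi_lambda _ fun n => (measurable_pi_apply n).withTop_coe
  rw [← h.map_fst_spineLaw ha, Measure.map_map hcoe hfst]
  unfold spinalLaw
  rw [Measure.map_map hm measurable_graft,
    Measure.map_congr (g := ((fun (s : ℕ → ℝ) (n : ℕ) => ((s n : ℝ) : WithTop ℝ)) ∘
      fun (s : ℕ → SpineState) (n : ℕ) => (s n).1) ∘ Prod.fst),
    ← Measure.map_map (hcoe.comp hfst) measurable_fst, Measure.map_fst_prod, measure_univ, one_smul]
  filter_upwards [h.position_graft ha] with p hp
  exact funext hp

theorem lintegral_position_spine (ha : -β ≤ a) (n : ℕ) {f : (Fin (n + 1) → ℝ) → ℝ≥0∞}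
    (hf : Measurable f) :
    ∫⁻ p, f (fun k => (position a p.1 (spine p.2 k)).untopD 0) ∂(spinalLaw law e β a) =
      ∫⁻ s, f (fun k => s k) * {s : ℕ → ℝ | ∀ k ≤ n, -β ≤ s k}.indicator
        (fun s => ENNReal.ofReal (U law (shift n e) (s n + β) / U law e (a + β))) s
        ∂(walkLaw law e a) := by
  have hm : Measurable fun p : Tree × (ℕ → ℕ) =>
      f fun k => (position a p.1 (spine p.2 k)).untopD 0 :=
    hf.comp (measurable_pi_lambda _ fun k => (measurable_position_spine a k).untopD 0)
  have hF : Measurable fun s : ℕ → ℝ => f fun k => s k := hf.comp (by fun_prop)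
  have hU := h.measurable_U n
  have hset : MeasurableSet {s : ℕ → ℝ | ∀ k ≤ n, -β ≤ s k} := by
    have : {s : ℕ → ℝ | ∀ k ≤ n, -β ≤ s k} = ⋂ k, ⋂ (_ : k ≤ n), {s | -β ≤ s k} := by
      ext; simp
    rw [this]
    exact MeasurableSet.iInter fun k => MeasurableSet.iInter fun _ =>
      measurableSet_le measurable_const (measurable_pi_apply k)
  have hW : Measurable fun s : ℕ → ℝ => f (fun k => s k) *
      {s : ℕ → ℝ | ∀ k ≤ n, -β ≤ s k}.indicator
        (fun s => ENNReal.ofReal (U law (shift n e) (s n + β) / U law e (a + β))) s :=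
    hF.mul ((((hU.comp (by fun_prop)).div_const _).ennreal_ofReal).indicator hset)
  have hfz : ∀ s : ℕ → ℝ, (f fun k : Fin (n + 1) => freeze n s k) = f fun k => s k := by
    intro s
    congr 1
    funext k
    exact freeze_of_le (Nat.lt_succ_iff.1 k.2) s
  have hUa : 0 < U law e (a + β) := h.U_pos 0 (by linarith)
  have key := h.lintegral_spineLaw_fst ha n hF
  simp_rw [hfz] at key
  have hfst : Measurable fun s : ℕ → SpineState => f fun k : Fin (n + 1) => (s k).1 :=
    hF.comp (by fun_prop : Measurable fun (s : ℕ → SpineState) (k : ℕ) => (s k).1)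
  have hfst2 : Measurable fun p : (ℕ → SpineState) × Tree =>
      f fun k : Fin (n + 1) => (p.1 k).1 := hfst.comp measurable_fst
  rw [walkLaw_eq, lintegral_map hW (measurable_path a)]
  unfold spinalLaw
  rw [lintegral_map hm measurable_graft,
    lintegral_congr_ae (g := fun p => f fun k : Fin (n + 1) => (p.1 k).1),
    lintegral_prod _ hfst2.aemeasurable]
  · simp only [lintegral_const, measure_univ, mul_one]
    rw [key]
    refine lintegral_congr fun X => ?_
    congr 1
    by_cases hX : path a X ∈ {s : ℕ → ℝ | ∀ k ≤ n, -β ≤ s k}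
    · rw [Set.indicator_of_mem hX, Set.indicator_of_mem hX, ENNReal.ofReal_div_of_pos hUa]
      rfl
    · rw [Set.indicator_of_notMem hX, Set.indicator_of_notMem hX]
  · filter_upwards [h.position_graft ha] with p hp
    congr 1
    funext k
    rw [hp k, WithTop.untopD_coe]

end GoodEnv

end

end

end BRWRE

/-! ### Assembly: the law of the spine for almost every environment -/

theorem mainTheorem6 {E Ω : Type*} [MeasurableSpace E] [MeasurableSpace Ω]
    (P : Measure Ω) [IsProbabilityMeasure P]
    -- the point process laws, and the i.i.d. environment (`ξ k` governs the broods of generation `k`)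
    (law : Kernel E BRWRE.Brood) [IsMarkovKernel law]
    (ξ : ℕ → Ω → E) (hξ : ∀ n, Measurable (ξ n))
    (hindep : iIndepFun ξ P) (hident : ∀ n, IdentDistrib (ξ n) (ξ 0) P P)
    -- non-extinction and non-triviality
    (hsurv : ∀ᵐ ω ∂P, law (ξ 0 ω) {b | 1 ≤ BRWRE.childSum (fun _ => 1) b} = 1)
    (hbranch : 0 < P {ω | 0 < law (ξ 0 ω) {b | 1 < BRWRE.childSum (fun _ => 1) b}})
    (hpos : ∀ᵐ ω ∂P, 0 < ∫⁻ b, BRWRE.childSum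
      ((Set.Ioi (0 : ℝ)).indicator fun x => ENNReal.ofReal (Real.exp (-x))) b ∂(law (ξ 0 ω)))
    -- the boundary case
    (hadd : ∀ᵐ ω ∂P,
      ∫⁻ b, BRWRE.childSum (fun x => ENNReal.ofReal (Real.exp (-x))) b ∂(law (ξ 0 ω)) = 1)
    (hder : ∀ᵐ ω ∂P,
      ∫ b, ∑' i, BRWRE.atPos (fun x : ℝ => x * Real.exp (-x)) (b i) ∂(law (ξ 0 ω)) = 0)
    -- the moment condition
    (δ : ℝ) (hδ : 0 < δ)
    (hmom : ∫⁻ ω, ∫⁻ b, BRWRE.childSum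
      (fun x => ENNReal.ofReal (|x| ^ (2 + δ) * Real.exp (-x))) b ∂(law (ξ 0 ω)) ∂P < ⊤) :
    ∀ᵐ ω ∂P, ∀ e : ℕ → E, e = (fun n => ξ n ω) →
      -- the harmonic function is well defined and positive
      (∀ (n : ℕ) (y : ℝ), 0 ≤ y → 0 < BRWRE.U law (BRWRE.shift n e) y ∧
        Tendsto (fun m => BRWRE.Un law m (BRWRE.shift n e) y) atTop
          (𝓝 (BRWRE.U law (BRWRE.shift n e) y))) ∧
      ∀ β a : ℝ, 0 ≤ β → 0 ≤ a →
      -- the marginal on trees has density `D_n / (U(ξ, a + β) e^{-a})` on `ℱ_n`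
      (∀ (n : ℕ) (A : Set BRWRE.Tree), MeasurableSet[BRWRE.treeField a n] A →
        BRWRE.spinalLaw law e β a (Prod.fst ⁻¹' A) =
          ∫⁻ T in A, BRWRE.D law e β a n T /
            ENNReal.ofReal (BRWRE.U law e (a + β) * Real.exp (-a)) ∂(BRWRE.treeLaw law e)) ∧
      -- (1) the conditional law of `w_n` given `ℱ_n`
      (∀ n : ℕ, (∀ᵐ p ∂(BRWRE.spinalLaw law e β a),
          0 < BRWRE.D law e β a n p.1 ∧ BRWRE.D law e β a n p.1 < ⊤) ∧
        ∀ v : List ℕ, v.length = n →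
          (BRWRE.spinalLaw law e β a)[
              {p : BRWRE.Tree × (ℕ → ℕ) | BRWRE.spine p.2 n = v}.indicator (fun _ => (1 : ℝ)) |
              (BRWRE.treeField a n).comap Prod.fst]
            =ᵐ[BRWRE.spinalLaw law e β a]
          fun p => (BRWRE.Dv law e β a p.1 v / BRWRE.D law e β a n p.1).toReal) ∧
      -- (2) the positions along the spine form the conditioned random walk
      (BRWRE.spinalLaw law e β a).map (fun p n => BRWRE.position a p.1 (BRWRE.spine p.2 n)) =
        (BRWRE.condWalkLaw law e β a).map (fun s n => ((s n : ℝ) : WithTop ℝ)) ∧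
      ∀ (n : ℕ) (f : (Fin (n + 1) → ℝ) → ℝ≥0∞), Measurable f →
        ∫⁻ p, f (fun k => (BRWRE.position a p.1 (BRWRE.spine p.2 k)).untopD 0)
            ∂(BRWRE.spinalLaw law e β a) =
          ∫⁻ s, f (fun k => s k) *
            {s : ℕ → ℝ | ∀ k ≤ n, -β ≤ s k}.indicator
              (fun s => ENNReal.ofReal
                (BRWRE.U law (BRWRE.shift n e) (s n + β) / BRWRE.U law e (a + β))) s
            ∂(BRWRE.walkLaw law e a) := by
  -- The null set is fixed here, before `β`, `a` and `n`; the rest is deterministic in the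
  -- environment.
  filter_upwards [BRWRE.ae_goodEnv P ξ hξ hindep hident hpos hadd hder hδ hmom] with ω hω
  rintro e rfl
  refine ⟨fun n y hy => ⟨hω.U_pos n hy, hω.tendsto_Un n hy⟩, fun β a hβ ha => ?_⟩
  have ha' : -β ≤ a := by linarith
  refine ⟨fun n A hA => BRWRE.spinalLaw_preimage_fst hω ha' n hA,
    fun n => ⟨BRWRE.ae_D_pos_lt_top hω ha' n, ?_⟩, hω.map_position_spine ha',
    fun n f hf => hω.lintegral_position_spine ha' n hf⟩
  rintro v rfl
  exact BRWRE.condExp_spine hω ha' v
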